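/- Let $(\mathbb X,\mathcal X)$ be a measurable space with a $\sigma$-finite measure $\lambda$. For each $t>0$ let $\eta_t$ be a Poisson process on $\mathbb X$ with intensity measure $t\lambda$, i.e. a random element of the space of integer-valued (the value $\infty$ being allowed) $\sigma$-finite measures on $\mathbb X$ that takes independent values on disjoint measurable sets and for which $\eta_t(B)$ is Poisson distributed with mean $t\lambda(B)$ whenever $\lambda(B)<\infty$; all $\eta_t$ are defined on one probability space. For an integer-valued $\sigma$-finite measure $\mu$ let $\mu^{(m)}$ be its $m$-th factorial measure on $\mathbb X^m$, $$\mu^{(m)}(B)=\int\!\cdots\!\int \mathbf 1_B(x_1,\dots,x_m)\Big(\mu-\sum_{j=1}^{m-1}\delta_{x_j}\Big)(dx_m)\cdots(\mu-\delta_{x_1})(dx_2)\,\mu(dx_1).$$ Let $\ell\in\mathbb N$ and, for $i=1,\dots,\ell$, let $m_i\ge 1$ be an integer, let $f^{(i)}:\mathbb X^{m_i}\to\mathbb R$ be measurable, symmetric and $\lambda^{m_i}$-integrable, and let $g_i$ be a real function on $(0,\infty)$. Put $$F^{(i)}_t=g_i(t)\int f^{(i)}\,d\eta_t^{(m_i)},\qquad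 \hat F^{(i)}_t=g_i(t)^{-1}\,t^{-(m_i-1/2)}\big(F^{(i)}_t-\mathbb E F^{(i)}_t\big),$$ the latter if $g_i(t)\neq 0$, and, for $1\le n\le m_i$, $$f^{(i)}_n(x_1,\dots,x_n)=\binom{m_i}{n}\int f^{(i)}(x_1,\dots,x_n,y_1,\dots,y_{m_i-n})\,\lambda^{m_i-n}\big(d(y_1,\dots,y_{m_i-n})\big).$$ Assume that $f^{(i)}_n\in L^2(\lambda^n)$ for all $1\le n\le m_i$ and that $\int|f^{(i)}_1|^3\,d\lambda<\infty$, for every $i$. Let $N$ be an $\ell$-dimensional centred (possibly degenerate) Gaussian random vector with covariance matrix $C_{ij}=\int f_1^{(i)}f_1^{(j)}\,d\lambda$. For $\ell$-dimensional random vectors $Y,Z$ let $$d_3(Y,Z)=\sup_{h}|\mathbb E h(Y)-\mathbb E h(Z)|,$$ where the supremum is over all $h\in C^3(\mathbb R^\ell)$ all of whose second and third order partial derivatives are bounded by $1$ in absolute value. Then, for all $t>0$ and all $i$, $f^{(i)}$ is almost surely $\eta_t^{(m_i)}$-integrable and $F^{(i)}_t$ is square integrable, and there is a constant $\tilde c>0$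 such that $$d_3\big((\hat F^{(1)}_t,\dots,\hat F^{(\ell)}_t),N\big)\le \tilde c\,t^{-1/2}$$ for all $t\ge 1$ with $g_i(t)\ne 0$ for $i=1,\dots,\ell$. -/

import Mathlib

open MeasureTheory ProbabilityTheory
open scoped ENNReal NNReal

noncomputable section

namespace PoissonU

variable {X : Type*} [MeasurableSpace X]

/-- The integer-valued (the value `∞` being allowed) `σ`-finite measures on `X`. -/
def IsPointMeasure (μ : Measure X) : Prop :=
  SigmaFinite μ ∧ ∀ B : Set X, MeasurableSet B → ∃ n : ℕ∞, μ B = (n : ℝ≥0∞)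

/-- `η` is a Poisson process on `X` with intensity measure `Λ`: a random element of the space of
integer-valued `σ`-finite measures (with the `σ`-field generated by the evaluations, which is the
one that Mathlib puts on `Measure X`) that has independent values on disjoint sets, and whose value
on a set of finite intensity is Poisson distributed. -/
structure IsPoissonProcess {Ω : Type*} [MeasurableSpace Ω] (η : Ω → Measure X) (Λ : Measure X)
    (P : Measure Ω) : Prop where
  measurable : Measurable η
  isPointMeasure : ∀ ω, IsPointMeasure (η ω)
  hasLaw : ∀ B : Set X, MeasurableSet B → Λ B < ∞ →
    HasLaw (fun ω => η ω B)
      ((poissonMeasure (Λ B).toNNReal).map (fun n : ℕ => (n : ℝ≥0∞))) P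
  indep : ∀ (k : ℕ) (B : Fin k → Set X), (∀ i, MeasurableSet (B i)) →
    Pairwise (fun i j => Disjoint (B i) (B j)) → iIndepFun (fun i ω => η ω (B i)) P

/-- The recursion from `ρ = μ^{(m)}` to `ν = μ^{(m+1)}`:
`ν(B) = ∫ (∫ 1_B(x₁,…,xₘ,y) (μ - δ_{x₁} - ⋯ - δ_{xₘ})(dy)) ρ(d(x₁,…,xₘ))`.
For integer-valued `σ`-finite `μ` and any fixed measurable `B` the inner integral is nonnegative for
`ρ`-almost every `(x₁,…,xₘ)`, and only a finite number is subtracted, so that the subtraction in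
`ℝ≥0∞` is the true one. -/
def IsFactorialStep (μ : Measure X) {m : ℕ} (ρ : Measure (Fin m → X))
    (ν : Measure (Fin (m + 1) → X)) : Prop :=
  ∀ B : Set (Fin (m + 1) → X), MeasurableSet B →
    ν B = ∫⁻ x : Fin m → X,
      (μ {y | (Fin.snoc x y : Fin (m + 1) → X) ∈ B}
        - ∑ j : Fin m, B.indicator (fun _ => (1 : ℝ≥0∞)) (Fin.snoc x (x j) : Fin (m + 1) → X)) ∂ρ

open Classical in
/-- The factorial measure `μ^{(m)}` on `X^m`: at each step the unique measure that satisfies the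
recursion `IsFactorialStep`, which exists for every integer-valued `σ`-finite `μ`. The start is the
unit mass on the one-point space `X^0`, so that `μ^{(1)} = μ`. -/
def factorialMeasure (μ : Measure X) : (m : ℕ) → Measure (Fin m → X)
  | 0 => Measure.dirac Fin.elim0
  | m + 1 => if h : ∃ ν, IsFactorialStep μ (factorialMeasure μ m) ν then h.choose else 0

/-- `f ∈ L¹_s(lam^m)`: measurable, symmetric and integrable. -/
def IsSymmKernel (lam : Measure X) (m : ℕ) (f : (Fin m → X) → ℝ) : Prop :=
  Measurable f ∧ (∀ (s : Equiv.Perm (Fin m)) (x : Fin m → X), f (x ∘ s) = f x) ∧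
    Integrable f (Measure.pi fun _ => lam)

/-- `(x₁,…,xₙ,y₁,…,y_{m-n})` as an element of `X^m`. -/
def glue {m n : ℕ} (x : Fin n → X) (y : Fin (m - n) → X) : Fin m → X :=
  fun j => if h : (j : ℕ) < n then x ⟨j, h⟩ else y ⟨j - n, by omega⟩

/-- `fₙ(x₁,…,xₙ) = (m choose n) ∫ f(x₁,…,xₙ,y₁,…,y_{m-n}) lam^{m-n}(dy)`, used for `n ≤ m`. -/
def projKernel (lam : Measure X) {m : ℕ} (f : (Fin m → X) → ℝ) (n : ℕ) (x : Fin n → X) : ℝ :=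
  (m.choose n : ℝ) * ∫ y : Fin (m - n) → X, f (glue x y) ∂(Measure.pi fun _ => lam)

/-- The kernel `f₁` as a function on `X`. -/
def projKernelOne (lam : Measure X) {m : ℕ} (f : (Fin m → X) → ℝ) (x : X) : ℝ :=
  projKernel lam f 1 (fun _ => x)

/-- The Poisson U-statistic `a ∫ f dη^{(m)}`. -/
def uStat {Ω : Type*} (η : Ω → Measure X) (a : ℝ) {m : ℕ} (f : (Fin m → X) → ℝ) (ω : Ω) : ℝ :=
  a * ∫ x, f x ∂(factorialMeasure (η ω) m)

/-- The normalized U-statistic `a⁻¹ t^{-(m-1/2)} (F - E F)` with `F = a ∫ f dη^{(m)}`. -/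
def normUStat {Ω : Type*} [MeasurableSpace Ω] (P : Measure Ω) (η : Ω → Measure X) (t a : ℝ) {m : ℕ}
    (f : (Fin m → X) → ℝ) (ω : Ω) : ℝ :=
  a⁻¹ * t ^ (-((m : ℝ) - 1 / 2)) * (uStat η a f ω - ∫ ω', uStat η a f ω' ∂P)

/-- The standard basis vector `eᵢ` of `ℝ^ℓ`. -/
abbrev basisVec {l : ℕ} (i : Fin l) : EuclideanSpace ℝ (Fin l) := EuclideanSpace.single i 1

/-- The class of test functions: `h ∈ C³(ℝ^ℓ)` with all second and third order partial derivatives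
bounded by `1` in absolute value. -/
def testFunctions (l : ℕ) : Set (EuclideanSpace ℝ (Fin l) → ℝ) :=
  {h | ContDiff ℝ 3 h ∧
    (∀ i j : Fin l, i ≤ j → ∀ x, |iteratedFDeriv ℝ 2 h x ![basisVec i, basisVec j]| ≤ 1) ∧
    (∀ i j k : Fin l, i ≤ j → j ≤ k →
      ∀ x, |iteratedFDeriv ℝ 3 h x ![basisVec i, basisVec j, basisVec k]| ≤ 1)}

/-- `d₃(Y, Z) = sup |E h(Y) - E h(Z)|` over the test functions `h`, for (square integrable) random
vectors `Y`, `Z` on probability spaces `(Ω, P)`, `(Ω', Q)`. -/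
def d3 {l : ℕ} {Ω Ω' : Type*} [MeasurableSpace Ω] [MeasurableSpace Ω']
    (P : Measure Ω) (Y : Ω → EuclideanSpace ℝ (Fin l))
    (Q : Measure Ω') (Z : Ω' → EuclideanSpace ℝ (Fin l)) : ℝ≥0∞ :=
  ⨆ h ∈ testFunctions l, ENNReal.ofReal |(∫ ω, h (Y ω) ∂P) - ∫ ω, h (Z ω) ∂Q|

end PoissonU

end

/-!
# Normal approximation of vectors of Poisson U-statistics in the distance `d₃`

The argument is elementary: it avoids Malliavin calculus and Stein's method by treating the part of
first order, which is infinitely divisible, separately from the parts of higher order, which are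
small.

*Chaos decomposition.* On products of disjoint sets the values of the factorial measure `η^{(n)}`
are falling factorials of the numbers of points (`HasCellValues`), and the mean of `η^{(n)}` is
`Λ^n` (`IsPoissonProcess.bind_factProc`). Multiple Wiener-Itô integrals with respect to the
compensated process are defined as alternating binomial sums of integrals with respect to factorial
measures and powers of `Λ` (`chaos`); binomial inversion then expresses `∫ f dη^{(m)}` through the
multiple integrals of the kernels that arise from `f` by integration over some of the variables
(`integral_factProc_eq_sum_chaosPart`). For step functions the multiple integrals are compensated
sums of independent Poisson variables, for which the isometry follows from the Mecke formula
(`integral_cellInt_sq`); a density argument bounds the `L²` norm in general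
(`IsPoissonProcess.eLpNorm_two_chaos_le`).

*Reduction to first order.* For the intensity measure `t • lam`, the multiple integral of order `n`
in the decomposition of the U-statistic has `L²` norm at most a constant times `t^{m - n/2}`. After
normalization, the orders `n ≥ 2` together form a centred remainder with `L²` norm of order
`t^{-1/2}` (`IsPoissonProcess.exists_remainder`). A test function has bounded second derivatives but
not necessarily bounded first derivatives; as the remainder is centred, the derivative at the origin
may be subtracted, and the remainder changes the expectation of the test function by at most
`O(t^{-1/2})` (`HasBoundedDerivs.abs_integral_add_sub_le`).

*Normal approximation of the first order.* By the exponential formula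
(`IsPoissonProcess.integral_exp`), the law of the vector of the normalized first-order integrals is
the `n`-th convolution power of the corresponding law for the intensity measure `(t / n) • lam`.
With `n = ⌈t⌉`, each of the factors has third absolute moment of the order `t^{-3/2}`, and its first
and second moments are those of a Gaussian law, of which the law of `N` is the `n`-th convolution
power. Replacing one factor at a time costs `O(t^{-3/2})` for each of at most `2 t` factors, hence
`O(t^{-1/2})` in total (`HasBoundedDerivs.abs_integral_convPow_sub_le`,
`abs_integral_linearVector_sub_le`).
-/

open Set Filter Topology
set_option linter.unusedSectionVars false

namespace PoissonU

section Factorial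

variable {X : Type*} [MeasurableSpace X]

/-! ### Approximation by sets that depend on a finite partition -/

/-- A subset of `X^n` that depends on `x` only through the cells `φ x₁, …, φ xₙ` of a finite
measurable partition of `X`, encoded as a measurable map `φ` to some `Fin r`. -/
def IsGridSet (n : ℕ) (S : Set (Fin n → X)) : Prop :=
  ∃ (r : ℕ) (φ : X → Fin r), Measurable φ ∧ ∃ T : Set (Fin n → Fin r),
    S = (fun x j => φ (x j)) ⁻¹' T

lemma exists_common_refinement {r r' : ℕ} {φ : X → Fin r} {φ' : X → Fin r'}
    (hφ : Measurable φ) (hφ' : Measurable φ') :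
    ∃ (q : ℕ) (ψ : X → Fin q) (p : Fin q → Fin r) (p' : Fin q → Fin r'), Measurable ψ ∧
      (∀ x, φ x = p (ψ x)) ∧ ∀ x, φ' x = p' (ψ x) := by
  refine ⟨r * r', fun x => finProdFinEquiv (φ x, φ' x), fun c => (finProdFinEquiv.symm c).1,
    fun c => (finProdFinEquiv.symm c).2, ?_, by simp, by simp⟩
  exact (measurable_of_finite _).comp (hφ.prodMk hφ')

lemma IsGridSet.measurableSet {n : ℕ} {S : Set (Fin n → X)} (hS : IsGridSet n S) :
    MeasurableSet S := by
  obtain ⟨r, φ, hφ, T, rfl⟩ := hS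
  exact (measurable_pi_lambda _ fun j => hφ.comp (measurable_pi_apply j)) T.toFinite.measurableSet

lemma isSetAlgebra_isGridSet (n : ℕ) : IsSetAlgebra {S : Set (Fin n → X) | IsGridSet n S} where
  empty_mem := ⟨1, fun _ => 0, measurable_const, ∅, by simp⟩
  compl_mem := by
    rintro S ⟨r, φ, hφ, T, rfl⟩
    exact ⟨r, φ, hφ, Tᶜ, rfl⟩
  union_mem := by
    rintro S S' ⟨r, φ, hφ, T, rfl⟩ ⟨r', φ', hφ', T', rfl⟩
    obtain ⟨q, ψ, p, p', hψ, hp, hp'⟩ := exists_common_refinement hφ hφ'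
    refine ⟨q, ψ, hψ, (fun i j => p (i j)) ⁻¹' T ∪ (fun i j => p' (i j)) ⁻¹' T', ?_⟩
    ext x
    simp only [mem_union, mem_preimage, hp, hp']

lemma generateFrom_isGridSet (n : ℕ) :
    (MeasurableSpace.pi : MeasurableSpace (Fin n → X)) =
      MeasurableSpace.generateFrom {S | IsGridSet n S} := by
  classical
  apply le_antisymm
  · refine iSup_le fun j => ?_
    rintro _ ⟨A, hA, rfl⟩
    -- a coordinate set depends on `x` only through the partition into `A` and its complement
    refine MeasurableSpace.measurableSet_generateFrom
      ⟨2, fun x => if x ∈ A then 1 else 0, Measurable.ite hA measurable_const measurable_const,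
        {i | i j = 1}, ?_⟩
    ext x
    by_cases h : x j ∈ A <;> simp [h]
  · exact MeasurableSpace.generateFrom_le fun S hS => hS.measurableSet

lemma measureDense_isGridSet {n : ℕ} (κ : Measure (Fin n → X)) [IsFiniteMeasure κ] :
    κ.MeasureDense {S | IsGridSet n S} :=
  Measure.MeasureDense.of_generateFrom_isSetAlgebra_finite κ (isSetAlgebra_isGridSet n)
    (generateFrom_isGridSet n)

/-- The inequality of two finite measures on `X^n` can be checked on grid sets. -/
lemma le_of_le_on_isGridSet {n : ℕ} {κ κ' : Measure (Fin n → X)} [IsFiniteMeasure κ]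
    [IsFiniteMeasure κ'] (h : ∀ S, IsGridSet n S → κ S ≤ κ' S) : κ ≤ κ' := by
  refine Measure.le_iff.2 fun S hS => ?_
  refine ENNReal.le_of_forall_pos_le_add fun ε hε _ => ?_
  obtain ⟨T, hT, hST⟩ := (measureDense_isGridSet (κ + κ')).approx S hS (measure_ne_top _ _) (ε / 2)
    (by positivity)
  have hκ : κ (symmDiff S T) + κ' (symmDiff S T) ≤ ENNReal.ofReal (ε / 2) := by
    simpa using hST.le
  have hT' : κ T ≤ κ' T := h T hT
  have h1 : κ S ≤ κ T + κ (symmDiff S T) := by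
    refine (measure_mono ?_).trans (measure_union_le _ _)
    intro x hx
    by_cases hxT : x ∈ T
    · exact Or.inl hxT
    · exact Or.inr (Or.inl ⟨hx, hxT⟩)
  have h2 : κ' T ≤ κ' S + κ' (symmDiff S T) := by
    refine (measure_mono ?_).trans (measure_union_le _ _)
    intro x hx
    by_cases hxS : x ∈ S
    · exact Or.inl hxS
    · exact Or.inr (Or.inr ⟨hx, hxS⟩)
  calc κ S ≤ κ' S + (κ (symmDiff S T) + κ' (symmDiff S T)) := by
        refine h1.trans ((add_le_add_left (hT'.trans h2) _).trans (le_of_eq ?_))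
        ring
    _ ≤ κ' S + ε := by
        gcongr
        refine hκ.trans ?_
        rw [ENNReal.ofReal_le_coe]
        exact half_le_self ε.2

/-- The inequality of two finite measures on `X^n` can be checked on the products of cells of finite
partitions. -/
lemma le_of_le_on_fibers {n : ℕ} {κ κ' : Measure (Fin n → X)} [IsFiniteMeasure κ]
    [IsFiniteMeasure κ'] (h : ∀ (r : ℕ) (φ : X → Fin r), Measurable φ → ∀ i : Fin n → Fin r,
      κ ((fun x j => φ (x j)) ⁻¹' {i}) ≤ κ' ((fun x j => φ (x j)) ⁻¹' {i})) : κ ≤ κ' := by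
  refine le_of_le_on_isGridSet ?_
  rintro _ ⟨r, φ, hφ, T, rfl⟩
  have hφn : Measurable (fun (x : Fin n → X) j => φ (x j)) :=
    measurable_pi_lambda _ fun j => hφ.comp (measurable_pi_apply j)
  have hT : T = ((T.toFinite.toFinset : Finset _) : Set (Fin n → Fin r)) := by simp
  rw [hT, ← sum_measure_preimage_singleton _ (fun i _ => hφn (measurableSet_singleton i)),
    ← sum_measure_preimage_singleton _ (fun i _ => hφn (measurableSet_singleton i))]
  exact Finset.sum_le_sum fun i _ => h r φ hφ i

/-! ### Factorial measures -/

/-- The product `C_{i₁} × ⋯ × C_{iₙ}` of members of a family of sets. -/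
def cell {Y : Type*} {r n : ℕ} (C : Fin r → Set Y) (i : Fin n → Fin r) : Set (Fin n → Y) :=
  univ.pi fun j => C (i j)

/-- The number of indices `j` with `i j = c`. -/
def occ {r n : ℕ} (i : Fin n → Fin r) (c : Fin r) : ℕ := ∑ j, if i j = c then 1 else 0

lemma mem_cell {Y : Type*} {r n : ℕ} {C : Fin r → Set Y} {i : Fin n → Fin r} {x : Fin n → Y} :
    x ∈ cell C i ↔ ∀ j, x j ∈ C (i j) := by simp [cell]

lemma fiber_inter_eq_cell {Y : Type*} {r n : ℕ} (φ : Y → Fin r) (D : Set Y) (i : Fin n → Fin r) :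
    (fun (x : Fin n → Y) j => φ (x j)) ⁻¹' {i} ∩ (univ.pi fun _ => D) =
      cell (fun c => φ ⁻¹' {c} ∩ D) i := by
  ext x
  simp only [mem_inter_iff, mem_preimage, mem_singleton_iff, mem_cell, mem_univ_pi, funext_iff]
  exact ⟨fun h j => ⟨h.1 j, h.2 j⟩, fun h => ⟨fun j => (h j).1, fun j => (h j).2⟩⟩

lemma pairwise_disjoint_fiber_inter {Y : Type*} {r : ℕ} (φ : Y → Fin r) (D : Set Y) :
    Pairwise (fun c d => Disjoint (φ ⁻¹' {c} ∩ D) (φ ⁻¹' {d} ∩ D)) := fun _ _ hcd =>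
  ((disjoint_singleton.2 hcd).preimage φ).mono inter_subset_left inter_subset_left

lemma measurableSet_cell {r n : ℕ} {C : Fin r → Set X} (hC : ∀ c, MeasurableSet (C c))
    (i : Fin n → Fin r) : MeasurableSet (cell C i) :=
  MeasurableSet.univ_pi fun j => hC (i j)

lemma occ_snoc {r n : ℕ} (i : Fin n → Fin r) (d c : Fin r) :
    occ (Fin.snoc i d : Fin (n + 1) → Fin r) c = occ i c + if d = c then 1 else 0 := by
  rw [occ, Fin.sum_univ_castSucc]
  simp only [Fin.snoc_castSucc, Fin.snoc_last, occ]

lemma occ_cons {r n : ℕ} (i : Fin n → Fin r) (d c : Fin r) :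
    occ (Fin.cons d i : Fin (n + 1) → Fin r) c = (if d = c then 1 else 0) + occ i c := by
  rw [occ, Fin.sum_univ_succ]
  simp only [Fin.cons_succ, Fin.cons_zero, occ]

/-- The number of ways to pick distinct points, `N c` of which lie in the cell `c`, from the cells
`i₁, …, iₙ`. -/
def fallProd {r n : ℕ} (N : Fin r → ℕ) (i : Fin n → Fin r) : ℕ :=
  ∏ c, (N c).descFactorial (occ i c)

lemma fallProd_snoc {r n : ℕ} (N : Fin r → ℕ) (i : Fin n → Fin r) (d : Fin r) :
    fallProd N (Fin.snoc i d : Fin (n + 1) → Fin r) = fallProd N i * (N d - occ i d) := by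
  classical
  simp only [fallProd, occ_snoc]
  rw [← Finset.mul_prod_erase _ _ (Finset.mem_univ d),
    ← Finset.mul_prod_erase (a := d) _ (fun c => (N c).descFactorial (occ i c)) (Finset.mem_univ d)]
  rw [if_pos rfl, Nat.descFactorial_succ]
  rw [Finset.prod_congr rfl fun c hc => by
    rw [if_neg (Finset.ne_of_mem_erase hc).symm, add_zero]]
  ring

lemma fallProd_cons {r n : ℕ} (N : Fin r → ℕ) (i : Fin n → Fin r) (d : Fin r) :
    fallProd N (Fin.cons d i : Fin (n + 1) → Fin r) =
      N d * fallProd (Function.update N d (N d - 1)) i := by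
  classical
  simp only [fallProd, occ_cons]
  rw [← Finset.mul_prod_erase _ _ (Finset.mem_univ d),
    ← Finset.mul_prod_erase (a := d) _
      (fun c => (Function.update N d (N d - 1) c).descFactorial (occ i c)) (Finset.mem_univ d)]
  rw [if_pos rfl, Function.update_self]
  rw [Finset.prod_congr rfl fun c hc => by
    rw [if_neg (Finset.ne_of_mem_erase hc).symm, zero_add,
      ← Function.update_of_ne (Finset.ne_of_mem_erase hc) (N d - 1) N]]
  rcases h : N d with _ | k
  · simp [add_comm 1]
  · rw [add_comm 1, Nat.succ_descFactorial_succ]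
    simp [mul_assoc]

lemma measurable_snoc {n : ℕ} :
    Measurable (fun p : (Fin n → X) × X => (Fin.snoc p.1 p.2 : Fin (n + 1) → X)) := by
  refine measurable_pi_lambda _ fun j => ?_
  refine Fin.lastCases ?_ (fun j => ?_) j
  · simpa using measurable_snd
  · simpa [Function.comp_def] using (measurable_pi_apply j).comp measurable_fst

lemma measurable_snoc_self {n : ℕ} (j : Fin n) :
    Measurable (fun x : Fin n → X => (Fin.snoc x (x j) : Fin (n + 1) → X)) :=
  measurable_snoc.comp (measurable_id.prodMk (measurable_pi_apply j))

lemma snoc_mem_cell {Y : Type*} {r n : ℕ} {C : Fin r → Set Y} {i : Fin n → Fin r} {d : Fin r}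
    {x : Fin n → Y} {y : Y} :
    (Fin.snoc x y : Fin (n + 1) → Y) ∈ cell C (Fin.snoc i d : Fin (n + 1) → Fin r) ↔
      x ∈ cell C i ∧ y ∈ C d := by
  simp [mem_cell, Fin.forall_fin_succ']

/-- On products of disjoint sets of finite measure, `ρ` has the values of `μ^{(n)}`. -/
def HasCellValues (μ : Measure X) {n : ℕ} (ρ : Measure (Fin n → X)) : Prop :=
  ∀ (r : ℕ) (C : Fin r → Set X) (N : Fin r → ℕ), (∀ c, MeasurableSet (C c)) →
    Pairwise (fun c d => Disjoint (C c) (C d)) → (∀ c, μ (C c) = N c) →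
    ∀ i : Fin n → Fin r, ρ (cell C i) = (fallProd N i : ℕ)

lemma IsPointMeasure.exists_nat {μ : Measure X} (hμ : IsPointMeasure μ) {D : Set X}
    (hD : MeasurableSet D) (h : μ D < ∞) : ∃ n : ℕ, μ D = n := by
  obtain ⟨n, hn⟩ := hμ.2 D hD
  induction n with
  | top => simp [hn] at h
  | coe n => exact ⟨n, by simpa using hn⟩

lemma HasCellValues.lt_top {μ : Measure X} (hμ : IsPointMeasure μ) {n : ℕ}
    {ρ : Measure (Fin n → X)} (hρ : HasCellValues μ ρ) {D : Set X} (hD : MeasurableSet D)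
    (h : μ D < ∞) : ρ (univ.pi fun _ => D) < ∞ := by
  obtain ⟨k, hk⟩ := hμ.exists_nat hD h
  have := hρ 1 (fun _ => D) (fun _ => k) (fun _ => hD)
    (fun c d hcd => absurd (Subsingleton.elim c d) hcd) (fun _ => hk) (fun _ => 0)
  rw [cell] at this
  rw [this]
  simp

lemma HasCellValues.sigmaFinite {μ : Measure X} (hμ : IsPointMeasure μ) {n : ℕ}
    {ρ : Measure (Fin n → X)} (hρ : HasCellValues μ ρ) : SigmaFinite ρ := by
  have := hμ.1
  refine ⟨⟨⟨fun k => univ.pi fun _ => spanningSets μ k, fun _ => trivial, fun k => ?_, ?_⟩⟩⟩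
  · exact hρ.lt_top hμ (measurableSet_spanningSets μ k) (measure_spanningSets_lt_top μ k)
  · rw [iUnion_univ_pi_of_monotone fun _ => monotone_spanningSets μ]
    simp [iUnion_spanningSets]

/-- The mass that is subtracted in the recursion of the factorial measures does not exceed the mass
from which it is subtracted: on grid sets this holds because a falling factorial of an integer
vanishes before a factor becomes negative. -/
lemma HasCellValues.map_le {μ : Measure X} (hμ : IsPointMeasure μ) {n : ℕ}
    {ρ : Measure (Fin n → X)} (hρ : HasCellValues μ ρ) {D : Set X} (hD : MeasurableSet D)
    (h : μ D < ∞) :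
    (∑ j, (ρ.restrict (univ.pi fun _ => D)).map
        (fun x => (Fin.snoc x (x j) : Fin (n + 1) → X))) ≤
      ((ρ.restrict (univ.pi fun _ => D)).prod (μ.restrict D)).map
        (fun p => (Fin.snoc p.1 p.2 : Fin (n + 1) → X)) := by
  classical
  have hDn : MeasurableSet (univ.pi fun _ : Fin n => D) := MeasurableSet.univ_pi fun _ => hD
  have : IsFiniteMeasure (ρ.restrict (univ.pi fun _ => D)) :=
    isFiniteMeasure_restrict.2 (hρ.lt_top hμ hD h).ne
  have : IsFiniteMeasure (μ.restrict D) := isFiniteMeasure_restrict.2 h.ne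
  -- it suffices to compare the masses of the products of the cells `φ⁻¹{c} ∩ D`
  refine le_of_le_on_fibers fun r φ hφ i' => ?_
  have hφn : ∀ m, Measurable (fun (x : Fin m → X) j => φ (x j)) := fun m =>
    measurable_pi_lambda _ fun j => hφ.comp (measurable_pi_apply j)
  have hm := hφn _ (measurableSet_singleton i')
  obtain ⟨i, c, rfl⟩ : ∃ (i : Fin n → Fin r) (c : Fin r), Fin.snoc i c = i' :=
    ⟨Fin.init i', i' (Fin.last n), Fin.snoc_init_self i'⟩
  set C : Fin r → Set X := fun c => φ ⁻¹' {c} ∩ D with hCdef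
  have hC : ∀ c, MeasurableSet (C c) := fun c => (hφ (measurableSet_singleton c)).inter hD
  choose N hN using fun c => hμ.exists_nat (hC c) ((measure_mono inter_subset_right).trans_lt h)
  have hdisj : Pairwise (fun c d => Disjoint (C c) (C d)) :=
    pairwise_disjoint_fiber_inter φ D
  have key := hρ r C N hC hdisj hN i
  have hpre : ∀ (x : Fin n → X) (y : X),
      ((fun j => φ ((Fin.snoc x y : Fin (n + 1) → X) j)) = Fin.snoc i c) ↔
        (fun j => φ (x j)) = i ∧ φ y = c := by
    intro x y
    simp [funext_iff, Fin.forall_fin_succ']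
  have h1 : (((ρ.restrict (univ.pi fun _ => D)).prod (μ.restrict D)).map
        (fun p => (Fin.snoc p.1 p.2 : Fin (n + 1) → X)))
        ((fun x j => φ (x j)) ⁻¹' {(Fin.snoc i c : Fin (n + 1) → Fin r)}) =
      ρ (cell C i) * N c := by
    rw [Measure.map_apply measurable_snoc hm]
    have : (fun p : (Fin n → X) × X => (Fin.snoc p.1 p.2 : Fin (n + 1) → X)) ⁻¹'
        ((fun x j => φ (x j)) ⁻¹' {(Fin.snoc i c : Fin (n + 1) → Fin r)}) =
        ((fun (x : Fin n → X) j => φ (x j)) ⁻¹' {i}) ×ˢ (φ ⁻¹' {c}) := by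
      ext p
      simp only [mem_preimage, mem_singleton_iff, mem_prod]
      exact hpre p.1 p.2
    rw [this, Measure.prod_prod, Measure.restrict_apply (hφn _ (measurableSet_singleton i)),
      fiber_inter_eq_cell, Measure.restrict_apply (hφ (measurableSet_singleton c)), ← hN c]
  have h2 : ∀ j, ((ρ.restrict (univ.pi fun _ => D)).map
        (fun x => (Fin.snoc x (x j) : Fin (n + 1) → X)))
        ((fun x j => φ (x j)) ⁻¹' {(Fin.snoc i c : Fin (n + 1) → Fin r)}) =
      ρ (cell C i) * if i j = c then 1 else 0 := by
    intro j
    rw [Measure.map_apply (measurable_snoc_self j) hm]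
    have : (fun x : Fin n → X => (Fin.snoc x (x j) : Fin (n + 1) → X)) ⁻¹'
        ((fun x j => φ (x j)) ⁻¹' {(Fin.snoc i c : Fin (n + 1) → Fin r)}) =
        if i j = c then ((fun (x : Fin n → X) j => φ (x j)) ⁻¹' {i}) else ∅ := by
      ext x
      simp only [mem_preimage, mem_singleton_iff]
      rw [hpre]
      split_ifs with hij
      · simp only [mem_preimage, mem_singleton_iff, and_iff_left_iff_imp]
        rintro rfl
        exact hij
      · simp only [mem_empty_iff_false, iff_false]
        rintro ⟨rfl, h⟩
        exact hij h
    rw [this]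
    split_ifs with hij
    · rw [Measure.restrict_apply (hφn _ (measurableSet_singleton i)), fiber_inter_eq_cell, mul_one]
    · simp
  rw [h1, Measure.finsetSum_apply, Finset.sum_congr rfl fun j _ => h2 j, ← Finset.mul_sum, key]
  -- the product on the left vanishes if more points are asked for in the cell `c` than it has
  have h3 : fallProd N i * occ i c ≤ fallProd N i * N c := by
    rcases le_or_gt (occ i c) (N c) with hle | hlt
    · exact Nat.mul_le_mul_left _ hle
    · have : fallProd N i = 0 :=
        Finset.prod_eq_zero (Finset.mem_univ c) (Nat.descFactorial_eq_zero_iff_lt.2 hlt)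
      simp [this]
  have h4 : (∑ j, if i j = c then (1 : ℝ≥0∞) else 0) = (occ i c : ℕ) := by simp [occ]
  rw [h4]
  exact_mod_cast h3

/-- The mass that the recursion of the factorial measures subtracts at `x`. -/
noncomputable def stepLoss {n : ℕ} (B : Set (Fin (n + 1) → X)) (x : Fin n → X) : ℝ≥0∞ :=
  ∑ j : Fin n, B.indicator (fun _ => (1 : ℝ≥0∞)) (Fin.snoc x (x j) : Fin (n + 1) → X)

lemma measurable_indicator_snoc_self {n : ℕ} {B : Set (Fin (n + 1) → X)} (hB : MeasurableSet B)
    (j : Fin n) : Measurable (fun x : Fin n → X =>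
      B.indicator (fun _ => (1 : ℝ≥0∞)) (Fin.snoc x (x j) : Fin (n + 1) → X)) :=
  (measurable_const.indicator hB).comp (measurable_snoc_self j)

lemma measurable_stepLoss {n : ℕ} {B : Set (Fin (n + 1) → X)} (hB : MeasurableSet B) :
    Measurable (stepLoss B) :=
  Finset.measurable_fun_sum _ fun j _ => measurable_indicator_snoc_self hB j

lemma measurable_section {μ : Measure X} [SFinite μ] {n : ℕ} {B : Set (Fin (n + 1) → X)}
    (hB : MeasurableSet B) :
    Measurable (fun x : Fin n → X => μ {y | (Fin.snoc x y : Fin (n + 1) → X) ∈ B}) :=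
  measurable_measure_prodMk_left (measurable_snoc hB)

/-- The pointwise form of `HasCellValues.map_le`: the mass that the recursion subtracts is almost
everywhere at most the mass from which it is subtracted, so that the truncated subtraction in
`IsFactorialStep` is a true one. -/
lemma HasCellValues.stepLoss_le {μ : Measure X} (hμ : IsPointMeasure μ) {n : ℕ}
    {ρ : Measure (Fin n → X)} (hρ : HasCellValues μ ρ) {B : Set (Fin (n + 1) → X)}
    (hB : MeasurableSet B) :
    ∀ᵐ x ∂ρ, stepLoss B x ≤ μ {y | (Fin.snoc x y : Fin (n + 1) → X) ∈ B} := by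
  have := hμ.1
  suffices H : ∀ k, ∀ᵐ x ∂ρ.restrict (univ.pi fun _ => spanningSets μ k),
      stepLoss B x ≤ μ {y | (Fin.snoc x y : Fin (n + 1) → X) ∈ B} by
    have h2 := (ae_restrict_iUnion_iff _ _).2 H
    rw [iUnion_univ_pi_of_monotone fun _ => monotone_spanningSets μ] at h2
    simpa [iUnion_spanningSets] using h2
  intro k
  set D := spanningSets μ k
  have hD : MeasurableSet D := measurableSet_spanningSets μ k
  have hDk : μ D < ∞ := measure_spanningSets_lt_top μ k
  have : IsFiniteMeasure (ρ.restrict (univ.pi fun _ => D)) :=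
    isFiniteMeasure_restrict.2 (hρ.lt_top hμ hD hDk).ne
  have : IsFiniteMeasure (μ.restrict D) := isFiniteMeasure_restrict.2 hDk.ne
  have hle := hρ.map_le hμ hD hDk
  have h1 : stepLoss B ≤ᵐ[ρ.restrict (univ.pi fun _ => D)]
      fun x => (μ.restrict D) {y | (Fin.snoc x y : Fin (n + 1) → X) ∈ B} := by
    refine ae_le_of_forall_setLIntegral_le_of_sigmaFinite (measurable_stepLoss hB)
      fun s hs _ => ?_
    -- the inequality of measures is applied to the tuples in `B` whose first `n` entries form an
    -- element of `s`
    have hS : MeasurableSet ((fun x : Fin (n + 1) → X => Fin.init x) ⁻¹' s ∩ B) := by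
      refine MeasurableSet.inter (hs.preimage ?_) hB
      exact measurable_pi_lambda _ fun j => measurable_pi_apply _
    have := hle ((fun x : Fin (n + 1) → X => Fin.init x) ⁻¹' s ∩ B)
    rw [Measure.finsetSum_apply, Measure.map_apply measurable_snoc hS,
      Measure.prod_apply (measurable_snoc hS)] at this
    calc ∫⁻ x in s, stepLoss B x ∂ρ.restrict (univ.pi fun _ => D)
        = ∑ j, ((ρ.restrict (univ.pi fun _ => D)).map
            (fun x => (Fin.snoc x (x j) : Fin (n + 1) → X)))
              ((fun x : Fin (n + 1) → X => Fin.init x) ⁻¹' s ∩ B) := by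
          simp only [stepLoss]
          rw [lintegral_finsetSum _ fun j _ => measurable_indicator_snoc_self hB j]
          refine Finset.sum_congr rfl fun j _ => ?_
          rw [Measure.map_apply (measurable_snoc_self j) hS, ← lintegral_indicator hs,
            ← lintegral_indicator_one (measurable_snoc_self j hS)]
          refine lintegral_congr fun x => ?_
          by_cases hx : x ∈ s <;>
            by_cases hxB : (Fin.snoc x (x j) : Fin (n + 1) → X) ∈ B <;> simp [hx, hxB]
      _ ≤ _ := this
      _ = ∫⁻ x in s, (μ.restrict D) {y | (Fin.snoc x y : Fin (n + 1) → X) ∈ B}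
            ∂ρ.restrict (univ.pi fun _ => D) := by
          rw [← lintegral_indicator hs]
          refine lintegral_congr fun x => ?_
          by_cases hx : x ∈ s <;> simp [hx, preimage, Fin.init_snoc]
  filter_upwards [h1] with x hx
  exact hx.trans (Measure.restrict_apply_le _ _)

/-- The recursion of the factorial measures has a solution: the right-hand side is countably
additive in the set, as the subtraction is a true one almost everywhere. -/
lemma HasCellValues.exists_isFactorialStep {μ : Measure X} (hμ : IsPointMeasure μ) {n : ℕ}
    {ρ : Measure (Fin n → X)} (hρ : HasCellValues μ ρ) : ∃ ν, IsFactorialStep μ ρ ν := by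
  have := hμ.1
  refine ⟨Measure.ofMeasurable (fun B _ => ∫⁻ x : Fin n → X,
    (μ {y | (Fin.snoc x y : Fin (n + 1) → X) ∈ B} - stepLoss B x) ∂ρ) (by simp) ?_, ?_⟩
  · intro B hB hdisj
    have hmeas : ∀ k, AEMeasurable (fun x : Fin n → X =>
        μ {y | (Fin.snoc x y : Fin (n + 1) → X) ∈ B k} - stepLoss (B k) x) ρ := fun k =>
      ((measurable_section (hB k)).sub (measurable_stepLoss (hB k))).aemeasurable
    rw [← lintegral_tsum hmeas]
    refine lintegral_congr_ae ?_
    have hle := ae_all_iff.2 fun k => hρ.stepLoss_le hμ (hB k)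
    filter_upwards [hle] with x hx
    have hμB : μ {y | (Fin.snoc x y : Fin (n + 1) → X) ∈ ⋃ k, B k} =
        ∑' k, μ {y | (Fin.snoc x y : Fin (n + 1) → X) ∈ B k} := by
      have : {y | (Fin.snoc x y : Fin (n + 1) → X) ∈ ⋃ k, B k} =
          ⋃ k, {y | (Fin.snoc x y : Fin (n + 1) → X) ∈ B k} := by
        ext y
        simp
      rw [this]
      refine measure_iUnion (fun i j hij => ?_) fun k => ?_
      · exact (hdisj hij).preimage (fun y => (Fin.snoc x y : Fin (n + 1) → X))
      · exact (measurable_snoc.comp measurable_prodMk_left) (hB k)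
    have hloss : stepLoss (⋃ k, B k) x = ∑' k, stepLoss (B k) x := by
      simp only [stepLoss]
      rw [Summable.tsum_finsetSum fun _ _ => ENNReal.summable]
      refine Finset.sum_congr rfl fun j _ => ?_
      -- countable additivity of the indicator is that of the Dirac measure
      have hdirac : ∀ {A : Set (Fin (n + 1) → X)}, MeasurableSet A → ∀ z,
          A.indicator (fun _ => (1 : ℝ≥0∞)) z = Measure.dirac z A := fun hA z =>
        (Measure.dirac_apply' z hA).symm
      simp_rw [hdirac (MeasurableSet.iUnion hB), hdirac (hB _)]
      exact measure_iUnion hdisj hB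
    rw [hμB, hloss]
    refine (ENNReal.tsum_sub ?_ hx).symm
    rw [← hloss]
    refine (ENNReal.sum_lt_top.2 fun j _ => ?_).ne
    refine lt_of_le_of_lt (indicator_le_self' (fun _ _ => zero_le_one) _) ENNReal.one_lt_top
  · intro B hB
    rw [Measure.ofMeasurable_apply B hB]
    rfl

/-- On a product of cells the recursion multiplies by one more factor of the falling factorial. -/
lemma HasCellValues.succ {μ : Measure X} {n : ℕ}
    {ρ : Measure (Fin n → X)} (hρ : HasCellValues μ ρ) {ν : Measure (Fin (n + 1) → X)}
    (hν : IsFactorialStep μ ρ ν) : HasCellValues μ ν := by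
  classical
  intro r C N hC hdisj hN i'
  obtain ⟨i, c, rfl⟩ : ∃ (i : Fin n → Fin r) (c : Fin r), Fin.snoc i c = i' :=
    ⟨Fin.init i', i' (Fin.last n), Fin.snoc_init_self i'⟩
  rw [hν _ (measurableSet_cell hC _), fallProd_snoc, Nat.cast_mul, ← hρ r C N hC hdisj hN i,
    mul_comm, ← setLIntegral_const, ← lintegral_indicator (measurableSet_cell hC _)]
  refine lintegral_congr fun x => ?_
  by_cases hx : x ∈ cell C i
  · have h1 : {y | (Fin.snoc x y : Fin (n + 1) → X) ∈ cell C (Fin.snoc i c : Fin (n + 1) → Fin r)} =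
        C c := by
      ext y
      simp [snoc_mem_cell, hx]
    have h2 : ∀ j, (cell C (Fin.snoc i c : Fin (n + 1) → Fin r)).indicator (fun _ => (1 : ℝ≥0∞))
        (Fin.snoc x (x j) : Fin (n + 1) → X) = if i j = c then 1 else 0 := by
      intro j
      have hxj : x j ∈ C (i j) := mem_cell.1 hx j
      by_cases hij : i j = c
      · rw [indicator_of_mem (snoc_mem_cell.2 ⟨hx, hij ▸ hxj⟩), if_pos hij]
      · rw [indicator_of_notMem, if_neg hij]
        exact fun h => (hdisj hij).notMem_of_mem_left hxj (snoc_mem_cell.1 h).2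
    rw [h1, hN, indicator_of_mem hx, Finset.sum_congr rfl fun j _ => h2 j]
    simp [occ]
  · have h1 : {y | (Fin.snoc x y : Fin (n + 1) → X) ∈ cell C (Fin.snoc i c : Fin (n + 1) → Fin r)} =
        ∅ := by
      ext y
      simp [snoc_mem_cell, hx]
    simp [h1, hx]

lemma hasCellValues_factorialMeasure {μ : Measure X} (hμ : IsPointMeasure μ) (n : ℕ) :
    HasCellValues μ (factorialMeasure μ n) := by
  induction n with
  | zero =>
    intro r C N hC _ _ i
    rw [factorialMeasure, Measure.dirac_apply' _ (measurableSet_cell hC _)]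
    simp [cell, fallProd, occ]
  | succ n ih =>
    have h := ih.exists_isFactorialStep hμ
    rw [factorialMeasure, dif_pos h]
    exact ih.succ h.choose_spec

lemma isFactorialStep_factorialMeasure {μ : Measure X} (hμ : IsPointMeasure μ) (n : ℕ) :
    IsFactorialStep μ (factorialMeasure μ n) (factorialMeasure μ (n + 1)) := by
  have h := (hasCellValues_factorialMeasure hμ n).exists_isFactorialStep hμ
  rw [factorialMeasure, dif_pos h]
  exact h.choose_spec

lemma sigmaFinite_factorialMeasure {μ : Measure X} (hμ : IsPointMeasure μ) (n : ℕ) :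
    SigmaFinite (factorialMeasure μ n) :=
  (hasCellValues_factorialMeasure hμ n).sigmaFinite hμ

/-- The recursion of the factorial measures in additive form: a pair of a tuple from `μ^{(n)}` and a
point of `μ` is either a tuple from `μ^{(n+1)}` or repeats an entry of the tuple. -/
lemma factorialMeasure_succ_add {μ : Measure X} (hμ : IsPointMeasure μ) (n : ℕ) :
    factorialMeasure μ (n + 1) + ∑ j, (factorialMeasure μ n).map
        (fun x => (Fin.snoc x (x j) : Fin (n + 1) → X)) =
      ((factorialMeasure μ n).prod μ).map (fun p => (Fin.snoc p.1 p.2 : Fin (n + 1) → X)) := by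
  have := hμ.1
  have := sigmaFinite_factorialMeasure hμ n
  refine Measure.ext fun B hB => ?_
  have h1 : (∑ j, (factorialMeasure μ n).map
      (fun x => (Fin.snoc x (x j) : Fin (n + 1) → X))) B =
      ∫⁻ x, stepLoss B x ∂factorialMeasure μ n := by
    simp only [stepLoss]
    rw [lintegral_finsetSum _ fun j _ => measurable_indicator_snoc_self hB j,
      Measure.finsetSum_apply]
    refine Finset.sum_congr rfl fun j _ => ?_
    rw [Measure.map_apply (measurable_snoc_self j) hB,
      ← lintegral_indicator_one (measurable_snoc_self j hB)]
    rfl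
  rw [Measure.add_apply, h1, isFactorialStep_factorialMeasure hμ n B hB,
    Measure.map_apply measurable_snoc hB, Measure.prod_apply (measurable_snoc hB),
    ← lintegral_add_right _ (measurable_stepLoss hB)]
  refine lintegral_congr_ae ?_
  filter_upwards [(hasCellValues_factorialMeasure hμ n).stepLoss_le hμ hB] with x hx
  exact tsub_add_cancel_of_le hx

end Factorial

/-! ### Independent Poisson variables -/

/-- The law of independent Poisson variables with means `ρ c`. -/
noncomputable def poissonPi {r : ℕ} (ρ : Fin r → ℝ≥0) : Measure (Fin r → ℕ) :=
  Measure.pi fun c => poissonMeasure (ρ c)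

instance {r : ℕ} (ρ : Fin r → ℝ≥0) : IsProbabilityMeasure (poissonPi ρ) := by
  unfold poissonPi; infer_instance

lemma poissonMeasure_singleton_succ (a : ℝ≥0) (k : ℕ) :
    ((k + 1 : ℕ) : ℝ≥0∞) * poissonMeasure a {k + 1} = a * poissonMeasure a {k} := by
  rw [poissonMeasure_singleton, poissonMeasure_singleton, ← ENNReal.ofReal_natCast,
    ← ENNReal.ofReal_mul (by positivity), ← ENNReal.ofReal_coe_nnreal,
    ← ENNReal.ofReal_mul (by positivity)]
  congr 1
  rw [Nat.factorial_succ]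
  push_cast
  field_simp
  ring

/-- The Mecke formula for independent Poisson variables: weighting by the number of points in a cell
and removing one of them amounts to multiplying by the intensity of the cell. -/
lemma lintegral_mul_pred_poissonPi {r : ℕ} (ρ : Fin r → ℝ≥0) (d : Fin r)
    (G : (Fin r → ℕ) → ℝ≥0∞) :
    ∫⁻ N, N d * G (Function.update N d (N d - 1)) ∂poissonPi ρ = ρ d * ∫⁻ N, G N ∂poissonPi ρ := by
  classical
  rw [lintegral_countable', lintegral_countable', ← ENNReal.tsum_mul_left]
  set S : (Fin r → ℕ) → (Fin r → ℕ) := fun N => Function.update N d (N d + 1) with hS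
  have hinj : Function.Injective S := by
    intro N M h
    have hd : N d = M d := by simpa [hS] using congrFun h d
    funext c
    by_cases hc : c = d
    · rw [hc, hd]
    · simpa [hS, hc] using congrFun h c
  -- terms with `N d = 0` vanish, and the others are indexed by the injective map `S`
  rw [← hinj.tsum_eq (f := fun N : Fin r → ℕ =>
    N d * G (Function.update N d (N d - 1)) * poissonPi ρ {N})]
  · refine tsum_congr fun N => ?_
    have h1 : S N d = N d + 1 := by simp [hS]
    have h2 : Function.update (S N) d (S N d - 1) = N := by simp [hS]
    rw [h2, h1]
    simp only [poissonPi, Measure.pi_singleton]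
    rw [← Finset.mul_prod_erase _ _ (Finset.mem_univ d),
      ← Finset.mul_prod_erase (a := d) _ (fun c => poissonMeasure (ρ c) {N c}) (Finset.mem_univ d),
      h1]
    rw [Finset.prod_congr rfl fun c hc => by
      rw [show S N c = N c by simp [hS, Finset.ne_of_mem_erase hc]]]
    calc _ = G N * (((N d + 1 : ℕ) : ℝ≥0∞) * poissonMeasure (ρ d) {N d + 1}) *
          ∏ c ∈ Finset.univ.erase d, poissonMeasure (ρ c) {N c} := by ring
      _ = _ := by
        rw [poissonMeasure_singleton_succ]
        ring
  · intro N hN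
    have hNd : N d ≠ 0 := by
      intro h
      simp [h] at hN
    refine ⟨Function.update N d (N d - 1), ?_⟩
    simp only [hS, Function.update_self, Function.update_idem]
    rw [Nat.sub_add_cancel (Nat.one_le_iff_ne_zero.2 hNd), Function.update_eq_self]

/-- The factorial moments of independent Poisson variables. -/
lemma lintegral_fallProd_poissonPi {r n : ℕ} (ρ : Fin r → ℝ≥0) (i : Fin n → Fin r) :
    ∫⁻ N, (fallProd N i : ℕ) ∂poissonPi ρ = ∏ j, (ρ (i j) : ℝ≥0∞) := by
  induction n with
  | zero => simp [fallProd, occ]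
  | succ n ih =>
    obtain ⟨d, i, rfl⟩ : ∃ (d : Fin r) (i' : Fin n → Fin r), Fin.cons d i' = i :=
      ⟨i 0, Fin.tail i, Fin.cons_self_tail i⟩
    simp_rw [fallProd_cons, Nat.cast_mul]
    rw [lintegral_mul_pred_poissonPi ρ d fun N => ((fallProd N i : ℕ) : ℝ≥0∞), ih,
      Fin.prod_univ_succ]
    simp

/-! ### Poisson processes -/

section Poisson

variable {X : Type*} [MeasurableSpace X] {Ω : Type*} [MeasurableSpace Ω] {P : Measure Ω}
  {η : Ω → Measure X} {Λ : Measure X}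

/-- The numbers of points in the sets of a family, with the junk value `0` for infinitely many. -/
noncomputable def counts {r : ℕ} (η : Ω → Measure X) (C : Fin r → Set X) (ω : Ω) (c : Fin r) : ℕ :=
  ⌊(η ω (C c)).toReal⌋₊

lemma IsPoissonProcess.ae_eq_counts (hη : IsPoissonProcess η Λ P) {r : ℕ} {C : Fin r → Set X}
    (hC : ∀ c, MeasurableSet (C c)) (hfin : ∀ c, Λ (C c) < ∞) :
    ∀ᵐ ω ∂P, ∀ c, η ω (C c) = counts η C ω c := by
  refine ae_all_iff.2 fun c => ?_
  have h := hη.hasLaw (C c) (hC c) (hfin c)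
  have h2 : ∀ᵐ y ∂P.map (fun ω => η ω (C c)), y = (⌊y.toReal⌋₊ : ℝ≥0∞) := by
    rw [h.map_eq]
    have hs : MeasurableSet {y : ℝ≥0∞ | y = (⌊y.toReal⌋₊ : ℝ≥0∞)} :=
      measurableSet_eq_fun measurable_id
        (measurable_from_top.comp (Nat.measurable_floor.comp ENNReal.measurable_toReal))
    rw [ae_map_iff measurable_from_top.aemeasurable hs]
    simp
  exact ae_of_ae_map h.aemeasurable h2

lemma IsPoissonProcess.measurable_counts (hη : IsPoissonProcess η Λ P) {r : ℕ} {C : Fin r → Set X}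
    (hC : ∀ c, MeasurableSet (C c)) : Measurable (counts η C) := by
  refine measurable_pi_lambda _ fun c => ?_
  exact Nat.measurable_floor.comp
    (((Measure.measurable_coe (hC c)).comp hη.measurable).ennreal_toReal)

lemma IsPoissonProcess.map_counts [IsProbabilityMeasure P] (hη : IsPoissonProcess η Λ P) {r : ℕ}
    {C : Fin r → Set X} (hC : ∀ c, MeasurableSet (C c))
    (hdisj : Pairwise (fun c d => Disjoint (C c) (C d))) (hfin : ∀ c, Λ (C c) < ∞) :
    P.map (counts η C) = poissonPi fun c => (Λ (C c)).toNNReal := by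
  have hind := hη.indep r C hC hdisj
  have hfl : Measurable (fun y : ℝ≥0∞ => ⌊y.toReal⌋₊) := by fun_prop
  have hind2 : iIndepFun (fun c ω => counts η C ω c) P :=
    hind.comp (fun _ y => ⌊y.toReal⌋₊) fun _ => hfl
  have hm := hη.measurable_counts hC
  have hmc : ∀ c, AEMeasurable (fun ω => counts η C ω c) P := fun c =>
    ((measurable_pi_apply c).comp hm).aemeasurable
  rw [iIndepFun_iff_map_fun_eq_pi_map hmc] at hind2
  refine hind2.trans ?_
  rw [poissonPi]
  congr 1
  funext c
  have h := hη.hasLaw (C c) (hC c) (hfin c)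
  have : (fun ω => counts η C ω c) = (fun y : ℝ≥0∞ => ⌊y.toReal⌋₊) ∘ fun ω => η ω (C c) := rfl
  rw [this, ← AEMeasurable.map_map_of_aemeasurable hfl.aemeasurable h.aemeasurable, h.map_eq,
    Measure.map_map hfl measurable_from_top]
  have hid : (fun y : ℝ≥0∞ => ⌊y.toReal⌋₊) ∘ (fun n : ℕ => (n : ℝ≥0∞)) = id := by
    funext n
    simp
  rw [hid, Measure.map_id]

/-- The event that all sets of the exhausting sequence `spanningSets Λ` have finitely many points;
it is almost sure. -/
def finiteOnSpanning (η : Ω → Measure X) (Λ : Measure X) [SigmaFinite Λ] : Set Ω :=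
  {ω | ∀ k, η ω (spanningSets Λ k) < ∞}

lemma IsPoissonProcess.measurableSet_finiteOnSpanning [SigmaFinite Λ]
    (hη : IsPoissonProcess η Λ P) : MeasurableSet (finiteOnSpanning η Λ) := by
  simp only [finiteOnSpanning, ofPred_forall]
  refine MeasurableSet.iInter fun k => ?_
  exact measurableSet_lt ((Measure.measurable_coe (measurableSet_spanningSets Λ k)).comp
    hη.measurable) measurable_const

lemma IsPoissonProcess.ae_mem_finiteOnSpanning [SigmaFinite Λ] (hη : IsPoissonProcess η Λ P) :
    ∀ᵐ ω ∂P, ω ∈ finiteOnSpanning η Λ := by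
  refine ae_all_iff.2 fun k => ?_
  filter_upwards [hη.ae_eq_counts (C := fun _ : Fin 1 => spanningSets Λ k)
    (fun _ => measurableSet_spanningSets Λ k) fun _ => measure_spanningSets_lt_top Λ k] with ω h
  rw [h 0]
  exact ENNReal.natCast_lt_top _

open Classical in
/-- The factorial measure of the process, set to zero on the null event on which some set of
`spanningSets Λ` has infinitely many points. This is a measurable map. -/
noncomputable def factProc (η : Ω → Measure X) (Λ : Measure X) [SigmaFinite Λ] (n : ℕ) (ω : Ω) :
    Measure (Fin n → X) :=
  if ω ∈ finiteOnSpanning η Λ then factorialMeasure (η ω) n else 0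

lemma IsPoissonProcess.ae_factProc_eq [SigmaFinite Λ] (hη : IsPoissonProcess η Λ P) (n : ℕ) :
    ∀ᵐ ω ∂P, factProc η Λ n ω = factorialMeasure (η ω) n := by
  filter_upwards [hη.ae_mem_finiteOnSpanning] with ω h
  rw [factProc, if_pos h]

/-- Measurability of the random factorial measures. On a power of a set of `spanningSets Λ` the mass
of a grid set is a polynomial in the numbers of points in the cells, and a π-λ argument extends
measurability from the grid sets to all measurable sets. -/
lemma IsPoissonProcess.measurable_factProc [SigmaFinite Λ] (hη : IsPoissonProcess η Λ P) (n : ℕ) :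
    Measurable (factProc η Λ n) := by
  classical
  have key : ∀ k, Measurable fun ω =>
      (factProc η Λ n ω).restrict (univ.pi fun _ => spanningSets Λ k) := by
    intro k
    set D := spanningSets Λ k
    have hD : MeasurableSet D := measurableSet_spanningSets Λ k
    have hDn : MeasurableSet (univ.pi fun _ : Fin n => D) := MeasurableSet.univ_pi fun _ => hD
    have hfin : ∀ ω, IsFiniteMeasure ((factProc η Λ n ω).restrict (univ.pi fun _ => D)) := by
      intro ω
      by_cases hω : ω ∈ finiteOnSpanning η Λ
      · rw [factProc, if_pos hω]
        exact isFiniteMeasure_restrict.2 ((hasCellValues_factorialMeasure (hη.isPointMeasure ω)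
          n).lt_top (hη.isPointMeasure ω) hD (hω k)).ne
      · rw [factProc, if_neg hω, Measure.restrict_zero]
        infer_instance
    have hgrid : ∀ S : Set (Fin n → X), IsGridSet n S → Measurable fun ω =>
        (factProc η Λ n ω).restrict (univ.pi fun _ => D) S := by
      rintro _ ⟨r, φ, hφ, T, rfl⟩
      have hφn : Measurable (fun (x : Fin n → X) j => φ (x j)) :=
        measurable_pi_lambda _ fun j => hφ.comp (measurable_pi_apply j)
      have hT : T = ((T.toFinite.toFinset : Finset _) : Set (Fin n → Fin r)) := by simp
      have hC : ∀ c, MeasurableSet (φ ⁻¹' {c} ∩ D) := fun c =>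
        (hφ (measurableSet_singleton c)).inter hD
      have hval : ∀ ω (i : Fin n → Fin r), (factProc η Λ n ω).restrict (univ.pi fun _ => D)
          ((fun x j => φ (x j)) ⁻¹' {i}) = (finiteOnSpanning η Λ).indicator
            (fun ω => ((fallProd (counts η (fun c => φ ⁻¹' {c} ∩ D) ω) i : ℕ) : ℝ≥0∞)) ω := by
        intro ω i
        rw [Measure.restrict_apply (hφn (measurableSet_singleton i)), fiber_inter_eq_cell]
        by_cases hω : ω ∈ finiteOnSpanning η Λ
        · rw [factProc, if_pos hω, indicator_of_mem hω]
          refine hasCellValues_factorialMeasure (hη.isPointMeasure ω) n r _ _ hC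
            (pairwise_disjoint_fiber_inter φ D) (fun c => ?_) i
          obtain ⟨m, hm⟩ := (hη.isPointMeasure ω).exists_nat (hC c)
            ((measure_mono inter_subset_right).trans_lt (hω k))
          rw [counts, hm]
          simp
        · rw [factProc, if_neg hω, indicator_of_notMem hω]
          simp
      rw [hT]
      simp_rw [← sum_measure_preimage_singleton _ (fun i _ => hφn (measurableSet_singleton i)),
        hval]
      refine Finset.measurable_fun_sum _ fun i _ => ?_
      refine Measurable.indicator ?_ hη.measurableSet_finiteOnSpanning
      exact (measurable_of_countable fun N : Fin r → ℕ => ((fallProd N i : ℕ) : ℝ≥0∞)).comp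
        (hη.measurable_counts hC)
    refine Measure.measurable_of_measurable_coe _ fun S hS => ?_
    induction S, hS using MeasurableSpace.induction_on_inter (generateFrom_isGridSet n)
      (isSetAlgebra_isGridSet n).isSetRing.isSetSemiring.isPiSystem with
    | empty => simp
    | basic S hS => exact hgrid S hS
    | compl S hS ih =>
      have : ∀ ω, (factProc η Λ n ω).restrict (univ.pi fun _ => D) Sᶜ =
          (factProc η Λ n ω).restrict (univ.pi fun _ => D) univ -
            (factProc η Λ n ω).restrict (univ.pi fun _ => D) S := fun ω =>
        measure_compl hS (measure_ne_top _ _)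
      simp_rw [this]
      exact (hgrid _ (isSetAlgebra_isGridSet n).univ_mem).sub ih
    | iUnion S hdisj hS ih =>
      simp_rw [measure_iUnion hdisj hS]
      exact Measurable.tsum ih
  refine Measure.measurable_of_measurable_coe _ fun S hS => ?_
  have : ∀ ω, factProc η Λ n ω S =
      ⨆ k, (factProc η Λ n ω).restrict (univ.pi fun _ => spanningSets Λ k) S := by
    intro ω
    simp_rw [Measure.restrict_apply hS]
    rw [← Monotone.measure_iUnion, ← inter_iUnion,
      iUnion_univ_pi_of_monotone fun _ => monotone_spanningSets Λ]
    · simp [iUnion_spanningSets]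
    · intro k l hkl
      exact inter_subset_inter_right _ (pi_mono fun _ _ => monotone_spanningSets Λ hkl)
  simp_rw [this]
  exact Measurable.iSup fun k => (Measure.measurable_coe hS).comp (key k)

/-- The Campbell formula as an equality of measures: the mean of the factorial measure is the power
of the intensity measure. On products of cells it is the formula for the factorial moments of
independent Poisson variables. -/
lemma IsPoissonProcess.bind_factProc [IsProbabilityMeasure P] [SigmaFinite Λ]
    (hη : IsPoissonProcess η Λ P) (n : ℕ) :
    P.bind (factProc η Λ n) = Measure.pi fun _ => Λ := by
  have hm := hη.measurable_factProc n
  have hcell : ∀ (r : ℕ) (C : Fin r → Set X) (_ : ∀ c, MeasurableSet (C c))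
      (_ : Pairwise (fun c d => Disjoint (C c) (C d))) (_ : ∀ c, Λ (C c) < ∞) (i : Fin n → Fin r),
      P.bind (factProc η Λ n) (cell C i) = Measure.pi (fun _ => Λ) (cell C i) := by
    intro r C hC hdisj hfin i
    rw [Measure.bind_apply (measurableSet_cell hC i) hm.aemeasurable, cell, Measure.pi_pi]
    have h1 : ∀ᵐ ω ∂P, factProc η Λ n ω (univ.pi fun j => C (i j)) =
        ((fallProd (counts η C ω) i : ℕ) : ℝ≥0∞) := by
      filter_upwards [hη.ae_factProc_eq n, hη.ae_eq_counts hC hfin] with ω h1 h2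
      rw [h1]
      exact hasCellValues_factorialMeasure (hη.isPointMeasure ω) n r C _ hC hdisj h2 i
    rw [lintegral_congr_ae h1, ← lintegral_map (f := fun N : Fin r → ℕ =>
      ((fallProd N i : ℕ) : ℝ≥0∞)) (measurable_of_countable _) (hη.measurable_counts hC),
      hη.map_counts hC hdisj hfin, lintegral_fallProd_poissonPi]
    exact Finset.prod_congr rfl fun j _ => ENNReal.coe_toNNReal (hfin _).ne
  have huniv : ⋃ k, (univ.pi fun _ : Fin n => spanningSets Λ k) = univ := by
    rw [iUnion_univ_pi_of_monotone fun _ => monotone_spanningSets Λ]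
    simp [iUnion_spanningSets]
  -- both measures are determined by their restrictions to an exhausting sequence of finite measure
  refine (Measure.ext_iff_of_iUnion_eq_univ huniv).2 fun k => ?_
  set D := spanningSets Λ k
  have hD : MeasurableSet D := measurableSet_spanningSets Λ k
  have hDk : Λ D < ∞ := measure_spanningSets_lt_top Λ k
  have hDfin : Measure.pi (fun _ => Λ) (univ.pi fun _ : Fin n => D) < ∞ := by
    rw [Measure.pi_pi]
    exact ENNReal.prod_lt_top fun _ _ => hDk
  have i1 : IsFiniteMeasure ((Measure.pi fun _ => Λ).restrict (univ.pi fun _ : Fin n => D)) :=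
    isFiniteMeasure_restrict.2 hDfin.ne
  have i2 : IsFiniteMeasure ((P.bind (factProc η Λ n)).restrict (univ.pi fun _ : Fin n => D)) := by
    have := hcell 1 (fun _ => D) (fun _ => hD)
      (fun c d hcd => absurd (Subsingleton.elim c d) hcd) (fun _ => hDk) fun _ => 0
    rw [cell] at this
    exact isFiniteMeasure_restrict.2 (this ▸ hDfin.ne)
  have hfib : ∀ (r : ℕ) (φ : X → Fin r), Measurable φ → ∀ i : Fin n → Fin r,
      (P.bind (factProc η Λ n)).restrict (univ.pi fun _ : Fin n => D)
        ((fun x j => φ (x j)) ⁻¹' {i}) =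
      (Measure.pi fun _ => Λ).restrict (univ.pi fun _ : Fin n => D)
        ((fun x j => φ (x j)) ⁻¹' {i}) := by
    intro r φ hφ i
    have hφn : Measurable (fun (x : Fin n → X) j => φ (x j)) :=
      measurable_pi_lambda _ fun j => hφ.comp (measurable_pi_apply j)
    rw [Measure.restrict_apply (hφn (measurableSet_singleton i)),
      Measure.restrict_apply (hφn (measurableSet_singleton i)), fiber_inter_eq_cell]
    exact hcell r _ (fun c => (hφ (measurableSet_singleton c)).inter hD)
      (pairwise_disjoint_fiber_inter φ D)
      (fun c => (measure_mono inter_subset_right).trans_lt hDk) i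
  exact le_antisymm (le_of_le_on_fibers fun r φ hφ i => (hfib r φ hφ i).le)
    (le_of_le_on_fibers fun r φ hφ i => (hfib r φ hφ i).ge)

end Poisson

/-! ### Symmetric functions of tuples -/

/-- Invariance under permutations of the arguments. -/
def IsSymmetric {Y : Type*} {n : ℕ} (a : (Fin n → Y) → ℝ) : Prop :=
  ∀ (s : Equiv.Perm (Fin n)) (x : Fin n → Y), a (x ∘ s) = a x

lemma IsSymmetric.snoc_eq_cons {Y : Type*} {n : ℕ} {a : (Fin (n + 1) → Y) → ℝ} (ha : IsSymmetric a)
    (x : Fin n → Y) (y : Y) :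
    a (Fin.snoc x y : Fin (n + 1) → Y) = a (Fin.cons y x : Fin (n + 1) → Y) := by
  rw [Fin.snoc_eq_cons_rotate]
  exact ha (finRotate (n + 1)) (Fin.cons y x : Fin (n + 1) → Y)

lemma IsSymmetric.cons {Y : Type*} {n : ℕ} {a : (Fin (n + 1) → Y) → ℝ} (ha : IsSymmetric a)
    (y : Y) : IsSymmetric fun x : Fin n → Y => a (Fin.cons y x : Fin (n + 1) → Y) := by
  intro s x
  change a (Fin.cons y (x ∘ s) : Fin (n + 1) → Y) = a (Fin.cons y x : Fin (n + 1) → Y)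
  rw [← ha (Equiv.Perm.decomposeFin.symm (0, s)) (Fin.cons y x : Fin (n + 1) → Y)]
  congr 1
  funext j
  refine Fin.cases ?_ (fun j => ?_) j <;> simp

lemma IsSymmetric.cons_cons {Y : Type*} {n : ℕ} {a : (Fin (n + 2) → Y) → ℝ} (ha : IsSymmetric a)
    (y z : Y) (x : Fin n → Y) :
    a (Fin.cons y (Fin.cons z x : Fin (n + 1) → Y) : Fin (n + 2) → Y) =
      a (Fin.cons z (Fin.cons y x : Fin (n + 1) → Y) : Fin (n + 2) → Y) := by
  rw [← ha (Equiv.swap 0 1) (Fin.cons z (Fin.cons y x : Fin (n + 1) → Y) : Fin (n + 2) → Y)]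
  congr 1
  funext j
  refine Fin.cases ?_ (fun j => Fin.cases ?_ (fun j => ?_) j) j
  · simp
  · simp
  · have h : Equiv.swap (0 : Fin (n + 2)) 1 j.succ.succ = j.succ.succ :=
      Equiv.swap_apply_of_ne_of_ne (Fin.succ_ne_zero _)
        (by simp [Fin.ext_iff])
    rw [Function.comp_apply, h]
    simp

/-! ### Compensated sums of independent Poisson variables -/

/-- The alternating binomial sum that turns moments into compensated moments. -/
noncomputable def altSum (n : ℕ) (M : ℕ → ℝ) : ℝ :=
  ∑ k ∈ Finset.range (n + 1), (-1 : ℝ) ^ (n + k) * n.choose k * M k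

/-- Pascal's rule for the coefficients. -/
lemma altSum_succ (n : ℕ) (M : ℕ → ℝ) :
    altSum (n + 1) M = altSum n (fun k => M (k + 1)) - altSum n M := by
  have h1 : altSum n M =
      ∑ k ∈ Finset.range (n + 2), (-1 : ℝ) ^ (n + k) * n.choose k * M k := by
    rw [Finset.sum_range_succ, Nat.choose_succ_self]
    simp [altSum]
  rw [h1, altSum, Finset.sum_range_succ', Finset.sum_range_succ' _ (n + 1), altSum,
    sub_add_eq_sub_sub, ← Finset.sum_sub_distrib]
  have : ∀ k, (-1 : ℝ) ^ (n + 1 + (k + 1)) * (n + 1).choose (k + 1) * M (k + 1) =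
      (-1 : ℝ) ^ (n + k) * n.choose k * M (k + 1) -
        (-1 : ℝ) ^ (n + (k + 1)) * n.choose (k + 1) * M (k + 1) := by
    intro k
    rw [Nat.choose_succ_succ]
    push_cast
    ring
  rw [Finset.sum_congr rfl fun k _ => this k]
  simp
  ring

lemma altSum_congr {n : ℕ} {M M' : ℕ → ℝ} (h : ∀ k ≤ n, M k = M' k) : altSum n M = altSum n M' :=
  Finset.sum_congr rfl fun k hk => by rw [h k (Nat.lt_succ_iff.1 (Finset.mem_range.1 hk))]

lemma altSum_sum {ι : Type*} (s : Finset ι) (n : ℕ) (w : ι → ℝ) (M : ι → ℕ → ℝ) :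
    altSum n (fun k => ∑ c ∈ s, w c * M c k) = ∑ c ∈ s, w c * altSum n (M c) := by
  simp only [altSum, Finset.mul_sum]
  rw [Finset.sum_comm]
  exact Finset.sum_congr rfl fun c _ => Finset.sum_congr rfl fun k _ => by ring

section Discrete

variable {r : ℕ} (ρ : Fin r → ℝ≥0)

/-- For points that are counted by `N` in finitely many cells with intensities `ρ`: the sum of
`a (i₁, …, iₙ)` in which the first `k` arguments run through distinct points and the others are
integrated against `ρ`. -/
noncomputable def cellMix : (n : ℕ) → ((Fin n → Fin r) → ℝ) → ℕ → (Fin r → ℕ) → ℝ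
  | 0, a, _, N => ∑ i, a i * fallProd N i
  | n + 1, a, k, N =>
    if k = n + 1 then ∑ i, a i * fallProd N i
    else cellMix n (fun i => ∑ c, (ρ c : ℝ) * a (Fin.snoc i c : Fin (n + 1) → Fin r)) k N

/-- The compensated `n`-fold sum of `a`, which is a multiple Wiener-Itô integral. -/
noncomputable def cellInt (n : ℕ) (a : (Fin n → Fin r) → ℝ) (N : Fin r → ℕ) : ℝ :=
  altSum n fun k => cellMix ρ n a k N

lemma cellMix_sum (n : ℕ) (w : Fin r → ℝ) (b : Fin r → (Fin n → Fin r) → ℝ) (k : ℕ)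
    (N : Fin r → ℕ) :
    cellMix ρ n (fun i => ∑ c, w c * b c i) k N = ∑ c, w c * cellMix ρ n (b c) k N := by
  have key : ∀ m (b : Fin r → (Fin m → Fin r) → ℝ),
      ∑ i, (∑ c, w c * b c i) * fallProd N i = ∑ c, w c * ∑ i, b c i * fallProd N i := by
    intro m b
    simp only [Finset.sum_mul, Finset.mul_sum]
    rw [Finset.sum_comm]
    exact Finset.sum_congr rfl fun c _ => Finset.sum_congr rfl fun k _ => by ring
  induction n generalizing k with
  | zero => exact key 0 b
  | succ n ih =>
    simp only [cellMix]
    split_ifs with h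
    · exact key _ b
    · rw [← ih]
      congr 1
      funext i
      simp only [Finset.mul_sum]
      rw [Finset.sum_comm]
      exact Finset.sum_congr rfl fun c _ => Finset.sum_congr rfl fun k _ => by ring

/-- Removal of a point from the cell `c`. -/
def dec (c : Fin r) (N : Fin r → ℕ) : Fin r → ℕ := Function.update N c (N c - 1)

/-- Addition of a point to the cell `c`. -/
def inc (c : Fin r) (N : Fin r → ℕ) : Fin r → ℕ := Function.update N c (N c + 1)

lemma sum_mul_fallProd_succ (n : ℕ) (a : (Fin (n + 1) → Fin r) → ℝ) (N : Fin r → ℕ) :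
    ∑ i, a i * fallProd N i =
      ∑ c, (N c : ℝ) * ∑ i, a (Fin.cons c i : Fin (n + 1) → Fin r) * fallProd (dec c N) i := by
  rw [← (Fin.consEquiv fun _ : Fin (n + 1) => Fin r).sum_comp, Fintype.sum_prod_type]
  refine Finset.sum_congr rfl fun c _ => ?_
  rw [Finset.mul_sum]
  refine Finset.sum_congr rfl fun i _ => ?_
  change a (Fin.cons c i : Fin (n + 1) → Fin r) *
    fallProd N (Fin.cons c i : Fin (n + 1) → Fin r) = _
  rw [fallProd_cons, dec]
  push_cast
  ring

/-- If at least one argument runs through points of the process, the first of them can be singled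
out: it lies in some cell `c`, and the other arguments see the configuration without it. -/
lemma cellMix_succ_succ (n : ℕ) (a : (Fin (n + 1) → Fin r) → ℝ) {k : ℕ} (hk : k ≤ n)
    (N : Fin r → ℕ) :
    cellMix ρ (n + 1) a (k + 1) N =
      ∑ c, (N c : ℝ) *
        cellMix ρ n (fun i => a (Fin.cons c i : Fin (n + 1) → Fin r)) k (dec c N) := by
  induction n with
  | zero =>
    obtain rfl : k = 0 := by omega
    simp only [cellMix]
    exact sum_mul_fallProd_succ 0 a N
  | succ n ih =>
    rcases Nat.lt_or_ge k (n + 1) with h | h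
    · have h1 : cellMix ρ (n + 2) a (k + 1) N = cellMix ρ (n + 1)
          (fun i => ∑ c, (ρ c : ℝ) * a (Fin.snoc i c : Fin (n + 2) → Fin r)) (k + 1) N := by
        rw [cellMix, if_neg (by omega)]
      rw [h1, ih _ (by omega)]
      refine Finset.sum_congr rfl fun c _ => ?_
      rw [cellMix, if_neg (by omega)]
      simp only [Fin.cons_snoc_eq_snoc_cons]
    · obtain rfl : k = n + 1 := by omega
      simp only [cellMix, if_true]
      exact sum_mul_fallProd_succ (n + 1) a N

lemma cellMix_succ_of_le (n : ℕ) {a : (Fin (n + 1) → Fin r) → ℝ} (ha : IsSymmetric a) {k : ℕ}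
    (hk : k ≤ n) (N : Fin r → ℕ) :
    cellMix ρ (n + 1) a k N =
      ∑ c, (ρ c : ℝ) * cellMix ρ n (fun i => a (Fin.cons c i : Fin (n + 1) → Fin r)) k N := by
  rw [cellMix, if_neg (by omega), ← cellMix_sum]
  simp only [ha.snoc_eq_cons]

/-- The compensated sum as a discrete Skorohod integral: one argument is singled out and integrated
with respect to the compensated points, where a point of the process is taken out of the
configuration that the other arguments see. -/
lemma cellInt_succ (n : ℕ) {a : (Fin (n + 1) → Fin r) → ℝ} (ha : IsSymmetric a) (N : Fin r → ℕ) :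
    cellInt ρ (n + 1) a N =
      ∑ c, (N c : ℝ) * cellInt ρ n (fun i => a (Fin.cons c i : Fin (n + 1) → Fin r)) (dec c N) -
      ∑ c, (ρ c : ℝ) * cellInt ρ n (fun i => a (Fin.cons c i : Fin (n + 1) → Fin r)) N := by
  simp only [cellInt]
  rw [altSum_succ, ← altSum_sum, ← altSum_sum]
  exact congrArg₂ _ (altSum_congr fun k hk => cellMix_succ_succ ρ n a hk N)
    (altSum_congr fun k hk => cellMix_succ_of_le ρ n ha hk N)

/-- Removal of a point after the addition of one: either the added point is removed again, or a
point that was there before, and then the order of the operations does not matter. -/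
lemma natCast_mul_dec_inc (F : (Fin r → ℕ) → ℝ) (c d : Fin r) (N : Fin r → ℕ) :
    (inc c N d : ℝ) * F (dec d (inc c N)) =
      (if d = c then F N else 0) + N d * F (inc c (dec d N)) := by
  by_cases h : d = c
  · subst h
    rw [if_pos rfl]
    have h1 : dec d (inc d N) = N := by simp [dec, inc]
    have h2 : inc d N d = N d + 1 := by simp [inc]
    rw [h1, h2]
    rcases Nat.eq_zero_or_pos (N d) with h0 | h0
    · simp [h0]
    · have h3 : inc d (dec d N) = N := by
        simp only [dec, inc, Function.update_self, Function.update_idem]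
        rw [Nat.sub_add_cancel h0, Function.update_eq_self]
      rw [h3]
      push_cast
      ring
  · have h1 : inc c N d = N d := by simp [inc, h]
    have h2 : dec d (inc c N) = inc c (dec d N) := by
      simp only [dec, inc, Function.update_of_ne h, Function.update_of_ne (Ne.symm h)]
      exact Function.update_comm (Ne.symm h) _ _ _
    rw [if_neg h, h1, h2, zero_add]

/-- Adding a point lowers the order of the compensated sum by one, as the derivative of a power. -/
lemma cellInt_inc_sub (n : ℕ) {a : (Fin (n + 1) → Fin r) → ℝ} (ha : IsSymmetric a) (c : Fin r)
    (N : Fin r → ℕ) :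
    cellInt ρ (n + 1) a (inc c N) - cellInt ρ (n + 1) a N =
      (n + 1) * cellInt ρ n (fun i => a (Fin.cons c i : Fin (n + 1) → Fin r)) N := by
  classical
  induction n generalizing N with
  | zero =>
    rw [cellInt_succ ρ 0 ha, cellInt_succ ρ 0 ha]
    have h0 : ∀ (b : (Fin 0 → Fin r) → ℝ) M, cellInt ρ 0 b M = b Fin.elim0 := by
      intro b M
      simp [cellInt, altSum, cellMix, fallProd, occ,
        Subsingleton.elim _ (Fin.elim0 : Fin 0 → Fin r)]
    simp only [h0]
    have : ∀ d, (inc c N d : ℝ) = N d + if d = c then 1 else 0 := by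
      intro d
      by_cases h : d = c
      · subst h
        simp [inc]
      · simp [inc, h]
    simp_rw [this, add_mul, Finset.sum_add_distrib]
    simp
  | succ n ih =>
    rw [cellInt_succ ρ _ ha, cellInt_succ ρ _ ha]
    set F : Fin r → (Fin r → ℕ) → ℝ :=
      fun d => cellInt ρ (n + 1) (fun i => a (Fin.cons d i : Fin (n + 2) → Fin r)) with hF
    have hDF : ∀ d M, F d (inc c M) - F d M = (n + 1) *
        cellInt ρ n (fun i => a (Fin.cons c (Fin.cons d i : Fin (n + 1) → Fin r) :
          Fin (n + 2) → Fin r)) M := by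
      intro d M
      rw [hF]
      simp only
      rw [ih (ha.cons d) M]
      simp only [ha.cons_cons d c]
    have hrec := cellInt_succ ρ n (ha.cons c) N
    calc _ = ∑ d, ((if d = c then F d N else 0) + N d * F d (inc c (dec d N))) -
            ∑ d, (ρ d : ℝ) * F d (inc c N) -
          (∑ d, (N d : ℝ) * F d (dec d N) - ∑ d, (ρ d : ℝ) * F d N) := by
          simp_rw [← natCast_mul_dec_inc]
          rfl
      _ = F c N + (∑ d, (N d : ℝ) * (F d (inc c (dec d N)) - F d (dec d N)) -
            ∑ d, (ρ d : ℝ) * (F d (inc c N) - F d N)) := by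
          simp only [Finset.sum_add_distrib, Finset.sum_ite_eq', Finset.mem_univ, if_true, mul_sub,
            Finset.sum_sub_distrib]
          ring
      _ = F c N + (n + 1) * F c N := by
          simp only [hDF]
          rw [show F c N = _ from hrec, mul_sub, Finset.mul_sum, Finset.mul_sum]
          congr 2 <;> exact Finset.sum_congr rfl fun d _ => by ring
      _ = _ := by
          rw [hF]
          push_cast
          ring

end Discrete

/-! ### The isometry for compensated Poisson sums -/

section Discrete

variable {r : ℕ} (ρ : Fin r → ℝ≥0)

/-- At most exponential growth in the total number of points; such functions form an algebra and are
integrable. -/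
def ExpBounded (G : (Fin r → ℕ) → ℝ) : Prop :=
  ∃ K b : ℝ, 0 ≤ K ∧ 1 ≤ b ∧ ∀ N, |G N| ≤ K * b ^ (∑ c, N c)

lemma ExpBounded.mul {G H : (Fin r → ℕ) → ℝ} (hG : ExpBounded G) (hH : ExpBounded H) :
    ExpBounded fun N => G N * H N := by
  obtain ⟨K, b, hK, hb, h⟩ := hG
  obtain ⟨K', b', hK', hb', h'⟩ := hH
  refine ⟨K * K', b * b', by positivity, one_le_mul_of_one_le_of_one_le hb hb', fun N => ?_⟩
  rw [abs_mul, mul_pow]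
  calc _ ≤ (K * b ^ (∑ c, N c)) * (K' * b' ^ (∑ c, N c)) :=
        mul_le_mul (h N) (h' N) (abs_nonneg _) (by positivity)
    _ = _ := by ring

lemma ExpBounded.add {G H : (Fin r → ℕ) → ℝ} (hG : ExpBounded G) (hH : ExpBounded H) :
    ExpBounded fun N => G N + H N := by
  obtain ⟨K, b, hK, hb, h⟩ := hG
  obtain ⟨K', b', hK', hb', h'⟩ := hH
  refine ⟨K + K', max b b', by positivity, le_max_of_le_left hb, fun N => ?_⟩
  calc _ ≤ |G N| + |H N| := abs_add_le _ _
    _ ≤ K * b ^ (∑ c, N c) + K' * b' ^ (∑ c, N c) := add_le_add (h N) (h' N)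
    _ ≤ K * max b b' ^ (∑ c, N c) + K' * max b b' ^ (∑ c, N c) := by
        gcongr
        · exact le_max_left _ _
        · exact le_max_right _ _
    _ = _ := by ring

lemma expBounded_const (x : ℝ) : ExpBounded fun _ : Fin r → ℕ => x :=
  ⟨|x|, 1, abs_nonneg x, le_rfl, fun N => by simp⟩

lemma ExpBounded.sum {ι : Type*} (s : Finset ι) {G : ι → (Fin r → ℕ) → ℝ}
    (h : ∀ c, ExpBounded (G c)) : ExpBounded fun N => ∑ c ∈ s, G c N := by
  classical
  induction s using Finset.induction_on with
  | empty => simpa using expBounded_const 0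
  | insert c s hc ih =>
    simp only [Finset.sum_insert hc]
    exact (h c).add ih

lemma expBounded_apply (c : Fin r) : ExpBounded fun N : Fin r → ℕ => (N c : ℝ) := by
  refine ⟨1, 2, zero_le_one, one_le_two, fun N => ?_⟩
  have h1 : N c ≤ ∑ c, N c := Finset.single_le_sum (f := N) (fun _ _ => Nat.zero_le _)
    (Finset.mem_univ c)
  have h2 : N c ≤ 2 ^ (∑ c, N c) := Nat.lt_two_pow_self.le.trans (Nat.pow_le_pow_right two_pos h1)
  rw [one_mul, Nat.abs_cast]
  exact_mod_cast h2

lemma ExpBounded.comp_of_sum_le {G : (Fin r → ℕ) → ℝ} (hG : ExpBounded G)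
    {T : (Fin r → ℕ) → Fin r → ℕ} (hT : ∀ N, ∑ c, T N c ≤ ∑ c, N c + 1) :
    ExpBounded fun N => G (T N) := by
  obtain ⟨K, b, hK, hb, h⟩ := hG
  refine ⟨K * b, b, by positivity, hb, fun N => (h _).trans ?_⟩
  calc K * b ^ (∑ c, T N c) ≤ K * b ^ (∑ c, N c + 1) := by
        gcongr
        exact hT N
    _ = _ := by ring

lemma sum_inc_le (c : Fin r) (N : Fin r → ℕ) : ∑ d, inc c N d ≤ ∑ d, N d + 1 := by
  rw [inc, Finset.sum_update_of_mem (Finset.mem_univ c),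
    ← Finset.add_sum_erase (a := c) _ N (Finset.mem_univ c), Finset.sdiff_singleton_eq_erase]
  omega

lemma sum_dec_le (c : Fin r) (N : Fin r → ℕ) : ∑ d, dec c N d ≤ ∑ d, N d + 1 := by
  rw [dec, Finset.sum_update_of_mem (Finset.mem_univ c),
    ← Finset.add_sum_erase (a := c) _ N (Finset.mem_univ c), Finset.sdiff_singleton_eq_erase]
  omega

lemma expBounded_fallProd {n : ℕ} (i : Fin n → Fin r) :
    ExpBounded fun N : Fin r → ℕ => (fallProd N i : ℝ) := by
  induction n with
  | zero => simpa [fallProd, occ] using expBounded_const 1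
  | succ n ih =>
    obtain ⟨d, i, rfl⟩ : ∃ (d : Fin r) (i' : Fin n → Fin r), Fin.cons d i' = i :=
      ⟨i 0, Fin.tail i, Fin.cons_self_tail i⟩
    simp_rw [fallProd_cons, Nat.cast_mul]
    exact (expBounded_apply d).mul ((ih i).comp_of_sum_le (T := dec d) (sum_dec_le d))

lemma expBounded_cellMix (n : ℕ) (a : (Fin n → Fin r) → ℝ) (k : ℕ) :
    ExpBounded (cellMix ρ n a k) := by
  have key : ∀ m (a : (Fin m → Fin r) → ℝ),
      ExpBounded fun N : Fin r → ℕ => ∑ i, a i * fallProd N i := fun m a =>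
    ExpBounded.sum _ fun i => (expBounded_const (a i)).mul (expBounded_fallProd i)
  induction n with
  | zero => exact key 0 a
  | succ n ih =>
    by_cases h : k = n + 1
    · convert key (n + 1) a using 1
      funext N
      rw [cellMix, if_pos h]
    · convert ih (fun i => ∑ c, (ρ c : ℝ) * a (Fin.snoc i c : Fin (n + 1) → Fin r)) using 1
      funext N
      rw [cellMix, if_neg h]

lemma expBounded_cellInt (n : ℕ) (a : (Fin n → Fin r) → ℝ) : ExpBounded (cellInt ρ n a) := by
  unfold cellInt altSum
  exact ExpBounded.sum _ fun k => (expBounded_const _).mul (expBounded_cellMix ρ n a k)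

lemma integrable_pow_poissonMeasure (a : ℝ≥0) (b : ℝ) :
    Integrable (fun n : ℕ => b ^ n) (poissonMeasure a) := by
  rw [integrable_poissonMeasure_iff]
  have := (Real.summable_pow_div_factorial (a * |b|)).mul_left (Real.exp (-a))
  refine this.congr fun n => ?_
  rw [Real.norm_eq_abs, abs_pow, mul_pow]
  ring

lemma ExpBounded.integrable {G : (Fin r → ℕ) → ℝ} (hG : ExpBounded G) :
    Integrable G (poissonPi ρ) := by
  obtain ⟨K, b, hK, hb, h⟩ := hG
  have h1 : Integrable (fun N : Fin r → ℕ => ∏ c, b ^ N c) (poissonPi ρ) :=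
    Integrable.fintype_prod (f := fun _ n => b ^ n) fun c => integrable_pow_poissonMeasure (ρ c) b
  refine (h1.const_mul K).mono' (measurable_of_countable G).aestronglyMeasurable
    (ae_of_all _ fun N => ?_)
  rw [Finset.prod_pow_eq_pow_sum]
  exact h N

/-- The Mecke formula for integrals of real functions. -/
lemma integral_mul_dec_poissonPi (d : Fin r) (G : (Fin r → ℕ) → ℝ) :
    ∫ N, (N d : ℝ) * G (dec d N) ∂poissonPi ρ = ρ d * ∫ N, G N ∂poissonPi ρ := by
  have hN : Measurable fun N : Fin r → ℕ => (N d : ℝ≥0) := measurable_of_countable _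
  have hd : Measurable (dec d : (Fin r → ℕ) → Fin r → ℕ) := measurable_of_countable _
  -- the formula for indicator functions is an equality of measures
  have h : ((poissonPi ρ).withDensity fun N => ((N d : ℝ≥0) : ℝ≥0∞)).map (dec d) =
      ρ d • poissonPi ρ := by
    refine Measure.ext fun S hS => ?_
    rw [Measure.map_apply hd hS, withDensity_apply _ (hd hS), ← lintegral_indicator (hd hS)]
    have := lintegral_mul_pred_poissonPi ρ d (S.indicator 1)
    rw [lintegral_indicator_one hS] at this
    rw [Measure.smul_apply, ENNReal.smul_def, smul_eq_mul, ← this]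
    refine lintegral_congr fun N => ?_
    change _ = _ * S.indicator 1 (dec d N)
    by_cases hN : dec d N ∈ S <;> simp [hN]
  have h2 : ∫ N, G N ∂((poissonPi ρ).withDensity fun N => ((N d : ℝ≥0) : ℝ≥0∞)).map (dec d) =
      ∫ N, G N ∂(ρ d • poissonPi ρ) := by rw [h]
  rw [integral_map hd.aemeasurable (measurable_of_countable G).aestronglyMeasurable,
    integral_withDensity_eq_integral_smul hN, integral_smul_nnreal_measure] at h2
  simpa [NNReal.smul_def] using h2

/-- The isometry property of the compensated sums. One factor is written as a discrete Skorohod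
integral; the Mecke formula then turns the removal of a point there into the addition of a point in
the other factor, and the difference that arises is of lower order by `cellInt_inc_sub`. -/
lemma integral_cellInt_sq (n : ℕ) {a : (Fin n → Fin r) → ℝ} (ha : IsSymmetric a) :
    ∫ N, cellInt ρ n a N ^ 2 ∂poissonPi ρ =
      n.factorial * ∑ i, a i ^ 2 * ∏ j, (ρ (i j) : ℝ) := by
  induction n with
  | zero =>
    have h0 : ∀ N, cellInt ρ 0 a N = a Fin.elim0 := fun N => by
      simp [cellInt, altSum, cellMix, fallProd, occ,
        Subsingleton.elim _ (Fin.elim0 : Fin 0 → Fin r)]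
    simp [h0, Subsingleton.elim _ (Fin.elim0 : Fin 0 → Fin r)]
  | succ n ih =>
    set G := cellInt ρ (n + 1) a with hG
    set F : Fin r → (Fin r → ℕ) → ℝ :=
      fun d => cellInt ρ n (fun i => a (Fin.cons d i : Fin (n + 1) → Fin r)) with hF
    have hGe : ExpBounded G := expBounded_cellInt ρ _ _
    have hFe : ∀ d, ExpBounded (F d) := fun d => expBounded_cellInt ρ _ _
    -- for `N d = 0`, where `inc d (dec d N) ≠ N`, both sides vanish
    have hinc : ∀ d N, (N d : ℝ) * F d (dec d N) * G N =
        N d * (F d (dec d N) * G (inc d (dec d N))) := by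
      intro d N
      rcases Nat.eq_zero_or_pos (N d) with h0 | h0
      · simp [h0]
      · have h3 : inc d (dec d N) = N := by
          simp only [dec, inc, Function.update_self, Function.update_idem]
          rw [Nat.sub_add_cancel h0, Function.update_eq_self]
        rw [h3, mul_assoc]
    calc ∫ N, G N ^ 2 ∂poissonPi ρ
        = ∫ N, (∑ d, (N d : ℝ) * (F d (dec d N) * G (inc d (dec d N))) -
            ∑ d, (ρ d : ℝ) * (F d N * G N)) ∂poissonPi ρ := by
          refine integral_congr_ae (ae_of_all _ fun N => ?_)
          simp only [← hinc]
          rw [sq]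
          conv_lhs => enter [1]; rw [hG, cellInt_succ ρ n ha]
          rw [sub_mul, Finset.sum_mul, Finset.sum_mul]
          simp only [mul_assoc, hF]
      _ = ∑ d, (ρ d : ℝ) * ∫ N, F d N * G (inc d N) ∂poissonPi ρ -
            ∑ d, (ρ d : ℝ) * ∫ N, F d N * G N ∂poissonPi ρ := by
          have e1 : ∀ d, ExpBounded fun N : Fin r → ℕ =>
              (N d : ℝ) * (F d (dec d N) * G (inc d (dec d N))) := fun d =>
            (expBounded_apply d).mul
              (((hFe d).mul (hGe.comp_of_sum_le (sum_inc_le d))).comp_of_sum_le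
                (T := dec d) (sum_dec_le d))
          have e2 : ∀ d, ExpBounded fun N : Fin r → ℕ => (ρ d : ℝ) * (F d N * G N) := fun d =>
            (expBounded_const _).mul ((hFe d).mul hGe)
          rw [integral_sub ((ExpBounded.sum _ e1).integrable ρ)
              ((ExpBounded.sum _ e2).integrable ρ),
            integral_finsetSum _ fun d _ => (e1 d).integrable ρ,
            integral_finsetSum _ fun d _ => (e2 d).integrable ρ]
          congr 1
          · exact Finset.sum_congr rfl fun d _ =>
              integral_mul_dec_poissonPi ρ d fun N => F d N * G (inc d N)
          · exact Finset.sum_congr rfl fun d _ => integral_const_mul _ _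
      _ = ∑ d, (ρ d : ℝ) * ((n + 1) * ∫ N, F d N ^ 2 ∂poissonPi ρ) := by
          rw [← Finset.sum_sub_distrib]
          refine Finset.sum_congr rfl fun d _ => ?_
          rw [← mul_sub, ← integral_sub
            (((hFe d).mul (hGe.comp_of_sum_le (sum_inc_le d))).integrable ρ)
            (((hFe d).mul hGe).integrable ρ),
            ← integral_const_mul ((n : ℝ) + 1) (fun N => F d N ^ 2)]
          congr 1
          refine integral_congr_ae (ae_of_all _ fun N => ?_)
          simp only
          rw [← mul_sub, hG, cellInt_inc_sub ρ n ha]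
          simp only [hF]
          ring
      _ = _ := by
          simp only [hF]
          rw [← (Fin.consEquiv fun _ : Fin (n + 1) => Fin r).sum_comp, Fintype.sum_prod_type,
            Finset.mul_sum]
          refine Finset.sum_congr rfl fun d _ => ?_
          rw [ih (ha.cons d), Nat.factorial_succ]
          simp only [Finset.mul_sum]
          refine Finset.sum_congr rfl fun i _ => ?_
          change _ = _ * (a (Fin.cons d i : Fin (n + 1) → Fin r) ^ 2 *
            ∏ j, (ρ ((Fin.cons d i : Fin (n + 1) → Fin r) j) : ℝ))
          rw [Fin.prod_univ_succ]
          simp only [Fin.cons_zero, Fin.cons_succ]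
          push_cast
          ring

end Discrete

/-! ### Integrals against random measures -/

section RandomMeasure

variable {Ω Y : Type*} [MeasurableSpace Ω] [MeasurableSpace Y] {P : Measure Ω} {ν : Ω → Measure Y}
  {M : Measure Y} {g : Y → ℝ}

/-- Here and in the next lemmas, `P.bind ν = M` says that `M` is the mean of the random measure `ν`.
-/
lemma ae_integrable_of_bind_eq (hν : Measurable ν) (hM : P.bind ν = M) (hg : Measurable g)
    (hi : Integrable g M) : ∀ᵐ ω ∂P, Integrable g (ν ω) := by
  have h1 : ∫⁻ ω, ∫⁻ y, ‖g y‖ₑ ∂ν ω ∂P = ∫⁻ y, ‖g y‖ₑ ∂M := by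
    rw [← hM, Measure.lintegral_bind hν.aemeasurable hg.enorm.aemeasurable]
  have h2 : ∫⁻ ω, ∫⁻ y, ‖g y‖ₑ ∂ν ω ∂P ≠ ∞ := h1 ▸ hi.2.ne
  have hm : Measurable fun ω => ∫⁻ y, ‖g y‖ₑ ∂ν ω := (Measure.measurable_lintegral hg.enorm).comp hν
  filter_upwards [ae_lt_top hm h2] with ω hω
  exact ⟨hg.aestronglyMeasurable, hω⟩

lemma aestronglyMeasurable_integral_of_bind_eq (hν : Measurable ν) (hM : P.bind ν = M)
    (hg : Measurable g) (hi : Integrable g M) :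
    AEStronglyMeasurable (fun ω => ∫ y, g y ∂ν ω) P := by
  have hm : Measurable fun ω => (∫⁻ y, ENNReal.ofReal (g y) ∂ν ω).toReal -
      (∫⁻ y, ENNReal.ofReal (-g y) ∂ν ω).toReal :=
    ((Measure.measurable_lintegral hg.ennreal_ofReal).comp hν).ennreal_toReal.sub
      ((Measure.measurable_lintegral hg.neg.ennreal_ofReal).comp hν).ennreal_toReal
  refine hm.aestronglyMeasurable.congr ?_
  filter_upwards [ae_integrable_of_bind_eq hν hM hg hi] with ω hω
  exact (integral_eq_lintegral_pos_part_sub_lintegral_neg_part hω).symm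

lemma eLpNorm_integral_le_of_bind_eq (hν : Measurable ν) (hM : P.bind ν = M) (hg : Measurable g) :
    eLpNorm (fun ω => ∫ y, g y ∂ν ω) 1 P ≤ eLpNorm g 1 M := by
  rw [eLpNorm_one_eq_lintegral_enorm, eLpNorm_one_eq_lintegral_enorm, ← hM,
    Measure.lintegral_bind hν.aemeasurable hg.enorm.aemeasurable]
  exact lintegral_mono fun ω => enorm_integral_le_lintegral_enorm _

lemma integrable_integral_of_bind_eq (hν : Measurable ν) (hM : P.bind ν = M) (hg : Measurable g)
    (hi : Integrable g M) : Integrable (fun ω => ∫ y, g y ∂ν ω) P := by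
  rw [← memLp_one_iff_integrable] at hi ⊢
  exact ⟨aestronglyMeasurable_integral_of_bind_eq hν hM hg (memLp_one_iff_integrable.1 hi),
    (eLpNorm_integral_le_of_bind_eq hν hM hg).trans_lt hi.2⟩

lemma integral_integral_of_bind_eq (hν : Measurable ν) (hM : P.bind ν = M) (hg : Measurable g)
    (hi : Integrable g M) : ∫ ω, ∫ y, g y ∂ν ω ∂P = ∫ y, g y ∂M := by
  have key : ∀ f : Y → ℝ, Measurable f → Integrable f M →
      Integrable (fun ω => (∫⁻ y, ENNReal.ofReal (f y) ∂ν ω).toReal) P ∧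
      ∫ ω, (∫⁻ y, ENNReal.ofReal (f y) ∂ν ω).toReal ∂P =
        (∫⁻ y, ENNReal.ofReal (f y) ∂M).toReal := by
    intro f hf hfi
    have hm : Measurable fun ω => ∫⁻ y, ENNReal.ofReal (f y) ∂ν ω :=
      (Measure.measurable_lintegral hf.ennreal_ofReal).comp hν
    have h1 : ∫⁻ ω, ∫⁻ y, ENNReal.ofReal (f y) ∂ν ω ∂P = ∫⁻ y, ENNReal.ofReal (f y) ∂M := by
      rw [← hM, Measure.lintegral_bind hν.aemeasurable hf.ennreal_ofReal.aemeasurable]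
    have h2 : ∫⁻ y, ENNReal.ofReal (f y) ∂M ≠ ∞ := hfi.lintegral_lt_top.ne
    refine ⟨integrable_toReal_of_lintegral_ne_top hm.aemeasurable (h1 ▸ h2), ?_⟩
    rw [integral_toReal hm.aemeasurable (ae_lt_top hm (h1 ▸ h2)), h1]
  have hae : (fun ω => ∫ y, g y ∂ν ω) =ᵐ[P] fun ω => (∫⁻ y, ENNReal.ofReal (g y) ∂ν ω).toReal -
      (∫⁻ y, ENNReal.ofReal (-g y) ∂ν ω).toReal := by
    filter_upwards [ae_integrable_of_bind_eq hν hM hg hi] with ω hω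
    exact integral_eq_lintegral_pos_part_sub_lintegral_neg_part hω
  rw [integral_congr_ae hae, integral_sub (key g hg hi).1 (key (fun y => -g y) hg.neg hi.neg).1,
    (key g hg hi).2, (key (fun y => -g y) hg.neg hi.neg).2,
    integral_eq_lintegral_pos_part_sub_lintegral_neg_part hi]

end RandomMeasure

/-! ### Partial integration of symmetric kernels -/

section Kernel

variable {X : Type*} [MeasurableSpace X] {Λ : Measure X}

lemma IsSymmKernel.sub {n : ℕ} {g h : (Fin n → X) → ℝ} (hg : IsSymmKernel Λ n g)
    (hh : IsSymmKernel Λ n h) : IsSymmKernel Λ n (g - h) :=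
  ⟨hg.1.sub hh.1, fun s x => by simp [hg.2.1 s x, hh.2.1 s x], hg.2.2.sub hh.2.2⟩

variable [SigmaFinite Λ]

lemma measurePreserving_snoc (n : ℕ) :
    MeasurePreserving (fun p : (Fin n → X) × X => (Fin.snoc p.1 p.2 : Fin (n + 1) → X))
      ((Measure.pi fun _ => Λ).prod Λ) (Measure.pi fun _ => Λ) := by
  refine ⟨measurable_snoc, (Measure.pi_eq fun s hs => ?_).symm⟩
  rw [Measure.map_apply measurable_snoc (MeasurableSet.univ_pi hs)]
  have : (fun p : (Fin n → X) × X => (Fin.snoc p.1 p.2 : Fin (n + 1) → X)) ⁻¹' univ.pi s =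
      (univ.pi fun j : Fin n => s j.castSucc) ×ˢ s (Fin.last n) := by
    ext p
    simp [Fin.forall_fin_succ']
  rw [this, Measure.prod_prod, Measure.pi_pi, Fin.prod_univ_castSucc]

lemma measurePreserving_comp_perm {n : ℕ} (s : Equiv.Perm (Fin n)) :
    MeasurePreserving (fun x : Fin n → X => x ∘ s) (Measure.pi fun _ => Λ)
      (Measure.pi fun _ => Λ) := by
  have hm : Measurable (fun x : Fin n → X => x ∘ s) :=
    measurable_pi_lambda _ fun j => measurable_pi_apply _
  refine ⟨hm, (Measure.pi_eq fun A hA => ?_).symm⟩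
  rw [Measure.map_apply hm (MeasurableSet.univ_pi hA)]
  have : (fun x : Fin n → X => x ∘ s) ⁻¹' univ.pi A = univ.pi fun j => A (s.symm j) := by
    ext x
    simp only [mem_preimage, mem_univ_pi, Function.comp_apply]
    exact ⟨fun h j => by simpa using h (s.symm j), fun h j => by simpa using h (s j)⟩
  rw [this, Measure.pi_pi]
  exact Equiv.prod_comp s.symm fun j => Λ (A j)

/-- Integration of a function of `n + 1` points over the last one. -/
noncomputable def partialInt (Λ : Measure X) {n : ℕ} (g : (Fin (n + 1) → X) → ℝ) (x : Fin n → X) :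
    ℝ :=
  ∫ y, g (Fin.snoc x y : Fin (n + 1) → X) ∂Λ

lemma IsSymmKernel.integrable_snoc {n : ℕ} {g : (Fin (n + 1) → X) → ℝ}
    (hg : IsSymmKernel Λ (n + 1) g) :
    Integrable (fun p : (Fin n → X) × X => g (Fin.snoc p.1 p.2 : Fin (n + 1) → X))
      ((Measure.pi fun _ => Λ).prod Λ) :=
  ((measurePreserving_snoc n).integrable_comp hg.1.aestronglyMeasurable).2 hg.2.2

lemma IsSymmKernel.partialInt {n : ℕ} {g : (Fin (n + 1) → X) → ℝ} (hg : IsSymmKernel Λ (n + 1) g) :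
    IsSymmKernel Λ n (partialInt Λ g) := by
  refine ⟨?_, fun s x => ?_, hg.integrable_snoc.integral_prod_left⟩
  · exact ((hg.1.comp measurable_snoc).stronglyMeasurable.integral_prod_right').measurable
  · have hs : IsSymmetric g := hg.2.1
    simp only [PoissonU.partialInt, hs.snoc_eq_cons]
    exact integral_congr_ae (ae_of_all _ fun y => hs.cons y s x)

lemma integral_partialInt {n : ℕ} {g : (Fin (n + 1) → X) → ℝ} (hg : IsSymmKernel Λ (n + 1) g) :
    ∫ x, partialInt Λ g x ∂(Measure.pi fun _ => Λ) = ∫ x, g x ∂(Measure.pi fun _ => Λ) := by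
  rw [← (measurePreserving_snoc n).map_eq, integral_map measurable_snoc.aemeasurable
    hg.1.aestronglyMeasurable, integral_prod _ hg.integrable_snoc]
  rfl

lemma eLpNorm_one_partialInt_le {n : ℕ} {g : (Fin (n + 1) → X) → ℝ} (hg : Measurable g) :
    eLpNorm (partialInt Λ g) 1 (Measure.pi fun _ => Λ) ≤ eLpNorm g 1 (Measure.pi fun _ => Λ) := by
  rw [eLpNorm_one_eq_lintegral_enorm, eLpNorm_one_eq_lintegral_enorm,
    ← (measurePreserving_snoc n).lintegral_comp hg.enorm,
    lintegral_prod (fun p : (Fin n → X) × X => ‖g (Fin.snoc p.1 p.2 : Fin (n + 1) → X)‖ₑ)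
      (hg.comp measurable_snoc).enorm.aemeasurable]
  exact lintegral_mono fun ω => enorm_integral_le_lintegral_enorm _

lemma partialInt_sub {n : ℕ} {g h : (Fin (n + 1) → X) → ℝ} (hg : IsSymmKernel Λ (n + 1) g)
    (hh : IsSymmKernel Λ (n + 1) h) :
    partialInt Λ (g - h) =ᵐ[Measure.pi fun _ => Λ] partialInt Λ g - partialInt Λ h := by
  filter_upwards [hg.integrable_snoc.prod_right_ae, hh.integrable_snoc.prod_right_ae] with x h1 h2
  exact integral_sub h1 h2

end Kernel

/-! ### Multiple integrals with respect to the compensated process -/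

section Chaos

variable {X : Type*} [MeasurableSpace X] {Λ : Measure X}

/-- For a family `ν` of measures on the powers of `X`: the integral of `g` in which the first `k`
variables are integrated with respect to `ν k` and the others with respect to `Λ`. It is used for
`k ≤ n` only. -/
noncomputable def mixInt (Λ : Measure X) (ν : (n : ℕ) → Measure (Fin n → X)) :
    (n : ℕ) → ((Fin n → X) → ℝ) → ℕ → ℝ
  | 0, g, _ => ∫ x, g x ∂ν 0
  | n + 1, g, k => if k = n + 1 then ∫ x, g x ∂ν (n + 1) else mixInt Λ ν n (partialInt Λ g) k

variable [SigmaFinite Λ] {Ω : Type*} [MeasurableSpace Ω] {P : Measure Ω} {η : Ω → Measure X}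

/-- The multiple Wiener-Itô integral of a symmetric kernel with respect to the compensated process,
as an alternating sum of integrals with respect to factorial measures. -/
noncomputable def chaos (η : Ω → Measure X) (Λ : Measure X) [SigmaFinite Λ] (n : ℕ)
    (g : (Fin n → X) → ℝ) (ω : Ω) : ℝ :=
  altSum n fun k => mixInt Λ (fun j => factProc η Λ j ω) n g k

variable [IsProbabilityMeasure P] (hη : IsPoissonProcess η Λ P)
include hη

lemma IsPoissonProcess.aestronglyMeasurable_mixInt {n : ℕ} {g : (Fin n → X) → ℝ}
    (hg : IsSymmKernel Λ n g) (k : ℕ) :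
    AEStronglyMeasurable (fun ω => mixInt Λ (fun j => factProc η Λ j ω) n g k) P := by
  have key : ∀ m (g : (Fin m → X) → ℝ), IsSymmKernel Λ m g →
      AEStronglyMeasurable (fun ω => ∫ x, g x ∂factProc η Λ m ω) P := fun m g hg =>
    aestronglyMeasurable_integral_of_bind_eq (hη.measurable_factProc m) (hη.bind_factProc m)
      hg.1 hg.2.2
  induction n with
  | zero => exact key 0 g hg
  | succ n ih =>
    simp only [mixInt]
    split_ifs
    · exact key (n + 1) g hg
    · exact ih hg.partialInt

lemma IsPoissonProcess.eLpNorm_one_mixInt_le {n : ℕ} {g : (Fin n → X) → ℝ}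
    (hg : IsSymmKernel Λ n g) (k : ℕ) :
    eLpNorm (fun ω => mixInt Λ (fun j => factProc η Λ j ω) n g k) 1 P ≤
      eLpNorm g 1 (Measure.pi fun _ => Λ) := by
  have key : ∀ m (g : (Fin m → X) → ℝ), IsSymmKernel Λ m g →
      eLpNorm (fun ω => ∫ x, g x ∂factProc η Λ m ω) 1 P ≤ eLpNorm g 1 (Measure.pi fun _ => Λ) :=
    fun m g hg =>
      eLpNorm_integral_le_of_bind_eq (hη.measurable_factProc m) (hη.bind_factProc m) hg.1
  induction n with
  | zero => exact key 0 g hg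
  | succ n ih =>
    simp only [mixInt]
    split_ifs
    · exact key (n + 1) g hg
    · exact (ih hg.partialInt).trans (eLpNorm_one_partialInt_le hg.1)

lemma IsPoissonProcess.integral_mixInt {n : ℕ} {g : (Fin n → X) → ℝ}
    (hg : IsSymmKernel Λ n g) (k : ℕ) :
    ∫ ω, mixInt Λ (fun j => factProc η Λ j ω) n g k ∂P = ∫ x, g x ∂(Measure.pi fun _ => Λ) := by
  have key : ∀ m (g : (Fin m → X) → ℝ), IsSymmKernel Λ m g →
      ∫ ω, ∫ x, g x ∂factProc η Λ m ω ∂P = ∫ x, g x ∂(Measure.pi fun _ => Λ) := fun m g hg =>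
    integral_integral_of_bind_eq (hη.measurable_factProc m) (hη.bind_factProc m) hg.1 hg.2.2
  induction n with
  | zero => exact key 0 g hg
  | succ n ih =>
    simp only [mixInt]
    split_ifs
    · exact key (n + 1) g hg
    · exact (ih hg.partialInt).trans (integral_partialInt hg)

lemma IsPoissonProcess.ae_mixInt_congr {n : ℕ} {g h : (Fin n → X) → ℝ}
    (hg : IsSymmKernel Λ n g) (hh : IsSymmKernel Λ n h)
    (hgh : g =ᵐ[Measure.pi fun _ => Λ] h) (k : ℕ) :
    ∀ᵐ ω ∂P, mixInt Λ (fun j => factProc η Λ j ω) n g k =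
      mixInt Λ (fun j => factProc η Λ j ω) n h k := by
  have key : ∀ m (g h : (Fin m → X) → ℝ), IsSymmKernel Λ m g → IsSymmKernel Λ m h →
      g =ᵐ[Measure.pi fun _ => Λ] h →
      ∀ᵐ ω ∂P, ∫ x, g x ∂factProc η Λ m ω = ∫ x, h x ∂factProc η Λ m ω := by
    intro m g h hg hh hgh
    -- a null set of the mean measure is almost surely a null set of the random measure
    have h0 : Measure.pi (fun _ => Λ) {x | ¬ g x = h x} = 0 := hgh
    have hms : MeasurableSet {x | ¬ g x = h x} := (measurableSet_eq_fun hg.1 hh.1).compl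
    have hm : Measurable fun ω => factProc η Λ m ω {x | ¬ g x = h x} :=
      (Measure.measurable_coe hms).comp (hη.measurable_factProc m)
    rw [← hη.bind_factProc m, Measure.bind_apply hms (hη.measurable_factProc m).aemeasurable,
      lintegral_eq_zero_iff hm] at h0
    filter_upwards [h0] with ω hω
    exact integral_congr_ae hω
  induction n with
  | zero => exact key 0 g h hg hh hgh
  | succ n ih =>
    simp only [mixInt]
    split_ifs
    · exact key (n + 1) g h hg hh hgh
    · refine ih hg.partialInt hh.partialInt ?_
      have h1 : (fun p : (Fin n → X) × X => g (Fin.snoc p.1 p.2 : Fin (n + 1) → X))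
          =ᵐ[(Measure.pi fun _ => Λ).prod Λ]
          fun p : (Fin n → X) × X => h (Fin.snoc p.1 p.2 : Fin (n + 1) → X) :=
        (measurePreserving_snoc n).quasiMeasurePreserving.ae_eq_comp hgh
      filter_upwards [Measure.ae_ae_of_ae_prod h1] with x hx
      exact integral_congr_ae hx

lemma IsPoissonProcess.ae_mixInt_sub {n : ℕ} {g h : (Fin n → X) → ℝ}
    (hg : IsSymmKernel Λ n g) (hh : IsSymmKernel Λ n h) (k : ℕ) :
    ∀ᵐ ω ∂P, mixInt Λ (fun j => factProc η Λ j ω) n (g - h) k =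
      mixInt Λ (fun j => factProc η Λ j ω) n g k - mixInt Λ (fun j => factProc η Λ j ω) n h k := by
  have key : ∀ m (g h : (Fin m → X) → ℝ), IsSymmKernel Λ m g → IsSymmKernel Λ m h →
      ∀ᵐ ω ∂P, ∫ x, (g - h) x ∂factProc η Λ m ω =
        ∫ x, g x ∂factProc η Λ m ω - ∫ x, h x ∂factProc η Λ m ω := by
    intro m g h hg hh
    filter_upwards [ae_integrable_of_bind_eq (hη.measurable_factProc m) (hη.bind_factProc m)
        hg.1 hg.2.2, ae_integrable_of_bind_eq (hη.measurable_factProc m) (hη.bind_factProc m)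
        hh.1 hh.2.2] with ω h1 h2
    exact integral_sub h1 h2
  induction n with
  | zero => exact key 0 g h hg hh
  | succ n ih =>
    simp only [mixInt]
    split_ifs
    · exact key (n + 1) g h hg hh
    · filter_upwards [ih hg.partialInt hh.partialInt,
        hη.ae_mixInt_congr (hg.sub hh).partialInt (hg.partialInt.sub hh.partialInt)
          (partialInt_sub hg hh) k] with ω h1 h2
      rw [h2, h1]

lemma IsPoissonProcess.aestronglyMeasurable_chaos {n : ℕ} {g : (Fin n → X) → ℝ}
    (hg : IsSymmKernel Λ n g) : AEStronglyMeasurable (chaos η Λ n g) P := by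
  unfold chaos altSum
  exact Finset.aestronglyMeasurable_fun_sum _ fun k _ =>
    (hη.aestronglyMeasurable_mixInt hg k).const_mul _

lemma IsPoissonProcess.integrable_mixInt {n : ℕ} {g : (Fin n → X) → ℝ}
    (hg : IsSymmKernel Λ n g) (k : ℕ) :
    Integrable (fun ω => mixInt Λ (fun j => factProc η Λ j ω) n g k) P :=
  memLp_one_iff_integrable.1 ⟨hη.aestronglyMeasurable_mixInt hg k,
    (hη.eLpNorm_one_mixInt_le hg k).trans_lt (memLp_one_iff_integrable.2 hg.2.2).2⟩

lemma IsPoissonProcess.eLpNorm_one_chaos_le {n : ℕ} {g : (Fin n → X) → ℝ}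
    (hg : IsSymmKernel Λ n g) :
    eLpNorm (chaos η Λ n g) 1 P ≤ (∑ k ∈ Finset.range (n + 1), ‖(-1 : ℝ) ^ (n + k) * n.choose k‖ₑ) *
      eLpNorm g 1 (Measure.pi fun _ => Λ) := by
  have h1 : chaos η Λ n g = ∑ k ∈ Finset.range (n + 1), ((-1 : ℝ) ^ (n + k) * n.choose k) •
      fun ω => mixInt Λ (fun j => factProc η Λ j ω) n g k := by
    funext ω
    simp [chaos, altSum]
  rw [h1, Finset.sum_mul]
  refine (eLpNorm_sum_le (fun k _ => (hη.aestronglyMeasurable_mixInt hg k).const_smul _)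
    le_rfl).trans (Finset.sum_le_sum fun k _ => ?_)
  rw [eLpNorm_const_smul]
  gcongr
  exact hη.eLpNorm_one_mixInt_le hg k

/-- All mixed integrals have the same mean, and the alternating binomial sum of a constant vanishes.
-/
lemma IsPoissonProcess.integral_chaos {n : ℕ} (hn : n ≠ 0) {g : (Fin n → X) → ℝ}
    (hg : IsSymmKernel Λ n g) : ∫ ω, chaos η Λ n g ω ∂P = 0 := by
  unfold chaos altSum
  rw [integral_finsetSum _ fun k _ => (hη.integrable_mixInt hg k).const_mul _]
  simp_rw [integral_const_mul, hη.integral_mixInt hg]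
  rw [← Finset.sum_mul]
  have h := Int.alternating_sum_range_choose_of_ne hn
  have h' : ∑ k ∈ Finset.range (n + 1), (-1 : ℝ) ^ k * n.choose k = 0 := by exact_mod_cast h
  simp_rw [pow_add, mul_assoc]
  rw [← Finset.mul_sum, h']
  simp

lemma IsPoissonProcess.ae_chaos_sub {n : ℕ} {g h : (Fin n → X) → ℝ}
    (hg : IsSymmKernel Λ n g) (hh : IsSymmKernel Λ n h) :
    chaos η Λ n (g - h) =ᵐ[P] chaos η Λ n g - chaos η Λ n h := by
  filter_upwards [ae_all_iff.2 fun k => hη.ae_mixInt_sub hg hh k] with ω hω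
  simp only [chaos, altSum, Pi.sub_apply]
  rw [← Finset.sum_sub_distrib]
  exact Finset.sum_congr rfl fun k _ => by rw [hω k]; ring

end Chaos

/-! ### Step functions on products of finitely many cells -/

section Grid

variable {X : Type*} {r : ℕ} {C : Fin r → Set X}

/-- The step function with the value `a i` on the product of the sets `C (i j)`. -/
noncomputable def gridFun {n : ℕ} (C : Fin r → Set X) (a : (Fin n → Fin r) → ℝ) (x : Fin n → X) :
    ℝ :=
  ∑ i, a i * (cell C i).indicator (fun _ => 1) x

lemma isSymmetric_gridFun {n : ℕ} {a : (Fin n → Fin r) → ℝ} (ha : IsSymmetric a) :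
    IsSymmetric (gridFun C a) := by
  classical
  intro s x
  simp only [gridFun]
  rw [← (Equiv.arrowCongr s.symm (Equiv.refl (Fin r))).sum_comp]
  refine Finset.sum_congr rfl fun i _ => ?_
  have h1 : Equiv.arrowCongr s.symm (Equiv.refl (Fin r)) i = i ∘ s := rfl
  rw [h1, ha s i]
  congr 1
  have h2 : x ∘ s ∈ cell C (i ∘ s) ↔ x ∈ cell C i := by
    simp only [mem_cell, Function.comp_apply]
    exact ⟨fun h j => by simpa using h (s.symm j), fun h j => h (s j)⟩
  by_cases h : x ∈ cell C i
  · rw [indicator_of_mem h, indicator_of_mem (h2.2 h)]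
  · rw [indicator_of_notMem h, indicator_of_notMem (mt h2.1 h)]

/-- As the cells are disjoint, at most one term of the sum that defines a step function is not zero.
-/
lemma gridFun_sq {n : ℕ} (hdisj : Pairwise (fun c d => Disjoint (C c) (C d)))
    (a : (Fin n → Fin r) → ℝ) (x : Fin n → X) :
    gridFun C a x ^ 2 = gridFun C (fun i => a i ^ 2) x := by
  classical
  have huniq : ∀ i i' : Fin n → Fin r, x ∈ cell C i → x ∈ cell C i' → i = i' := by
    intro i i' h h'
    funext j
    by_contra hne
    exact (hdisj hne).notMem_of_mem_left (mem_cell.1 h j) (mem_cell.1 h' j)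
  by_cases hx : ∃ i, x ∈ cell C i
  · obtain ⟨i, hi⟩ := hx
    have key : ∀ b : (Fin n → Fin r) → ℝ, gridFun C b x = b i := by
      intro b
      simp only [gridFun]
      rw [Finset.sum_eq_single i]
      · simp [hi]
      · intro i' _ hne
        rw [indicator_of_notMem fun h => hne (huniq _ _ h hi), mul_zero]
      · simp
    rw [key, key]
  · have key : ∀ b : (Fin n → Fin r) → ℝ, gridFun C b x = 0 := by
      intro b
      refine Finset.sum_eq_zero fun i _ => ?_
      rw [indicator_of_notMem fun h => hx ⟨i, h⟩, mul_zero]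
    rw [key, key]
    simp

lemma gridFun_snoc {n : ℕ} (a : (Fin (n + 1) → Fin r) → ℝ) (x : Fin n → X) (y : X) :
    gridFun C a (Fin.snoc x y : Fin (n + 1) → X) =
      ∑ c, (C c).indicator (fun _ => (1 : ℝ)) y *
        gridFun C (fun i => a (Fin.snoc i c : Fin (n + 1) → Fin r)) x := by
  classical
  simp only [gridFun]
  rw [← (Fin.snocEquiv fun _ : Fin (n + 1) => Fin r).sum_comp, Fintype.sum_prod_type]
  refine Finset.sum_congr rfl fun c _ => ?_
  rw [Finset.mul_sum]
  refine Finset.sum_congr rfl fun i _ => ?_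
  change a (Fin.snoc i c : Fin (n + 1) → Fin r) *
    (cell C (Fin.snoc i c : Fin (n + 1) → Fin r)).indicator (fun _ => (1 : ℝ)) (Fin.snoc x y) = _
  by_cases h1 : x ∈ cell C i <;> by_cases h2 : y ∈ C c
  · rw [indicator_of_mem (snoc_mem_cell.2 ⟨h1, h2⟩), indicator_of_mem h1, indicator_of_mem h2]
    ring
  · rw [indicator_of_notMem fun h => h2 (snoc_mem_cell.1 h).2, indicator_of_notMem h2]
    ring
  · rw [indicator_of_notMem fun h => h1 (snoc_mem_cell.1 h).1, indicator_of_notMem h1]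
    ring
  · rw [indicator_of_notMem fun h => h1 (snoc_mem_cell.1 h).1, indicator_of_notMem h1]
    ring

variable [MeasurableSpace X] {Λ : Measure X}

lemma measurable_gridFun {n : ℕ} (hC : ∀ c, MeasurableSet (C c)) (a : (Fin n → Fin r) → ℝ) :
    Measurable (gridFun C a) :=
  Finset.measurable_fun_sum _ fun i _ =>
    (measurable_const.indicator (measurableSet_cell hC i)).const_mul _

lemma integral_gridFun {n : ℕ} (hC : ∀ c, MeasurableSet (C c)) {ν : Measure (Fin n → X)}
    (hν : ∀ i : Fin n → Fin r, ν (cell C i) < ∞) (a : (Fin n → Fin r) → ℝ) :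
    Integrable (gridFun C a) ν ∧ ∫ x, gridFun C a x ∂ν = ∑ i, a i * ν.real (cell C i) := by
  have hi : ∀ i : Fin n → Fin r,
      Integrable (fun x => a i * (cell C i).indicator (fun _ => (1 : ℝ)) x) ν := fun i =>
    ((integrable_indicator_iff (measurableSet_cell hC i)).2
      (integrableOn_const (hν i).ne)).const_mul _
  refine ⟨integrable_finsetSum _ fun i _ => hi i, ?_⟩
  simp only [gridFun]
  rw [integral_finsetSum _ fun i _ => hi i]
  refine Finset.sum_congr rfl fun i _ => ?_
  rw [integral_const_mul, integral_indicator (measurableSet_cell hC i)]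
  simp

lemma partialInt_gridFun {n : ℕ} (hC : ∀ c, MeasurableSet (C c)) (hfin : ∀ c, Λ (C c) < ∞)
    (a : (Fin (n + 1) → Fin r) → ℝ) :
    partialInt Λ (gridFun C a) = gridFun C fun i =>
      ∑ c, ((Λ (C c)).toNNReal : ℝ) * a (Fin.snoc i c : Fin (n + 1) → Fin r) := by
  funext x
  simp only [partialInt, gridFun_snoc]
  have hi : ∀ c, Integrable (fun y => (C c).indicator (fun _ => (1 : ℝ)) y *
      gridFun C (fun i => a (Fin.snoc i c : Fin (n + 1) → Fin r)) x) Λ := fun c =>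
    ((integrable_indicator_iff (hC c)).2 (integrableOn_const (hfin c).ne)).mul_const _
  rw [integral_finsetSum _ fun c _ => hi c]
  simp only [integral_mul_const]
  have h1 : ∀ c, ∫ y, (C c).indicator (fun _ => (1 : ℝ)) y ∂Λ = ((Λ (C c)).toNNReal : ℝ) := by
    intro c
    rw [integral_indicator (hC c)]
    simp [Measure.real, ENNReal.coe_toNNReal_eq_toReal]
  simp only [h1, gridFun, Finset.mul_sum, Finset.sum_mul]
  rw [Finset.sum_comm]
  exact Finset.sum_congr rfl fun i _ => Finset.sum_congr rfl fun c _ => by ring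

/-- For step functions, the mixed integrals are the discrete ones, as functions of the numbers of
points in the cells. -/
lemma mixInt_gridFun (hC : ∀ c, MeasurableSet (C c)) (hfin : ∀ c, Λ (C c) < ∞)
    {ν : (n : ℕ) → Measure (Fin n → X)} {N : Fin r → ℕ}
    (hν : ∀ n (i : Fin n → Fin r), ν n (cell C i) = (fallProd N i : ℕ)) {n : ℕ}
    (a : (Fin n → Fin r) → ℝ) (k : ℕ) :
    mixInt Λ ν n (gridFun C a) k = cellMix (fun c => (Λ (C c)).toNNReal) n a k N := by
  have key : ∀ m (a : (Fin m → Fin r) → ℝ),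
      ∫ x, gridFun C a x ∂ν m = ∑ i, a i * fallProd N i := by
    intro m a
    rw [(integral_gridFun hC (fun i => (hν m i).symm ▸ ENNReal.natCast_lt_top _) a).2]
    simp [Measure.real, hν]
  induction n with
  | zero => exact key 0 a
  | succ n ih =>
    simp only [mixInt, cellMix]
    split_ifs
    · exact key (n + 1) a
    · rw [partialInt_gridFun hC hfin, ih]

variable [SigmaFinite Λ]

lemma isSymmKernel_gridFun {n : ℕ} (hC : ∀ c, MeasurableSet (C c)) (hfin : ∀ c, Λ (C c) < ∞)
    {a : (Fin n → Fin r) → ℝ} (ha : IsSymmetric a) : IsSymmKernel Λ n (gridFun C a) := by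
  refine ⟨measurable_gridFun hC a, isSymmetric_gridFun ha, (integral_gridFun hC (fun i => ?_) a).1⟩
  rw [cell, Measure.pi_pi]
  exact ENNReal.prod_lt_top fun j _ => hfin _

lemma eLpNorm_two_sq {Y : Type*} [MeasurableSpace Y] {μ : Measure Y} {f : Y → ℝ}
    (hi : Integrable (fun y => f y ^ 2) μ) :
    eLpNorm f 2 μ ^ 2 = ENNReal.ofReal (∫ y, f y ^ 2 ∂μ) := by
  have h := eLpNorm_nnreal_pow_eq_lintegral (μ := μ) (f := f) (p := 2) (by norm_num)
  rw [NNReal.coe_ofNat, ENNReal.rpow_ofNat] at h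
  simp only [ENNReal.rpow_ofNat] at h
  rw [ofReal_integral_eq_lintegral_ofReal hi (ae_of_all _ fun y => sq_nonneg _)]
  refine h.trans (lintegral_congr fun y => ?_)
  rw [← ofReal_norm, ← ENNReal.ofReal_pow (norm_nonneg _), Real.norm_eq_abs, sq_abs]

/-- The isometry property of the multiple integrals of step functions. -/
lemma IsPoissonProcess.eLpNorm_two_chaos_gridFun {Ω : Type*} [MeasurableSpace Ω] {P : Measure Ω}
    {η : Ω → Measure X} [IsProbabilityMeasure P] (hη : IsPoissonProcess η Λ P) {n : ℕ}
    (hC : ∀ c, MeasurableSet (C c)) (hdisj : Pairwise (fun c d => Disjoint (C c) (C d)))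
    (hfin : ∀ c, Λ (C c) < ∞) {a : (Fin n → Fin r) → ℝ} (ha : IsSymmetric a) :
    eLpNorm (chaos η Λ n (gridFun C a)) 2 P ^ 2 =
      n.factorial * eLpNorm (gridFun C a) 2 (Measure.pi fun _ => Λ) ^ 2 := by
  set ρ : Fin r → ℝ≥0 := fun c => (Λ (C c)).toNNReal with hρ
  have h1 : chaos η Λ n (gridFun C a) =ᵐ[P] fun ω => cellInt ρ n a (counts η C ω) := by
    filter_upwards [hη.ae_eq_counts hC hfin, ae_all_iff.2 hη.ae_factProc_eq] with ω h2 h3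
    refine altSum_congr fun k _ => mixInt_gridFun hC hfin (fun m i => ?_) a k
    rw [h3]
    exact hasCellValues_factorialMeasure (hη.isPointMeasure ω) m r C _ hC hdisj h2 i
  have hcells : ∀ i : Fin n → Fin r, Measure.pi (fun _ => Λ) (cell C i) < ∞ := fun i => by
    rw [cell, Measure.pi_pi]
    exact ENNReal.prod_lt_top fun j _ => hfin _
  have hint : Integrable (fun N => cellInt ρ n a N ^ 2) (poissonPi ρ) := by
    have := ((expBounded_cellInt ρ n a).mul (expBounded_cellInt ρ n a)).integrable ρ
    simpa only [sq] using this
  have hmap := hη.map_counts hC hdisj hfin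
  have hm := hη.measurable_counts (C := C) hC
  have hint' : Integrable (fun ω => cellInt ρ n a (counts η C ω) ^ 2) P := by
    rw [← hρ] at hmap
    rw [← hmap] at hint
    exact hint.comp_measurable hm
  have e1 : ∫ ω, cellInt ρ n a (counts η C ω) ^ 2 ∂P = ∫ N, cellInt ρ n a N ^ 2 ∂poissonPi ρ := by
    rw [← hmap, integral_map hm.aemeasurable (measurable_of_countable _).aestronglyMeasurable]
  have hsq : (fun x => gridFun C a x ^ 2) = gridFun C fun i => a i ^ 2 :=
    funext fun x => gridFun_sq hdisj a x
  rw [eLpNorm_congr_ae h1, eLpNorm_two_sq hint', e1, integral_cellInt_sq ρ n ha,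
    eLpNorm_two_sq (hsq ▸ (integral_gridFun hC hcells _).1), hsq, (integral_gridFun hC hcells _).2,
    ENNReal.ofReal_mul (by positivity), ENNReal.ofReal_natCast]
  have hsum : ∑ i, a i ^ 2 * ∏ j, (ρ (i j) : ℝ) =
      ∑ i, a i ^ 2 * (Measure.pi fun _ => Λ).real (cell C i) := by
    refine Finset.sum_congr rfl fun i _ => ?_
    rw [Measure.real, cell, Measure.pi_pi, ENNReal.toReal_prod]
    rfl
  rw [hsum]

end Grid

/-! ### Density of the step functions -/

section Density

lemma tendsto_eLpNorm_indicator_compl {Y : Type*} [MeasurableSpace Y] {μ : Measure Y}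
    {S : ℕ → Set Y} (hS : ∀ k, MeasurableSet (S k)) (hmono : Monotone S) (huniv : ⋃ k, S k = univ)
    {p : ℝ≥0∞} (hp0 : p ≠ 0) (hp : p ≠ ∞) {g : Y → ℝ} (hg : Measurable g) (hgp : MemLp g p μ) :
    Tendsto (fun k => eLpNorm ((S k)ᶜ.indicator g) p μ) atTop (𝓝 0) := by
  have hp' : 0 < p.toReal := ENNReal.toReal_pos hp0 hp
  have h1 : Tendsto (fun k => ∫⁻ y, ‖(S k)ᶜ.indicator g y‖ₑ ^ p.toReal ∂μ) atTop
      (𝓝 (∫⁻ _, 0 ∂μ)) := by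
    refine tendsto_lintegral_of_dominated_convergence (fun y => ‖g y‖ₑ ^ p.toReal)
      (fun k => (hg.indicator (hS k).compl).enorm.pow_const _) (fun k => ae_of_all _ fun y => ?_)
      (lintegral_rpow_enorm_lt_top_of_eLpNorm_lt_top hp0 hp hgp.2).ne (ae_of_all _ fun y => ?_)
    · refine ENNReal.rpow_le_rpow ?_ hp'.le
      exact enorm_indicator_le_enorm_self _ _
    · obtain ⟨k, hk⟩ := mem_iUnion.1 (huniv ▸ mem_univ y)
      refine tendsto_const_nhds.congr' ?_
      filter_upwards [eventually_ge_atTop k] with l hl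
      rw [indicator_of_notMem (notMem_compl_iff.2 (hmono hl hk)), enorm_zero,
        ENNReal.zero_rpow_of_pos hp']
  rw [lintegral_zero] at h1
  have h2 := (ENNReal.continuous_rpow_const (y := 1 / p.toReal)).tendsto 0 |>.comp h1
  rw [ENNReal.zero_rpow_of_pos (by positivity)] at h2
  refine h2.congr fun k => ?_
  rw [eLpNorm_eq_lintegral_rpow_enorm_toReal hp0 hp]
  rfl

variable {X : Type*} [MeasurableSpace X]

/-- For a finite measure on `X^n`, the functions that depend only on the cells of the arguments in a
finite partition are dense. -/
lemma exists_eLpNorm_sub_comp_le {n : ℕ} (κ : Measure (Fin n → X)) [IsFiniteMeasure κ] {p : ℝ≥0∞}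
    (hp : p ≠ ∞) {g : (Fin n → X) → ℝ} (hg : MemLp g p κ) {ε : ℝ≥0∞} (hε : ε ≠ 0) :
    ∃ (r : ℕ) (φ : X → Fin r) (a : (Fin n → Fin r) → ℝ), Measurable φ ∧
      eLpNorm (g - fun x => a fun j => φ (x j)) p κ ≤ ε := by
  have hφn : ∀ {r : ℕ} {φ : X → Fin r}, Measurable φ →
      Measurable (fun (x : Fin n → X) j => φ (x j)) := fun hφ =>
    measurable_pi_lambda _ fun j => hφ.comp (measurable_pi_apply j)
  suffices H : ∃ f : (Fin n → X) → ℝ, eLpNorm (g - f) p κ ≤ ε ∧ ∃ (r : ℕ) (φ : X → Fin r)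
      (a : (Fin n → Fin r) → ℝ), Measurable φ ∧ f = fun x => a fun j => φ (x j) by
    obtain ⟨f, hf, r, φ, a, hφ, rfl⟩ := H
    exact ⟨r, φ, a, hφ, hf⟩
  refine hg.induction_dense hp _ ?_ ?_ ?_ hε
  · intro c s hs _ ε hε
    obtain ⟨δ, hδ, hsmall⟩ := exists_eLpNorm_indicator_le (μ := κ) hp c hε
    obtain ⟨T, ⟨r, φ, hφ, T, rfl⟩, hT⟩ := (measureDense_isGridSet κ).approx s hs
      (measure_ne_top _ _) δ hδ
    rw [ENNReal.ofReal_coe_nnreal] at hT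
    refine ⟨_, ?_, r, φ, T.indicator fun _ => c, hφ, rfl⟩
    refine le_trans (le_of_eq ?_) (hsmall _ hT.le)
    refine eLpNorm_congr_norm_ae (ae_of_all _ fun x => ?_)
    by_cases h1 : x ∈ s <;> by_cases h2 : (fun j => φ (x j)) ∈ T <;>
      simp [h1, h2, indicator, symmDiff_def]
  · rintro _ _ ⟨r, φ, a, hφ, rfl⟩ ⟨r', φ', a', hφ', rfl⟩
    obtain ⟨q, ψ, π, π', hψ, hπ, hπ'⟩ := exists_common_refinement hφ hφ'
    refine ⟨q, ψ, fun i => a (fun j => π (i j)) + a' (fun j => π' (i j)), hψ, ?_⟩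
    funext x
    simp [hπ, hπ']
  · rintro _ ⟨r, φ, a, hφ, rfl⟩
    exact ((measurable_of_countable a).comp (hφn hφ)).aestronglyMeasurable

/-- The average of a function of a tuple over the permutations of its arguments. -/
noncomputable def symmetrize {Y : Type*} {n : ℕ} (a : (Fin n → Y) → ℝ) (x : Fin n → Y) : ℝ :=
  (n.factorial : ℝ)⁻¹ * ∑ s : Equiv.Perm (Fin n), a (x ∘ s)

lemma isSymmetric_symmetrize {Y : Type*} {n : ℕ} (a : (Fin n → Y) → ℝ) :
    IsSymmetric (symmetrize a) := by
  intro s x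
  simp only [symmetrize]
  congr 1
  exact Equiv.sum_comp (Equiv.mulLeft s) fun s' : Equiv.Perm (Fin n) => a (x ∘ s')

lemma gridFun_symmetrize {Y : Type*} {r n : ℕ} (C : Fin r → Set Y) (a : (Fin n → Fin r) → ℝ)
    (x : Fin n → Y) : gridFun C (symmetrize a) x = symmetrize (gridFun C a) x := by
  classical
  have key : ∀ s : Equiv.Perm (Fin n), gridFun C a (x ∘ s) = gridFun C (fun i => a (i ∘ s)) x := by
    intro s
    simp only [gridFun]
    rw [← (Equiv.arrowCongr s.symm (Equiv.refl (Fin r))).sum_comp]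
    refine Finset.sum_congr rfl fun i _ => ?_
    have h1 : Equiv.arrowCongr s.symm (Equiv.refl (Fin r)) i = i ∘ s := rfl
    rw [h1]
    congr 1
    have h2 : x ∘ s ∈ cell C (i ∘ s) ↔ x ∈ cell C i := by
      simp only [mem_cell, Function.comp_apply]
      exact ⟨fun h j => by simpa using h (s.symm j), fun h j => h (s j)⟩
    by_cases h : x ∈ cell C i
    · rw [indicator_of_mem h, indicator_of_mem (h2.2 h)]
    · rw [indicator_of_notMem h, indicator_of_notMem (mt h2.1 h)]
  simp only [symmetrize, key]
  simp only [gridFun, symmetrize, Finset.mul_sum, Finset.sum_mul]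
  rw [Finset.sum_comm]
  exact Finset.sum_congr rfl fun i _ => Finset.sum_congr rfl fun s _ => by ring

variable {Λ : Measure X} [SigmaFinite Λ]

/-- Symmetrization does not increase the distance to a symmetric function, by the triangle
inequality and the permutation invariance of product measures. -/
lemma eLpNorm_sub_symmetrize_le {n : ℕ} {g h : (Fin n → X) → ℝ} (hgs : IsSymmetric g)
    (hg : Measurable g) (hh : Measurable h) {p : ℝ≥0∞} (hp : 1 ≤ p) :
    eLpNorm (g - symmetrize h) p (Measure.pi fun _ => Λ) ≤
      eLpNorm (g - h) p (Measure.pi fun _ => Λ) := by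
  have hfac : (n.factorial : ℝ) ≠ 0 := Nat.cast_ne_zero.2 n.factorial_ne_zero
  have h1 : g - symmetrize h = (n.factorial : ℝ)⁻¹ •
      ∑ s : Equiv.Perm (Fin n), (g - h) ∘ fun x : Fin n → X => x ∘ s := by
    funext x
    simp only [Pi.sub_apply, symmetrize, Pi.smul_apply, Finset.sum_apply, Function.comp_apply,
      hgs _ x, smul_eq_mul]
    simp [Finset.sum_sub_distrib, Fintype.card_perm, mul_sub, inv_mul_cancel_left₀ hfac]
  have hm : AEStronglyMeasurable (g - h) (Measure.pi fun _ => Λ) := (hg.sub hh).aestronglyMeasurable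
  have h2 : ∀ s : Equiv.Perm (Fin n), eLpNorm ((g - h) ∘ fun x : Fin n → X => x ∘ s) p
      (Measure.pi fun _ => Λ) = eLpNorm (g - h) p (Measure.pi fun _ => Λ) := fun s =>
    eLpNorm_comp_measurePreserving hm (measurePreserving_comp_perm s)
  rw [h1, eLpNorm_const_smul]
  calc _ ≤ ‖(n.factorial : ℝ)⁻¹‖ₑ * ∑ s : Equiv.Perm (Fin n),
        eLpNorm ((g - h) ∘ fun x : Fin n → X => x ∘ s) p (Measure.pi fun _ => Λ) := by
        gcongr
        exact eLpNorm_sum_le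
          (fun s _ => hm.comp_measurePreserving (measurePreserving_comp_perm s)) hp
    _ = ‖(n.factorial : ℝ)⁻¹‖ₑ * ‖(n.factorial : ℝ)‖ₑ *
          eLpNorm (g - h) p (Measure.pi fun _ => Λ) := by
        simp only [h2]
        simp [Fintype.card_perm, mul_assoc]
    _ = _ := by
        rw [← enorm_mul, inv_mul_cancel₀ hfac]
        simp

/-- Symmetric kernels in `L²` are limits of symmetric step functions, in `L¹` and in `L²` at the
same time. -/
lemma IsSymmKernel.exists_gridFun {n : ℕ} {g : (Fin n → X) → ℝ} (hg : IsSymmKernel Λ n g)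
    (hg2 : MemLp g 2 (Measure.pi fun _ => Λ)) {ε : ℝ≥0∞} (hε : ε ≠ 0) :
    ∃ (r : ℕ) (C : Fin r → Set X) (a : (Fin n → Fin r) → ℝ), (∀ c, MeasurableSet (C c)) ∧
      Pairwise (fun c d => Disjoint (C c) (C d)) ∧ (∀ c, Λ (C c) < ∞) ∧ IsSymmetric a ∧
      eLpNorm (g - gridFun C a) 1 (Measure.pi fun _ => Λ) ≤ ε ∧
      eLpNorm (g - gridFun C a) 2 (Measure.pi fun _ => Λ) ≤ ε := by
  set S : ℕ → Set (Fin n → X) := fun k => univ.pi fun _ => spanningSets Λ k with hSdef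
  have hS : ∀ k, MeasurableSet (S k) := fun k =>
    MeasurableSet.univ_pi fun _ => measurableSet_spanningSets Λ k
  have hmono : Monotone S := fun k l hkl => pi_mono fun _ _ => monotone_spanningSets Λ hkl
  have huniv : ⋃ k, S k = univ := by
    rw [hSdef, iUnion_univ_pi_of_monotone fun _ => monotone_spanningSets Λ]
    simp [iUnion_spanningSets]
  have hε2 : ε / 2 ≠ 0 := by simp [hε]
  have hev : ∀ p : ℝ≥0∞, p ≠ 0 → p ≠ ∞ → MemLp g p (Measure.pi fun _ => Λ) →
      ∀ᶠ k in atTop, eLpNorm ((S k)ᶜ.indicator g) p (Measure.pi fun _ => Λ) ≤ ε / 2 := by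
    intro p hp0 hp hgp
    exact (tendsto_eLpNorm_indicator_compl hS hmono huniv hp0 hp hg.1 hgp).eventually_le_const
      (pos_iff_ne_zero.2 hε2)
  -- outside `S k` the kernel is replaced by zero
  obtain ⟨k, hk1, hk2⟩ := ((hev 1 one_ne_zero ENNReal.one_ne_top
    (memLp_one_iff_integrable.2 hg.2.2)).and (hev 2 two_ne_zero ENNReal.ofNat_ne_top hg2)).exists
  set D := spanningSets Λ k
  have hD : MeasurableSet D := measurableSet_spanningSets Λ k
  have hDk : Λ D < ∞ := measure_spanningSets_lt_top Λ k
  set κ := (Measure.pi fun _ => Λ).restrict (S k) with hκ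
  have : IsFiniteMeasure κ := by
    refine isFiniteMeasure_restrict.2 ?_
    rw [hSdef, Measure.pi_pi]
    exact (ENNReal.prod_lt_top fun _ _ => hDk).ne
  -- `K` is the constant in the comparison of the `L¹` norm with the `L²` norm on `S k`; an error
  -- `δ` in `L²` is at most `ε / 2` in both norms
  set K : ℝ≥0∞ := κ univ ^ (1 / (1 : ℝ≥0∞).toReal - 1 / (2 : ℝ≥0∞).toReal) with hK
  have hKtop : K ≠ ∞ := ENNReal.rpow_ne_top_of_nonneg (by norm_num) (measure_ne_top _ _)
  set δ := ε / 2 / (1 + K) with hδ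
  have hδ0 : δ ≠ 0 := ENNReal.div_ne_zero.2 ⟨hε2, by simp [hKtop]⟩
  have hδ1 : δ ≤ ε / 2 := ENNReal.div_le_of_le_mul (le_mul_of_one_le_right' le_self_add)
  have hδK : δ * K ≤ ε / 2 := by
    calc δ * K ≤ δ * (1 + K) := by gcongr; exact le_add_self
      _ = ε / 2 := ENNReal.div_mul_cancel (by simp) (by simp [hKtop])
  obtain ⟨r, φ, a, hφ, ha⟩ := exists_eLpNorm_sub_comp_le κ (p := 2) ENNReal.ofNat_ne_top
    (hg2.restrict _) hδ0
  set C : Fin r → Set X := fun c => φ ⁻¹' {c} ∩ D with hCdef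
  have hC : ∀ c, MeasurableSet (C c) := fun c => (hφ (measurableSet_singleton c)).inter hD
  have hφn : Measurable (fun (x : Fin n → X) j => φ (x j)) :=
    measurable_pi_lambda _ fun j => hφ.comp (measurable_pi_apply j)
  have hh : Measurable (fun x : Fin n → X => a fun j => φ (x j)) :=
    (measurable_of_countable a).comp hφn
  have hgrid : gridFun C a = (S k).indicator fun x => a fun j => φ (x j) := by
    classical
    funext x
    simp only [gridFun]
    by_cases hx : x ∈ S k
    · have hx' : ∀ j, x j ∈ D := fun j => hx j (mem_univ j)
      rw [indicator_of_mem hx, Finset.sum_eq_single fun j => φ (x j)]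
      · rw [indicator_of_mem (mem_cell.2 fun j => (⟨rfl, hx' j⟩ : x j ∈ φ ⁻¹' {φ (x j)} ∩ D)),
          mul_one]
      · intro i _ hne
        rw [indicator_of_notMem, mul_zero]
        exact fun h => hne (funext fun j => ((mem_cell.1 h j).1 : φ (x j) = i j).symm)
      · simp
    · rw [indicator_of_notMem hx]
      refine Finset.sum_eq_zero fun i _ => ?_
      rw [indicator_of_notMem, mul_zero]
      exact fun h => hx fun j _ => (mem_cell.1 h j).2
  have hsplit : g - gridFun C a = (S k)ᶜ.indicator g +
      (S k).indicator (g - fun x => a fun j => φ (x j)) := by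
    rw [hgrid]
    funext x
    by_cases hx : x ∈ S k <;> simp [hx]
  have hm1 : AEStronglyMeasurable ((S k)ᶜ.indicator g) (Measure.pi fun _ => Λ) :=
    (hg.1.indicator (hS k).compl).aestronglyMeasurable
  have hm2 : AEStronglyMeasurable ((S k).indicator (g - fun x => a fun j => φ (x j)))
      (Measure.pi fun _ => Λ) := ((hg.1.sub hh).indicator (hS k)).aestronglyMeasurable
  have hfinal : ∀ p : ℝ≥0∞, 1 ≤ p →
      eLpNorm ((S k)ᶜ.indicator g) p (Measure.pi fun _ => Λ) ≤ ε / 2 →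
      eLpNorm (g - fun x => a fun j => φ (x j)) p κ ≤ ε / 2 →
      eLpNorm (g - gridFun C (symmetrize a)) p (Measure.pi fun _ => Λ) ≤ ε := by
    intro p hp h1 h2
    have : gridFun C (symmetrize a) = symmetrize (gridFun C a) :=
      funext fun x => gridFun_symmetrize C a x
    rw [this]
    refine (eLpNorm_sub_symmetrize_le hg.2.1 hg.1 (measurable_gridFun hC a) hp).trans ?_
    rw [hsplit]
    refine (eLpNorm_add_le hm1 hm2 hp).trans ?_
    rw [eLpNorm_indicator_eq_eLpNorm_restrict (hS k)]
    exact (add_le_add h1 h2).trans (ENNReal.add_halves ε).le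
  refine ⟨r, C, symmetrize a, hC, pairwise_disjoint_fiber_inter φ D,
    fun c => (measure_mono inter_subset_right).trans_lt hDk, isSymmetric_symmetrize a,
    hfinal 1 le_rfl hk1 ?_, hfinal 2 one_le_two hk2 (ha.trans hδ1)⟩
  refine (eLpNorm_le_eLpNorm_mul_rpow_measure_univ one_le_two
    (hg.1.sub hh).aestronglyMeasurable).trans (le_trans ?_ hδK)
  gcongr

/-- Multiple integrals of symmetric kernels in `L²` are square integrable. The isometry for step
functions extends as an inequality, since multiple integrals depend continuously in `L¹` on the
kernel. The constant `n !` in place of its square root is large enough for the purposes here. -/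
lemma IsPoissonProcess.eLpNorm_two_chaos_le {Ω : Type*} [MeasurableSpace Ω] {P : Measure Ω}
    {η : Ω → Measure X} [IsProbabilityMeasure P] (hη : IsPoissonProcess η Λ P) {n : ℕ}
    {g : (Fin n → X) → ℝ} (hg : IsSymmKernel Λ n g) (hg2 : MemLp g 2 (Measure.pi fun _ => Λ)) :
    eLpNorm (chaos η Λ n g) 2 P ≤
      (n.factorial : ℝ≥0∞) * eLpNorm g 2 (Measure.pi fun _ => Λ) := by
  set M := ∑ k ∈ Finset.range (n + 1), ‖(-1 : ℝ) ^ (n + k) * n.choose k‖ₑ with hM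
  have hMtop : M ≠ ∞ := (ENNReal.sum_lt_top.2 fun k _ => enorm_lt_top).ne
  choose r C a hC hdisj hfin ha h1 h2 using fun k : ℕ =>
    hg.exists_gridFun hg2 (ε := ((k : ℝ≥0∞) + 1)⁻¹) (by simp)
  have hG : ∀ k, IsSymmKernel Λ n (gridFun (C k) (a k)) := fun k =>
    isSymmKernel_gridFun (hC k) (hfin k) (ha k)
  have hlim : Tendsto (fun k : ℕ => ((k : ℝ≥0∞) + 1)⁻¹) atTop (𝓝 0) := by
    have := (tendsto_add_atTop_iff_nat 1).2 ENNReal.tendsto_inv_nat_nhds_zero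
    simpa using this
  have hconv : TendstoInMeasure P (fun k => chaos η Λ n (gridFun (C k) (a k))) atTop
      (chaos η Λ n g) := by
    refine tendstoInMeasure_of_tendsto_eLpNorm one_ne_zero
      (fun k => hη.aestronglyMeasurable_chaos (hG k)) (hη.aestronglyMeasurable_chaos hg) ?_
    have hb : Tendsto (fun k : ℕ => M * ((k : ℝ≥0∞) + 1)⁻¹) atTop (𝓝 0) := by
      simpa using ENNReal.Tendsto.const_mul hlim (Or.inr hMtop)
    refine tendsto_of_tendsto_of_tendsto_of_le_of_le tendsto_const_nhds hb (fun _ => zero_le)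
      fun k => ?_
    rw [← eLpNorm_neg, neg_sub, ← eLpNorm_congr_ae (hη.ae_chaos_sub hg (hG k))]
    refine (hη.eLpNorm_one_chaos_le (hg.sub (hG k))).trans ?_
    gcongr
    exact h1 k
  -- the `L²` norm is lower semicontinuous under convergence in probability
  have hbound : ∀ ε : ℝ≥0∞, 0 < ε → eLpNorm (chaos η Λ n g) 2 P ≤
      (n.factorial : ℝ≥0∞) * (eLpNorm g 2 (Measure.pi fun _ => Λ) + ε) := by
    intro ε hε
    refine eLpNorm_le_of_tendstoInMeasure ?_ hconv
      fun k => hη.aestronglyMeasurable_chaos (hG k)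
    filter_upwards [hlim.eventually_le_const hε] with k hk
    have h3 : eLpNorm (gridFun (C k) (a k)) 2 (Measure.pi fun _ => Λ) ≤
        eLpNorm g 2 (Measure.pi fun _ => Λ) + ε := by
      have : gridFun (C k) (a k) = g - (g - gridFun (C k) (a k)) := by simp
      rw [this]
      exact (eLpNorm_sub_le hg.1.aestronglyMeasurable (hg.sub (hG k)).1.aestronglyMeasurable
        one_le_two).trans (add_le_add le_rfl ((h2 k).trans hk))
    refine le_trans ?_ (mul_le_mul_right h3 _)
    refine (ENNReal.pow_right_strictMono two_ne_zero).le_iff_le.1 ?_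
    rw [hη.eLpNorm_two_chaos_gridFun (hC k) (hdisj k) (hfin k) (ha k), mul_pow]
    gcongr
    exact_mod_cast Nat.le_self_pow two_ne_zero _
  have hc : Tendsto (fun ε : ℝ≥0∞ => (n.factorial : ℝ≥0∞) *
      (eLpNorm g 2 (Measure.pi fun _ => Λ) + ε)) (𝓝[>] 0)
      (𝓝 ((n.factorial : ℝ≥0∞) * (eLpNorm g 2 (Measure.pi fun _ => Λ) + 0))) :=
    (ENNReal.Tendsto.const_mul (tendsto_const_nhds.add tendsto_id)
      (Or.inr (ENNReal.natCast_ne_top _))).mono_left nhdsWithin_le_nhds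
  rw [add_zero] at hc
  exact ge_of_tendsto hc (eventually_nhdsWithin_of_forall hbound)

end Density

/-! ### The projected kernels as iterated partial integrals -/

section Projection

variable {X : Type*} [MeasurableSpace X] {lam : Measure X} [SigmaFinite lam]

/-- The kernel `f_n` without its binomial coefficient. -/
noncomputable def projInt (lam : Measure X) {m : ℕ} (f : (Fin m → X) → ℝ) (n : ℕ) (x : Fin n → X) :
    ℝ :=
  ∫ y : Fin (m - n) → X, f (glue x y) ∂(Measure.pi fun _ => lam)

lemma measurable_glue {m n : ℕ} :
    Measurable (fun p : (Fin n → X) × (Fin (m - n) → X) => (glue p.1 p.2 : Fin m → X)) := by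
  refine measurable_pi_lambda _ fun j => ?_
  by_cases h : (j : ℕ) < n
  · simp only [glue, h, dif_pos]
    exact (measurable_pi_apply _).comp measurable_fst
  · simp only [glue, h, dif_neg, not_false_iff]
    exact (measurable_pi_apply _).comp measurable_snd

lemma measurePreserving_glue {m n : ℕ} (h : n ≤ m) :
    MeasurePreserving (fun p : (Fin n → X) × (Fin (m - n) → X) => (glue p.1 p.2 : Fin m → X))
      ((Measure.pi fun _ => lam).prod (Measure.pi fun _ => lam)) (Measure.pi fun _ => lam) := by
  refine ⟨measurable_glue, (Measure.pi_eq fun s hs => ?_).symm⟩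
  set e : Fin n ⊕ Fin (m - n) ≃ Fin m :=
    finSumFinEquiv.trans (finCongr (Nat.add_sub_of_le h)) with he
  have hl : ∀ (x : Fin n → X) (y : Fin (m - n) → X) j, glue x y (e (Sum.inl j)) = x j := by
    intro x y j
    simp [glue, he]
  have hr : ∀ (x : Fin n → X) (y : Fin (m - n) → X) j, glue x y (e (Sum.inr j)) = y j := by
    intro x y j
    simp [glue, he]
  have hpre : (fun p : (Fin n → X) × (Fin (m - n) → X) => (glue p.1 p.2 : Fin m → X)) ⁻¹'
      univ.pi s = (univ.pi fun j => s (e (Sum.inl j))) ×ˢ (univ.pi fun j => s (e (Sum.inr j))) := by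
    ext p
    simp only [mem_preimage, mem_univ_pi, mem_prod, ← e.forall_congr_right (q := fun j =>
      (glue p.1 p.2 : Fin m → X) j ∈ s j), Sum.forall, hl, hr]
  rw [Measure.map_apply measurable_glue (MeasurableSet.univ_pi hs), hpre, Measure.prod_prod,
    Measure.pi_pi, Measure.pi_pi, ← e.prod_comp, Fintype.prod_sum_type]

lemma IsSymmKernel.integrable_glue {m n : ℕ} (h : n ≤ m) {f : (Fin m → X) → ℝ}
    (hf : IsSymmKernel lam m f) :
    Integrable (fun p : (Fin n → X) × (Fin (m - n) → X) => f (glue p.1 p.2))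
      ((Measure.pi fun _ => lam).prod (Measure.pi fun _ => lam)) :=
  ((measurePreserving_glue h).integrable_comp hf.1.aestronglyMeasurable).2 hf.2.2

lemma projInt_self {m : ℕ} (f : (Fin m → X) → ℝ) : projInt lam f m = f := by
  funext x
  have h : ∀ y : Fin (m - m) → X, glue x y = x := by
    intro y
    funext j
    simp [glue]
  have : IsEmpty (Fin (m - m)) := by
    rw [Nat.sub_self]
    infer_instance
  simp only [projInt, h]
  simp [Measure.real]

lemma measurePreserving_comp_cast {p q : ℕ} (h : p = q) :
    MeasurePreserving (fun (y : Fin q → X) (j : Fin p) => y (Fin.cast h j))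
      (Measure.pi fun _ => lam) (Measure.pi fun _ => lam) := by
  subst h
  exact MeasurePreserving.id _

/-- Integration over the last variable and then over the others beyond the first `n` gives the same
kernel as joint integration. -/
lemma projInt_partialInt {m n : ℕ} (h : n ≤ m) {f : (Fin (m + 1) → X) → ℝ}
    (hf : IsSymmKernel lam (m + 1) f) :
    projInt lam (partialInt lam f) n =ᵐ[Measure.pi fun _ => lam] projInt lam f n := by
  have hq : m + 1 - n = m - n + 1 := by omega
  have hmp := (measurePreserving_comp_cast (lam := lam) hq).comp (measurePreserving_snoc (m - n))
  have hglue : ∀ (x : Fin n → X) (p : (Fin (m - n) → X) × X),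
      (glue x (fun j : Fin (m + 1 - n) =>
        (Fin.snoc p.1 p.2 : Fin (m - n + 1) → X) (Fin.cast hq j)) : Fin (m + 1) → X) =
      Fin.snoc (glue x p.1 : Fin m → X) p.2 := by
    intro x p
    funext j
    refine Fin.lastCases ?_ (fun j => ?_) j
    · have h1 : ¬ m < n := by omega
      have h2 : (Fin.cast hq ⟨m - n, by omega⟩ : Fin (m - n + 1)) = Fin.last (m - n) := by
        ext
        simp
      simp [glue, h1, h2]
    · by_cases hj : (j : ℕ) < n
      · simp [glue, hj]
      · have h2 : (Fin.cast hq ⟨j - n, by omega⟩ : Fin (m - n + 1)) =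
            Fin.castSucc ⟨j - n, by omega⟩ := by
          ext
          simp
        simp only [glue, Fin.val_castSucc, hj, dif_neg, not_false_iff, h2, Fin.snoc_castSucc]
  filter_upwards [(hf.integrable_glue (n := n) (by omega)).prod_right_ae] with x hx
  simp only [projInt, partialInt]
  rw [← hmp.map_eq, integral_map hmp.measurable.aemeasurable, integral_prod]
  · exact integral_congr_ae (ae_of_all _ fun y => integral_congr_ae (ae_of_all _ fun z =>
      congrArg f (hglue x (y, z)).symm))
  · exact (hmp.integrable_comp hx.aestronglyMeasurable).2 hx
  · rw [hmp.map_eq]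
    exact hx.aestronglyMeasurable

lemma measurable_projInt {m n : ℕ} {f : (Fin m → X) → ℝ} (hf : Measurable f) :
    Measurable (projInt lam f n) :=
  ((hf.comp measurable_glue).stronglyMeasurable.integral_prod_right').measurable

lemma isSymmKernel_projInt_one {m : ℕ} (h : 1 ≤ m) {f : (Fin m → X) → ℝ}
    (hf : IsSymmKernel lam m f) : IsSymmKernel lam 1 (projInt lam f 1) := by
  refine ⟨measurable_projInt hf.1, fun s x => ?_, (hf.integrable_glue h).integral_prod_left⟩
  rw [Subsingleton.elim s 1]
  rfl

end Projection

/-! ### Intensity measures that are multiples of a fixed measure -/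

section Scaling

variable {X : Type*} [MeasurableSpace X] {lam : Measure X} [SigmaFinite lam] {Λ : Measure X}
  [SigmaFinite Λ] {t : ℝ}

lemma pi_smul_measure (hΛ : Λ = ENNReal.ofReal t • lam) (n : ℕ) :
    Measure.pi (fun _ : Fin n => Λ) = ENNReal.ofReal t ^ n • Measure.pi fun _ => lam := by
  refine Measure.pi_eq fun s hs => ?_
  rw [Measure.smul_apply, Measure.pi_pi, hΛ]
  simp [Finset.prod_mul_distrib]

lemma partialInt_smul_measure (ht : 0 < t) (hΛ : Λ = ENNReal.ofReal t • lam) {n : ℕ}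
    (g : (Fin (n + 1) → X) → ℝ) : partialInt Λ g = t • partialInt lam g := by
  funext x
  simp only [partialInt, hΛ, integral_smul_measure, Pi.smul_apply, ENNReal.toReal_ofReal ht.le]

lemma IsSymmKernel.smul_measure (hΛ : Λ = ENNReal.ofReal t • lam) {n : ℕ} {g : (Fin n → X) → ℝ}
    (hg : IsSymmKernel lam n g) : IsSymmKernel Λ n g :=
  ⟨hg.1, hg.2.1, by
    rw [pi_smul_measure hΛ]
    exact hg.2.2.smul_measure (ENNReal.pow_ne_top ENNReal.ofReal_ne_top)⟩

lemma IsSymmKernel.const_smul {n : ℕ} {g : (Fin n → X) → ℝ}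
    (hg : IsSymmKernel lam n g) (c : ℝ) : IsSymmKernel lam n (c • g) :=
  ⟨hg.1.const_smul c, fun s x => by simp [hg.2.1 s x], hg.2.2.smul c⟩

lemma eLpNorm_two_smul_measure (hΛ : Λ = ENNReal.ofReal t • lam) {n : ℕ} (g : (Fin n → X) → ℝ) :
    eLpNorm g 2 (Measure.pi fun _ => Λ) =
      (ENNReal.ofReal t ^ n) ^ (1 / 2 : ℝ) * eLpNorm g 2 (Measure.pi fun _ => lam) := by
  rw [pi_smul_measure hΛ, eLpNorm_smul_measure_of_ne_top ENNReal.ofNat_ne_top]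
  simp

end Scaling

/-! ### The chaos decomposition of a Poisson U-statistic -/

section Decomposition

variable {X : Type*} [MeasurableSpace X] {Λ : Measure X} [SigmaFinite Λ]
  {Ω : Type*} [MeasurableSpace Ω] {P : Measure Ω} {η : Ω → Measure X}

/-- The multiple integral of order `n` of the kernel that remains when `f` is integrated over its
last `m - n` variables; for `n > m` the value is irrelevant. -/
noncomputable def chaosPart (η : Ω → Measure X) (Λ : Measure X) [SigmaFinite Λ] :
    (m : ℕ) → ((Fin m → X) → ℝ) → ℕ → Ω → ℝ
  | 0, f, _ => chaos η Λ 0 f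
  | m + 1, f, n => if n = m + 1 then chaos η Λ (m + 1) f else chaosPart η Λ m (partialInt Λ f) n

lemma chaosPart_self (m : ℕ) (f : (Fin m → X) → ℝ) : chaosPart η Λ m f m = chaos η Λ m f := by
  cases m <;> simp [chaosPart]

lemma chaosPart_succ {m n : ℕ} (h : n ≤ m) (f : (Fin (m + 1) → X) → ℝ) :
    chaosPart η Λ (m + 1) f n = chaosPart η Λ m (partialInt Λ f) n := by
  rw [chaosPart, if_neg (by omega)]

/-- The part of order `n` is an alternating sum of mixed integrals of `f` itself: further variables
are integrated with respect to `Λ` in each of them. -/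
lemma chaosPart_eq_altSum {m n : ℕ} (h : n ≤ m) (f : (Fin m → X) → ℝ) (ω : Ω) :
    chaosPart η Λ m f n ω = altSum n fun k => mixInt Λ (fun j => factProc η Λ j ω) m f k := by
  induction m with
  | zero =>
    obtain rfl : n = 0 := by omega
    rfl
  | succ m ih =>
    rcases Nat.lt_or_ge m n with h1 | h1
    · obtain rfl : n = m + 1 := by omega
      rw [chaosPart_self]
      rfl
    · rw [chaosPart_succ h1, ih h1]
      refine altSum_congr fun k hk => ?_
      rw [mixInt, if_neg (by omega)]

/-- Binomial inversion. -/
lemma sum_choose_mul_altSum (m : ℕ) (M : ℕ → ℝ) :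
    ∑ n ∈ Finset.range (m + 1), (m.choose n : ℝ) * altSum n M = M m := by
  induction m generalizing M with
  | zero => simp [altSum]
  | succ m ih =>
    have h : ∀ n, (((m + 1).choose (n + 1) : ℕ) : ℝ) * altSum (n + 1) M =
        m.choose n * altSum n (fun k => M (k + 1)) - m.choose n * altSum n M +
          m.choose (n + 1) * altSum (n + 1) M := by
      intro n
      rw [Nat.choose_succ_succ, ← mul_sub, ← altSum_succ]
      push_cast
      ring
    have h2 : ∑ n ∈ Finset.range (m + 1), (m.choose (n + 1) : ℝ) * altSum (n + 1) M + altSum 0 M =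
        ∑ n ∈ Finset.range (m + 1), (m.choose n : ℝ) * altSum n M := by
      rw [Finset.sum_range_succ, Nat.choose_succ_self, Finset.sum_range_succ' _ m]
      simp
    rw [Finset.sum_range_succ']
    simp only [h]
    rw [Finset.sum_add_distrib, Finset.sum_sub_distrib, ih, ih, Nat.choose_zero_right,
      Nat.cast_one, one_mul, add_assoc, h2, ih]
    ring

/-- The chaos decomposition: an integral with respect to a factorial measure is a sum of multiple
Wiener-Itô integrals. -/
lemma integral_factProc_eq_sum_chaosPart (m : ℕ) (f : (Fin m → X) → ℝ) (ω : Ω) :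
    ∫ x, f x ∂factProc η Λ m ω =
      ∑ n ∈ Finset.range (m + 1), (m.choose n : ℝ) * chaosPart η Λ m f n ω := by
  have h1 : ∫ x, f x ∂factProc η Λ m ω = mixInt Λ (fun j => factProc η Λ j ω) m f m := by
    cases m <;> simp [mixInt]
  rw [h1, ← sum_choose_mul_altSum m fun k => mixInt Λ (fun j => factProc η Λ j ω) m f k]
  refine Finset.sum_congr rfl fun n hn => ?_
  rw [chaosPart_eq_altSum (Nat.lt_succ_iff.1 (Finset.mem_range.1 hn))]

variable {lam : Measure X} [SigmaFinite lam] {t : ℝ} [IsProbabilityMeasure P]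

lemma IsPoissonProcess.aestronglyMeasurable_chaosPart (hη : IsPoissonProcess η Λ P) {m n : ℕ}
    (h : n ≤ m) {f : (Fin m → X) → ℝ} (hf : IsSymmKernel Λ m f) :
    AEStronglyMeasurable (chaosPart η Λ m f n) P := by
  induction m with
  | zero => exact hη.aestronglyMeasurable_chaos hf
  | succ m ih =>
    rcases Nat.lt_or_ge m n with h1 | h1
    · obtain rfl : n = m + 1 := by omega
      rw [chaosPart_self]
      exact hη.aestronglyMeasurable_chaos hf
    · rw [chaosPart_succ h1]
      exact ih h1 hf.partialInt

/-- The size of the part of order `n` for the intensity measure `t • lam`: each of the `m - n`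
variables that are integrated out contributes a factor `t`, and each of the others a factor `√t`. -/
lemma IsPoissonProcess.eLpNorm_two_chaosPart_le (hη : IsPoissonProcess η Λ P) (ht : 0 < t)
    (hΛ : Λ = ENNReal.ofReal t • lam) {m n : ℕ} (h : n ≤ m) {f : (Fin m → X) → ℝ}
    (hf : IsSymmKernel lam m f) (hf2 : MemLp (projInt lam f n) 2 (Measure.pi fun _ => lam)) :
    eLpNorm (chaosPart η Λ m f n) 2 P ≤ n.factorial * ENNReal.ofReal t ^ (m - n) *
      (ENNReal.ofReal t ^ n) ^ (1 / 2 : ℝ) *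
        eLpNorm (projInt lam f n) 2 (Measure.pi fun _ => lam) := by
  induction m with
  | zero =>
    obtain rfl : n = 0 := by omega
    rw [projInt_self] at hf2 ⊢
    rw [chaosPart_self]
    refine (hη.eLpNorm_two_chaos_le (hf.smul_measure hΛ) ⟨hf2.1.mono_ac ?_, ?_⟩).trans ?_
    · rw [pi_smul_measure hΛ]
      exact Measure.smul_absolutelyContinuous
    · rw [eLpNorm_two_smul_measure hΛ]
      exact ENNReal.mul_lt_top (by simp) hf2.2
    · rw [eLpNorm_two_smul_measure hΛ]
      simp
  | succ m ih =>
    rcases Nat.lt_or_ge m n with h1 | h1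
    · obtain rfl : n = m + 1 := by omega
      rw [projInt_self] at hf2 ⊢
      rw [chaosPart_self]
      refine (hη.eLpNorm_two_chaos_le (hf.smul_measure hΛ) ⟨hf2.1.mono_ac ?_, ?_⟩).trans ?_
      · rw [pi_smul_measure hΛ]
        exact Measure.smul_absolutelyContinuous
      · rw [eLpNorm_two_smul_measure hΛ]
        exact ENNReal.mul_lt_top (by
          refine (ENNReal.rpow_ne_top_of_nonneg (by norm_num)
            (ENNReal.pow_ne_top ENNReal.ofReal_ne_top)).lt_top) hf2.2
      · rw [eLpNorm_two_smul_measure hΛ, Nat.sub_self, pow_zero, mul_one, mul_assoc]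
    · have hpart : partialInt Λ f = t • partialInt lam f := partialInt_smul_measure ht hΛ f
      have hproj : projInt lam (t • partialInt lam f) n =ᵐ[Measure.pi fun _ => lam]
          t • projInt lam f n := by
        have e : projInt lam (t • partialInt lam f) n = t • projInt lam (partialInt lam f) n := by
          funext x
          simp only [projInt, Pi.smul_apply, smul_eq_mul, integral_const_mul]
        rw [e]
        filter_upwards [projInt_partialInt h1 hf] with x hx
        simp [hx]
      rw [chaosPart_succ h1, hpart]
      refine (ih h1 (hf.partialInt.const_smul t)
        ((memLp_congr_ae hproj).2 (hf2.const_smul t))).trans (le_of_eq ?_)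
      rw [eLpNorm_congr_ae hproj, eLpNorm_const_smul, Nat.succ_sub h1, pow_succ,
        Real.enorm_eq_ofReal ht.le]
      ring

end Decomposition

/-! ### Products of linear functionals of a point measure -/

section FactorialMeasure

variable {X : Type*} [MeasurableSpace X]

lemma measurable_const_fin_one : Measurable fun (y : X) (_ : Fin 1) => y :=
  measurable_pi_lambda _ fun _ => measurable_id

lemma factorialMeasure_one {μ : Measure X} (hμ : IsPointMeasure μ) :
    factorialMeasure μ 1 = μ.map fun y _ => y := by
  have := hμ.1
  have h := factorialMeasure_succ_add hμ 0
  simp only [Finset.univ_eq_empty, Finset.sum_empty, add_zero] at h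
  rw [h, factorialMeasure, Measure.dirac_prod, Measure.map_map measurable_snoc
    measurable_prodMk_left]
  congr 1

/-- The recursion of the factorial measures for integrals, in additive form. -/
lemma lintegral_factorialMeasure_succ {μ : Measure X} (hμ : IsPointMeasure μ) (n : ℕ)
    {F : (Fin (n + 1) → X) → ℝ≥0∞} (hF : Measurable F) :
    ∫⁻ x, F x ∂factorialMeasure μ (n + 1) +
        ∑ j, ∫⁻ x, F (Fin.snoc x (x j) : Fin (n + 1) → X) ∂factorialMeasure μ n =
      ∫⁻ x, ∫⁻ y, F (Fin.snoc x y : Fin (n + 1) → X) ∂μ ∂factorialMeasure μ n := by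
  have := hμ.1
  have := sigmaFinite_factorialMeasure hμ n
  have h := congrArg (fun M => ∫⁻ x, F x ∂M) (factorialMeasure_succ_add hμ n)
  rw [lintegral_add_measure, lintegral_finsetSum_measure, lintegral_map hF measurable_snoc,
    lintegral_prod (fun p : (Fin n → X) × X => F (Fin.snoc p.1 p.2 : Fin (n + 1) → X))
      (hF.comp measurable_snoc).aemeasurable] at h
  rw [← h]
  congr 1
  exact Finset.sum_congr rfl fun j _ => (lintegral_map hF (measurable_snoc_self j)).symm

lemma snoc_zero {n : ℕ} (x : Fin (n + 1) → X) (y : X) :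
    (Fin.snoc x y : Fin (n + 2) → X) 0 = x 0 :=
  Fin.snoc_castSucc (α := fun _ => X) y x 0

lemma snoc_two_one (x : Fin 2 → X) (y : X) : (Fin.snoc x y : Fin 3 → X) 1 = x 1 :=
  Fin.snoc_castSucc (α := fun _ => X) y x 1

lemma snoc_one_one (x : Fin 1 → X) (y : X) : (Fin.snoc x y : Fin 2 → X) 1 = y :=
  Fin.snoc_last (α := fun _ => X) y x

lemma snoc_two_two (x : Fin 2 → X) (y : X) : (Fin.snoc x y : Fin 3 → X) 2 = y :=
  Fin.snoc_last (α := fun _ => X) y x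

/-- The third power of a linear functional of a point measure in terms of factorial measures. -/
lemma lintegral_pow_three {μ : Measure X} (hμ : IsPointMeasure μ) {b : X → ℝ≥0∞}
    (hb : Measurable b) :
    (∫⁻ y, b y ∂μ) ^ 3 = ∫⁻ x, b (x 0) * b (x 1) * b (x 2) ∂factorialMeasure μ 3 +
      (2 * ∫⁻ x, b (x 0) ^ 2 * b (x 1) ∂factorialMeasure μ 2 +
        ∫⁻ x, b (x 0) * b (x 1) ^ 2 ∂factorialMeasure μ 2) +
      ∫⁻ x, b (x 0) ^ 3 ∂factorialMeasure μ 1 := by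
  have hm : ∀ {n : ℕ} (j : Fin n), Measurable fun x : Fin n → X => b (x j) := fun j =>
    hb.comp (measurable_pi_apply j)
  have h1 : ∀ c : X → ℝ≥0∞, Measurable c →
      ∫⁻ x, c (x 0) ∂factorialMeasure μ 1 = ∫⁻ y, c y ∂μ := by
    intro c hc
    rw [factorialMeasure_one hμ, lintegral_map (f := fun x : Fin 1 → X => c (x 0))
      (hc.comp (measurable_pi_apply 0)) measurable_const_fin_one]
  have e2 := lintegral_factorialMeasure_succ hμ 1 (F := fun x => b (x 0) * b (x 1))
    ((hm 0).mul (hm 1))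
  have e2' := lintegral_factorialMeasure_succ hμ 1 (F := fun x => b (x 0) ^ 2 * b (x 1))
    (((hm 0).pow_const 2).mul (hm 1))
  have e3 := lintegral_factorialMeasure_succ hμ 2 (F := fun x => b (x 0) * b (x 1) * b (x 2))
    (((hm 0).mul (hm 1)).mul (hm 2))
  simp only [snoc_zero, snoc_two_one, snoc_one_one, snoc_two_two, Fin.sum_univ_two,
    Fin.sum_univ_one, lintegral_const_mul _ hb, lintegral_mul_const _ (hm _),
    lintegral_mul_const _ ((hm _).pow_const _)] at e2 e2' e3
  rw [lintegral_mul_const (f := fun x : Fin 2 → X => b (x 0) * b (x 1)) _ ((hm 0).mul (hm 1))] at e3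
  rw [h1 b hb] at e2
  rw [h1 _ (hb.pow_const 2)] at e2'
  have e4 : ∫⁻ x, b (x 0) * b (x 0) ∂factorialMeasure μ 1 = ∫⁻ y, b y ^ 2 ∂μ := by
    rw [← h1 _ (hb.pow_const 2)]
    simp only [sq]
  have e5 : ∀ x : Fin 2 → X, b (x 0) * b (x 1) * b (x 0) = b (x 0) ^ 2 * b (x 1) := fun x => by ring
  have e6 : ∀ x : Fin 2 → X, b (x 0) * b (x 1) * b (x 1) = b (x 0) * b (x 1) ^ 2 := fun x => by ring
  have e7 : ∀ x : Fin 1 → X, b (x 0) ^ 2 * b (x 0) = b (x 0) ^ 3 := fun x => by ring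
  simp only [e5, e6, e7, e4] at e2 e2' e3
  rw [pow_succ, sq, ← e2, add_mul, ← e2', ← e3]
  ring

/-- The product of two linear functionals of a point measure in terms of factorial measures. -/
lemma integral_mul_integral {μ : Measure X} (hμ : IsPointMeasure μ) {φ ψ : X → ℝ}
    (hφm : Measurable φ) (hψm : Measurable ψ) (hφ : Integrable φ μ) (hψ : Integrable ψ μ) :
    (∫ y, φ y ∂μ) * ∫ y, ψ y ∂μ =
      ∫ x, φ (x 0) * ψ (x 1) ∂factorialMeasure μ 2 + ∫ y, φ y * ψ y ∂μ := by
  have := hμ.1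
  have := sigmaFinite_factorialMeasure hμ 1
  have hF : Measurable fun x : Fin 2 → X => φ (x 0) * ψ (x 1) :=
    (hφm.comp (measurable_pi_apply 0)).mul (hψm.comp (measurable_pi_apply 1))
  have hφ1 : Measurable fun x : Fin 1 → X => φ (x 0) := hφm.comp (measurable_pi_apply 0)
  have h1 : MeasurePreserving (fun (y : X) (_ : Fin 1) => y) μ (factorialMeasure μ 1) :=
    ⟨measurable_const_fin_one, (factorialMeasure_one hμ).symm⟩
  have h := factorialMeasure_succ_add hμ 1
  have hi : Integrable (fun x : Fin 2 → X => φ (x 0) * ψ (x 1))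
      (((factorialMeasure μ 1).prod μ).map
        fun p => (Fin.snoc p.1 p.2 : Fin (1 + 1) → X)) := by
    rw [integrable_map_measure hF.aestronglyMeasurable measurable_snoc.aemeasurable]
    have := ((h1.integrable_comp (g := fun x : Fin 1 → X => φ (x 0))
      hφ1.aestronglyMeasurable).1 hφ).mul_prod hψ
    refine this.congr (ae_of_all _ fun p => ?_)
    simp only [Function.comp_apply, snoc_zero, snoc_one_one]
  have hi' := hi
  rw [← h, integrable_add_measure] at hi'
  have e := congrArg (fun M => ∫ x : Fin 2 → X, φ (x 0) * ψ (x 1) ∂M) h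
  rw [integral_add_measure hi'.1 hi'.2, integral_map measurable_snoc.aemeasurable
    hF.aestronglyMeasurable, Fin.sum_univ_one, integral_map (measurable_snoc_self _).aemeasurable
    hF.aestronglyMeasurable] at e
  simp only [snoc_zero, snoc_one_one] at e
  rw [integral_prod_mul (fun x : Fin 1 → X => φ (x 0)) ψ, ← h1.map_eq,
    integral_map measurable_const_fin_one.aemeasurable hφ1.aestronglyMeasurable,
    integral_map (φ := fun (y : X) (_ : Fin 1) => y) (f := fun x : Fin 1 → X => φ (x 0) * ψ (x 0))
      measurable_const_fin_one.aemeasurable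
      (hφ1.mul (hψm.comp (measurable_pi_apply 0))).aestronglyMeasurable] at e
  exact e.symm

end FactorialMeasure

/-! ### Linear functionals of the compensated process -/

section FirstOrder

variable {X : Type*} [MeasurableSpace X] {Λ : Measure X}
  {Ω : Type*} [MeasurableSpace Ω] {P : Measure Ω} {η : Ω → Measure X}

/-- The integral of `φ` with respect to the compensated process `η - Λ`. -/
noncomputable def firstChaos (η : Ω → Measure X) (Λ : Measure X) (φ : X → ℝ) (ω : Ω) : ℝ :=
  ∫ y, φ y ∂η ω - ∫ y, φ y ∂Λ

variable [SigmaFinite Λ]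

lemma measurePreserving_const_fin_one :
    MeasurePreserving (fun (y : X) (_ : Fin 1) => y) Λ (Measure.pi fun _ => Λ) := by
  refine ⟨measurable_const_fin_one, (Measure.pi_eq fun s hs => ?_).symm⟩
  rw [Measure.map_apply measurable_const_fin_one (MeasurableSet.univ_pi hs)]
  simp [preimage]

lemma isSymmKernel_one {φ : X → ℝ} (hφm : Measurable φ) (hφ : Integrable φ Λ) :
    IsSymmKernel Λ 1 fun x => φ (x 0) := by
  refine ⟨hφm.comp (measurable_pi_apply 0), fun s x => ?_, ?_⟩
  · rw [Subsingleton.elim s 1]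
    rfl
  · exact (measurePreserving_const_fin_one.integrable_comp
      (g := fun x : Fin 1 → X => φ (x 0))
      (hφm.comp (measurable_pi_apply 0)).aestronglyMeasurable).1 hφ

variable [IsProbabilityMeasure P] (hη : IsPoissonProcess η Λ P)
include hη

/-- The intensity measure is the mean of the process. -/
lemma IsPoissonProcess.bind_eq : P.bind η = Λ := by
  have h0 : Measurable fun x : Fin 1 → X => x 0 := measurable_pi_apply 0
  have h1 : ∀ᵐ ω ∂P, (factProc η Λ 1 ω).map (fun x => x 0) = η ω := by
    filter_upwards [hη.ae_factProc_eq 1] with ω hω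
    rw [hω, factorialMeasure_one (hη.isPointMeasure ω), Measure.map_map h0 measurable_const_fin_one]
    exact Measure.map_id
  refine Measure.ext fun B hB => ?_
  rw [Measure.bind_apply hB hη.measurable.aemeasurable]
  have h2 : ∫⁻ ω, η ω B ∂P = ∫⁻ ω, factProc η Λ 1 ω ((fun x => x 0) ⁻¹' B) ∂P := by
    refine lintegral_congr_ae ?_
    filter_upwards [h1] with ω hω
    rw [← hω, Measure.map_apply h0 hB]
  rw [h2, ← Measure.bind_apply (h0 hB) (hη.measurable_factProc 1).aemeasurable,
    hη.bind_factProc 1,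
    ← measurePreserving_const_fin_one.measure_preimage (h0 hB).nullMeasurableSet]
  rfl

/-- Multiple integrals of order one are integrals with respect to the compensated process. -/
lemma IsPoissonProcess.ae_chaos_one {g : (Fin 1 → X) → ℝ} (hg : Measurable g) :
    chaos η Λ 1 g =ᵐ[P] firstChaos η Λ fun y => g fun _ => y := by
  filter_upwards [hη.ae_factProc_eq 1, hη.ae_factProc_eq 0] with ω h1 h0
  have e : chaos η Λ 1 g ω = ∫ x, g x ∂factProc η Λ 1 ω -
      ∫ x, partialInt Λ g x ∂factProc η Λ 0 ω := by
    simp [chaos, altSum, Finset.sum_range_succ, mixInt]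
    ring
  have e2 : ∀ y, (Fin.snoc (Fin.elim0 : Fin 0 → X) y : Fin 1 → X) = fun _ => y := by
    intro y
    funext j
    obtain rfl : j = Fin.last 0 := Fin.fin_one_eq_zero j
    exact Fin.snoc_last (α := fun _ => X) y Fin.elim0
  rw [e, h1, h0, factorialMeasure_one (hη.isPointMeasure ω), factorialMeasure,
    integral_map measurable_const_fin_one.aemeasurable hg.aestronglyMeasurable,
    integral_dirac' _ _ Subsingleton.measurable.stronglyMeasurable]
  simp only [partialInt, e2]
  rfl

end FirstOrder

/-! ### Moments of linear functionals -/

section Moments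

variable {X : Type*} [MeasurableSpace X] {Λ : Measure X} [SigmaFinite Λ]
  {Ω : Type*} [MeasurableSpace Ω] {P : Measure Ω} {η : Ω → Measure X} {φ ψ : X → ℝ}

lemma firstChaos_const_mul (c : ℝ) (φ : X → ℝ) (ω : Ω) :
    firstChaos η Λ (fun y => c * φ y) ω = c * firstChaos η Λ φ ω := by
  simp only [firstChaos, integral_const_mul]
  ring

lemma measurable_comp_eval {β : Type*} [MeasurableSpace β] {c : X → β} (hc : Measurable c) {n : ℕ}
    (j : Fin n) : Measurable fun x : Fin n → X => c (x j) :=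
  hc.comp (measurable_pi_apply j)

variable [IsProbabilityMeasure P] (hη : IsPoissonProcess η Λ P)
include hη

lemma IsPoissonProcess.ae_integrable (hφm : Measurable φ) (hφ : Integrable φ Λ) :
    ∀ᵐ ω ∂P, Integrable φ (η ω) :=
  ae_integrable_of_bind_eq hη.measurable hη.bind_eq hφm hφ

lemma IsPoissonProcess.aestronglyMeasurable_firstChaos (hφm : Measurable φ) (hφ : Integrable φ Λ) :
    AEStronglyMeasurable (firstChaos η Λ φ) P :=
  (aestronglyMeasurable_integral_of_bind_eq hη.measurable hη.bind_eq hφm hφ).sub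
    aestronglyMeasurable_const

lemma IsPoissonProcess.ae_firstChaos_congr (hφm : Measurable φ) (hψm : Measurable ψ)
    (h : φ =ᵐ[Λ] ψ) : firstChaos η Λ φ =ᵐ[P] firstChaos η Λ ψ := by
  have hms : MeasurableSet {y | ¬ φ y = ψ y} := (measurableSet_eq_fun hφm hψm).compl
  have h0 : Λ {y | ¬ φ y = ψ y} = 0 := h
  have hm : Measurable fun ω => η ω {y | ¬ φ y = ψ y} :=
    (Measure.measurable_coe hms).comp hη.measurable
  rw [← hη.bind_eq, Measure.bind_apply hms hη.measurable.aemeasurable,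
    lintegral_eq_zero_iff hm] at h0
  filter_upwards [h0] with ω hω
  rw [firstChaos, firstChaos, integral_congr_ae h, integral_congr_ae (show φ =ᵐ[η ω] ψ from hω)]

lemma IsPoissonProcess.ae_firstChaos_sum {ι : Type*} (s : Finset ι) (w : ι → ℝ) {φ : ι → X → ℝ}
    (hφm : ∀ i, Measurable (φ i)) (hφ : ∀ i, Integrable (φ i) Λ) :
    firstChaos η Λ (fun y => ∑ i ∈ s, w i * φ i y) =ᵐ[P]
      fun ω => ∑ i ∈ s, w i * firstChaos η Λ (φ i) ω := by
  have h : ∀ᵐ ω ∂P, ∀ i ∈ s, Integrable (φ i) (η ω) :=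
    (Finset.eventually_all s).2 fun i _ => hη.ae_integrable (hφm i) (hφ i)
  filter_upwards [h] with ω hω
  simp only [firstChaos, mul_sub, Finset.sum_sub_distrib]
  rw [integral_finsetSum _ fun i hi => (hω i hi).const_mul _,
    integral_finsetSum _ fun i _ => (hφ i).const_mul _]
  simp only [integral_const_mul]

lemma IsPoissonProcess.integral_firstChaos (hφm : Measurable φ) (hφ : Integrable φ Λ) :
    ∫ ω, firstChaos η Λ φ ω ∂P = 0 := by
  simp only [firstChaos]
  rw [integral_sub (integrable_integral_of_bind_eq hη.measurable hη.bind_eq hφm hφ)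
    (integrable_const _), integral_integral_of_bind_eq hη.measurable hη.bind_eq hφm hφ]
  simp

lemma IsPoissonProcess.memLp_two_firstChaos (hφm : Measurable φ) (hφ : Integrable φ Λ)
    (hφ2 : MemLp φ 2 Λ) : MemLp (firstChaos η Λ φ) 2 P := by
  have hm := hη.aestronglyMeasurable_firstChaos hφm hφ
  have hmp : MemLp (fun x : Fin 1 → X => φ (x 0)) 2 (Measure.pi fun _ => Λ) := by
    rw [← (measurePreserving_const_fin_one (Λ := Λ)).map_eq,
      memLp_map_measure_iff (measurable_comp_eval hφm 0).aestronglyMeasurable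
        measurable_const_fin_one.aemeasurable]
    exact hφ2
  have h := hη.eLpNorm_two_chaos_le (isSymmKernel_one hφm hφ) hmp
  rw [eLpNorm_congr_ae (hη.ae_chaos_one (measurable_comp_eval hφm 0))] at h
  exact ⟨hm, h.trans_lt (ENNReal.mul_lt_top (by simp) hmp.2)⟩

/-- The covariance of two linear functionals, from the Campbell formulas of orders one and two. -/
lemma IsPoissonProcess.integral_firstChaos_mul (hφm : Measurable φ) (hφ : Integrable φ Λ)
    (hφ2 : MemLp φ 2 Λ) (hψm : Measurable ψ) (hψ : Integrable ψ Λ) (hψ2 : MemLp ψ 2 Λ) :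
    ∫ ω, firstChaos η Λ φ ω * firstChaos η Λ ψ ω ∂P = ∫ y, φ y * ψ y ∂Λ := by
  have hF : Measurable fun x : Fin 2 → X => φ (x 0) * ψ (x 1) :=
    (hφm.comp (measurable_pi_apply 0)).mul (hψm.comp (measurable_pi_apply 1))
  have hFi : Integrable (fun x : Fin 2 → X => φ (x 0) * ψ (x 1)) (Measure.pi fun _ => Λ) := by
    have h := Integrable.fintype_prod (μ := fun _ => Λ) (f := ![φ, ψ])
      (Fin.forall_fin_two.2 ⟨hφ, hψ⟩)
    simpa using h
  have hFe : ∫ x : Fin 2 → X, φ (x 0) * ψ (x 1) ∂(Measure.pi fun _ => Λ) =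
      (∫ y, φ y ∂Λ) * ∫ y, ψ y ∂Λ := by
    have h := integral_fintype_prod_eq_prod (μ := fun _ => Λ) (fun i : Fin 2 => ![φ, ψ] i)
    simpa using h
  have hpm : Measurable fun y => φ y * ψ y := hφm.mul hψm
  have hpi : Integrable (fun y => φ y * ψ y) Λ := hφ2.integrable_mul hψ2
  have e : (fun ω => firstChaos η Λ φ ω * firstChaos η Λ ψ ω) =ᵐ[P] fun ω =>
      ∫ x : Fin 2 → X, φ (x 0) * ψ (x 1) ∂factProc η Λ 2 ω + ∫ y, φ y * ψ y ∂η ω -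
        (∫ y, ψ y ∂Λ) * ∫ y, φ y ∂η ω - (∫ y, φ y ∂Λ) * ∫ y, ψ y ∂η ω +
        (∫ y, φ y ∂Λ) * ∫ y, ψ y ∂Λ := by
    filter_upwards [hη.ae_integrable hφm hφ, hη.ae_integrable hψm hψ, hη.ae_factProc_eq 2]
      with ω h1 h2 h3
    rw [h3, ← integral_mul_integral (hη.isPointMeasure ω) hφm hψm h1 h2, firstChaos, firstChaos]
    ring
  have i1 := integrable_integral_of_bind_eq (hη.measurable_factProc 2) (hη.bind_factProc 2) hF hFi
  have i2 := integrable_integral_of_bind_eq hη.measurable hη.bind_eq hpm hpi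
  have i3 := integrable_integral_of_bind_eq hη.measurable hη.bind_eq hφm hφ
  have i4 := integrable_integral_of_bind_eq hη.measurable hη.bind_eq hψm hψ
  have i12 := i1.add i2
  have i123 := i12.sub (i3.const_mul (∫ y, ψ y ∂Λ))
  have i1234 := i123.sub (i4.const_mul (∫ y, φ y ∂Λ))
  simp only [Pi.add_def, Pi.sub_def] at i12 i123 i1234
  rw [integral_congr_ae e, integral_add i1234 (integrable_const _),
    integral_sub i123 (i4.const_mul _), integral_sub i12 (i3.const_mul _), integral_add i1 i2,
    integral_const_mul, integral_const_mul, integral_integral_of_bind_eq (hη.measurable_factProc 2)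
    (hη.bind_factProc 2) hF hFi, integral_integral_of_bind_eq hη.measurable hη.bind_eq hpm hpi,
    integral_integral_of_bind_eq hη.measurable hη.bind_eq hφm hφ,
    integral_integral_of_bind_eq hη.measurable hη.bind_eq hψm hψ, hFe]
  simp
  ring

/-- The third moment of a nonnegative linear functional of the process, from the Campbell formulas
of orders one, two and three. -/
lemma IsPoissonProcess.lintegral_pow_three {b : X → ℝ≥0∞} (hb : Measurable b) :
    ∫⁻ ω, (∫⁻ y, b y ∂η ω) ^ 3 ∂P = (∫⁻ y, b y ∂Λ) ^ 3 +
      3 * ((∫⁻ y, b y ^ 2 ∂Λ) * ∫⁻ y, b y ∂Λ) + ∫⁻ y, b y ^ 3 ∂Λ := by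
  have hm : ∀ {n : ℕ} (j : Fin n), Measurable fun x : Fin n → X => b (x j) := fun j =>
    hb.comp (measurable_pi_apply j)
  have camp : ∀ (n : ℕ) (F : (Fin n → X) → ℝ≥0∞), Measurable F →
      ∫⁻ ω, ∫⁻ x, F x ∂factProc η Λ n ω ∂P = ∫⁻ x, F x ∂(Measure.pi fun _ => Λ) := by
    intro n F hF
    rw [← hη.bind_factProc n, Measure.lintegral_bind (hη.measurable_factProc n).aemeasurable
      hF.aemeasurable]
  have meas : ∀ (n : ℕ) (F : (Fin n → X) → ℝ≥0∞), Measurable F →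
      Measurable fun ω => ∫⁻ x, F x ∂factProc η Λ n ω := fun n F hF =>
    (Measure.measurable_lintegral hF).comp (hη.measurable_factProc n)
  have hone : ∀ c : X → ℝ≥0∞, Measurable c →
      ∫⁻ x : Fin 1 → X, c (x 0) ∂(Measure.pi fun _ => Λ) = ∫⁻ y, c y ∂Λ := by
    intro c hc
    rw [← measurePreserving_const_fin_one.lintegral_comp (measurable_comp_eval hc 0)]
  have htwo : ∀ c d : X → ℝ≥0∞, Measurable c → Measurable d →
      ∫⁻ x : Fin 2 → X, c (x 0) * d (x 1) ∂(Measure.pi fun _ => Λ) =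
        (∫⁻ y, c y ∂Λ) * ∫⁻ y, d y ∂Λ := by
    intro c d hc hd
    have h : Measurable fun x : Fin 2 → X => c (x 0) * d (x 1) :=
      (measurable_comp_eval hc 0).mul (measurable_comp_eval hd 1)
    rw [← (measurePreserving_snoc 1).lintegral_comp h]
    simp only [snoc_zero, snoc_one_one]
    rw [lintegral_prod_mul (f := fun x : Fin 1 → X => c (x 0))
      (measurable_comp_eval hc 0).aemeasurable hd.aemeasurable, hone c hc]
  have m3 : Measurable fun x : Fin 3 → X => b (x 0) * b (x 1) * b (x 2) :=
    ((hm 0).mul (hm 1)).mul (hm 2)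
  have hthree : ∫⁻ x : Fin 3 → X, b (x 0) * b (x 1) * b (x 2) ∂(Measure.pi fun _ => Λ) =
      (∫⁻ y, b y ∂Λ) ^ 3 := by
    rw [← (measurePreserving_snoc 2).lintegral_comp m3]
    simp only [snoc_zero, snoc_two_one, snoc_two_two]
    rw [lintegral_prod_mul (f := fun x : Fin 2 → X => b (x 0) * b (x 1))
      ((hm 0).mul (hm 1)).aemeasurable hb.aemeasurable, htwo b b hb hb]
    ring
  have e : (fun ω => (∫⁻ y, b y ∂η ω) ^ 3) =ᵐ[P] fun ω =>
      ∫⁻ x, b (x 0) * b (x 1) * b (x 2) ∂factProc η Λ 3 ω +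
      (2 * ∫⁻ x, b (x 0) ^ 2 * b (x 1) ∂factProc η Λ 2 ω +
        ∫⁻ x, b (x 0) * b (x 1) ^ 2 ∂factProc η Λ 2 ω) +
      ∫⁻ x, b (x 0) ^ 3 ∂factProc η Λ 1 ω := by
    filter_upwards [ae_all_iff.2 hη.ae_factProc_eq] with ω hω
    rw [hω, hω, hω, PoissonU.lintegral_pow_three (hη.isPointMeasure ω) hb]
  have m2 : Measurable fun x : Fin 2 → X => b (x 0) ^ 2 * b (x 1) :=
    ((hm 0).pow_const 2).mul (hm 1)
  have m2' : Measurable fun x : Fin 2 → X => b (x 0) * b (x 1) ^ 2 :=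
    (hm 0).mul ((hm 1).pow_const 2)
  have m1 := (hm (0 : Fin 1)).pow_const 3
  rw [lintegral_congr_ae e, lintegral_add_right _ (meas 1 _ m1), lintegral_add_left (meas 3 _ m3),
    lintegral_add_right _ (meas 2 _ m2'), lintegral_const_mul _ (meas 2 _ m2), camp 3 _ m3,
    camp 2 _ m2, camp 2 _ m2', camp 1 _ m1, hthree]
  have e1 := htwo _ _ (hb.pow_const 2) hb
  have e2 := htwo _ _ hb (hb.pow_const 2)
  have e3 := hone _ (hb.pow_const 3)
  rw [e1, e2, e3]
  ring

end Moments

/-! ### The exponential formula -/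

section CharFun

/-- The joint characteristic function of independent Poisson variables. -/
lemma integral_exp_poissonPi {r : ℕ} (ρ : Fin r → ℝ≥0) (α : Fin r → ℝ) :
    ∫ N, Complex.exp ((∑ c, α c * N c : ℝ) * Complex.I) ∂poissonPi ρ =
      Complex.exp (∑ c, ρ c * (Complex.exp (α c * Complex.I) - 1)) := by
  have h : ∀ N : Fin r → ℕ, Complex.exp ((∑ c, α c * N c : ℝ) * Complex.I) =
      ∏ c, Complex.exp ((α c * N c : ℝ) * Complex.I) := by
    intro N
    rw [← Complex.exp_sum, Complex.ofReal_sum, Finset.sum_mul]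
  simp only [h, poissonPi]
  rw [integral_fintype_prod_eq_prod (𝕜 := ℂ) (μ := fun c => poissonMeasure (ρ c))
    fun c (k : ℕ) => Complex.exp ((α c * k : ℝ) * Complex.I), Complex.exp_sum]
  refine Finset.prod_congr rfl fun c _ => ?_
  rw [← charFun_map_cast_poissonMeasure, charFun_apply_real,
    integral_map .of_discrete (by fun_prop)]
  push_cast
  rfl

lemma norm_exp_mul_I_sub_le (x y : ℝ) :
    ‖Complex.exp (x * Complex.I) - Complex.exp (y * Complex.I)‖ ≤ ‖x - y‖ := by
  have h : Complex.exp (x * Complex.I) - Complex.exp (y * Complex.I) =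
      Complex.exp (y * Complex.I) * (Complex.exp (Complex.I * (x - y : ℝ)) - 1) := by
    rw [mul_sub, ← Complex.exp_add]
    push_cast
    ring_nf
  rw [h, norm_mul, Complex.norm_exp_ofReal_mul_I, one_mul]
  exact Real.norm_exp_I_mul_ofReal_sub_one_le

lemma norm_exp_mul_I_sub_one_le (x : ℝ) : ‖Complex.exp (x * Complex.I) - 1‖ ≤ ‖x‖ := by
  simpa using norm_exp_mul_I_sub_le x 0

variable {X : Type*} [MeasurableSpace X] {Λ : Measure X}
  {Ω : Type*} [MeasurableSpace Ω] {P : Measure Ω} {η : Ω → Measure X} {φ : X → ℝ}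

lemma integrable_exp_mul_I {Y : Type*} [MeasurableSpace Y] {μ : Measure Y} [IsFiniteMeasure μ]
    {f : Y → ℝ} (hf : AEStronglyMeasurable f μ) :
    Integrable (fun y => Complex.exp (f y * Complex.I)) μ := by
  refine (integrable_const (1 : ℝ)).mono ?_ (ae_of_all _ fun y => ?_)
  · exact (Complex.measurable_exp.comp_aemeasurable ((Complex.measurable_ofReal.comp_aemeasurable
      hf.aemeasurable).mul_const Complex.I)).aestronglyMeasurable
  · rw [Complex.norm_exp_ofReal_mul_I, norm_one]

lemma integrable_exp_mul_I_sub_one {Y : Type*} [MeasurableSpace Y] {μ : Measure Y} {f : Y → ℝ}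
    (hf : Integrable f μ) : Integrable (fun y => Complex.exp (f y * Complex.I) - 1) μ := by
  refine hf.mono ?_ (ae_of_all _ fun y => norm_exp_mul_I_sub_one_le _)
  have := Complex.measurable_ofReal.comp_aemeasurable hf.1.aemeasurable
  exact (Complex.measurable_exp.comp_aemeasurable
    (this.mul_const Complex.I)).aestronglyMeasurable.sub aestronglyMeasurable_const

/-- The exponential formula for step functions. -/
lemma IsPoissonProcess.integral_exp_step [IsProbabilityMeasure P] (hη : IsPoissonProcess η Λ P)
    {r : ℕ} {C : Fin r → Set X} (hC : ∀ c, MeasurableSet (C c))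
    (hdisj : Pairwise (fun c d => Disjoint (C c) (C d))) (hfin : ∀ c, Λ (C c) < ∞) (α : Fin r → ℝ) :
    ∫ ω, Complex.exp ((∫ y, ∑ c, α c * (C c).indicator (fun _ => 1) y ∂η ω : ℝ) * Complex.I) ∂P =
      Complex.exp (∫ y, (Complex.exp ((∑ c, α c * (C c).indicator (fun _ => 1) y : ℝ) *
        Complex.I) - 1) ∂Λ) := by
  have h1 : ∀ᵐ ω ∂P, ∫ y, ∑ c, α c * (C c).indicator (fun _ => 1) y ∂η ω =
      ∑ c, α c * counts η C ω c := by
    filter_upwards [hη.ae_eq_counts hC hfin] with ω hω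
    have hi : ∀ c, Integrable (fun y => α c * (C c).indicator (fun _ => (1 : ℝ)) y) (η ω) :=
      fun c => ((integrable_indicator_iff (hC c)).2 (integrableOn_const
        ((hω c).symm ▸ ENNReal.natCast_ne_top _))).const_mul _
    rw [integral_finsetSum _ fun c _ => hi c]
    refine Finset.sum_congr rfl fun c _ => ?_
    rw [integral_const_mul, integral_indicator (hC c)]
    simp [Measure.real, hω c]
  have h2 : ∀ y, Complex.exp ((∑ c, α c * (C c).indicator (fun _ => 1) y : ℝ) * Complex.I) - 1 =
      ∑ c, (C c).indicator (fun _ => Complex.exp (α c * Complex.I) - 1) y := by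
    intro y
    by_cases hy : ∃ c, y ∈ C c
    · obtain ⟨c, hc⟩ := hy
      have hne : ∀ d ≠ c, y ∉ C d := fun d hd h => (hdisj hd).notMem_of_mem_left h hc
      rw [Finset.sum_eq_single c (fun d _ hd => by simp [hne d hd]) (by simp),
        Finset.sum_eq_single c (fun d _ hd => by simp [hne d hd]) (by simp)]
      simp [hc]
    · simp only [not_exists] at hy
      simp [hy]
  have h3 : ∫ ω, Complex.exp ((∑ c, α c * counts η C ω c : ℝ) * Complex.I) ∂P =
      ∫ N, Complex.exp ((∑ c, α c * N c : ℝ) * Complex.I) ∂poissonPi fun c =>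
        (Λ (C c)).toNNReal := by
    rw [← hη.map_counts hC hdisj hfin, integral_map (hη.measurable_counts hC).aemeasurable
      (measurable_of_countable _).aestronglyMeasurable]
  have h4 : (fun ω => Complex.exp ((∫ y, ∑ c, α c * (C c).indicator (fun _ => 1) y ∂η ω : ℝ) *
      Complex.I)) =ᵐ[P] fun ω => Complex.exp ((∑ c, α c * counts η C ω c : ℝ) * Complex.I) := by
    filter_upwards [h1] with ω hω
    rw [hω]
  rw [integral_congr_ae h4, h3, integral_exp_poissonPi]
  simp only [h2]
  rw [integral_finsetSum _ fun c _ => (integrable_indicator_iff (hC c)).2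
    (integrableOn_const (hfin c).ne)]
  congr 1
  refine Finset.sum_congr rfl fun c _ => ?_
  rw [integral_indicator (hC c), setIntegral_const, Complex.real_smul]
  rfl

variable [SigmaFinite Λ]

lemma exists_step {φ : X → ℝ} (hφm : Measurable φ) (hφ : Integrable φ Λ) (hφ2 : MemLp φ 2 Λ)
    {ε : ℝ≥0∞} (hε : ε ≠ 0) :
    ∃ (r : ℕ) (C : Fin r → Set X) (α : Fin r → ℝ), (∀ c, MeasurableSet (C c)) ∧
      Pairwise (fun c d => Disjoint (C c) (C d)) ∧ (∀ c, Λ (C c) < ∞) ∧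
      eLpNorm (fun y => φ y - ∑ c, α c * (C c).indicator (fun _ => 1) y) 1 Λ ≤ ε := by
  have hmp : MemLp (fun x : Fin 1 → X => φ (x 0)) 2 (Measure.pi fun _ => Λ) := by
    rw [← (measurePreserving_const_fin_one (Λ := Λ)).map_eq,
      memLp_map_measure_iff (measurable_comp_eval hφm 0).aestronglyMeasurable
        measurable_const_fin_one.aemeasurable]
    exact hφ2
  obtain ⟨r, C, a, hC, hdisj, hfin, -, h1, -⟩ := (isSymmKernel_one hφm hφ).exists_gridFun hmp hε
  refine ⟨r, C, fun c => a fun _ => c, hC, hdisj, hfin, le_trans (le_of_eq ?_) h1⟩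
  have hg : Measurable ((fun x : Fin 1 → X => φ (x 0)) - gridFun C a) :=
    (measurable_comp_eval hφm 0).sub (measurable_gridFun hC a)
  rw [← eLpNorm_comp_measurePreserving hg.aestronglyMeasurable
    (measurePreserving_const_fin_one (Λ := Λ))]
  congr 1
  funext y
  simp only [Function.comp_apply, Pi.sub_apply, gridFun]
  rw [← (Equiv.funUnique (Fin 1) (Fin r)).symm.sum_comp]
  congr 1
  refine Finset.sum_congr rfl fun c _ => ?_
  change _ = a (fun _ => c) * (cell C fun _ => c).indicator (fun _ => 1) fun _ => y
  congr 1
  by_cases hy : y ∈ C c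
  · rw [indicator_of_mem hy, indicator_of_mem (mem_cell.2 fun _ => hy)]
  · rw [indicator_of_notMem hy, indicator_of_notMem fun h => hy (mem_cell.1 h 0)]

/-- The exponential formula for the characteristic functional, by approximation with step functions
in `L¹`: both sides are Lipschitz continuous in `φ` because `x ↦ exp (i x)` is. -/
lemma IsPoissonProcess.integral_exp [IsProbabilityMeasure P] (hη : IsPoissonProcess η Λ P)
    (hφm : Measurable φ) (hφ : Integrable φ Λ) (hφ2 : MemLp φ 2 Λ) :
    ∫ ω, Complex.exp ((∫ y, φ y ∂η ω : ℝ) * Complex.I) ∂P =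
      Complex.exp (∫ y, (Complex.exp (φ y * Complex.I) - 1) ∂Λ) := by
  have hpos : ∀ k : ℕ, ((k : ℝ≥0∞) + 1)⁻¹ ≠ 0 := fun k =>
    ENNReal.inv_ne_zero.2 (by finiteness)
  choose r C α hC hdisj hfin happ using fun k : ℕ => exists_step hφm hφ hφ2 (hpos k)
  set s : ℕ → X → ℝ := fun k y => ∑ c, α k c * (C k c).indicator (fun _ => 1) y with hs
  have hsm : ∀ k, Measurable (s k) := fun k => Finset.measurable_fun_sum _ fun c _ =>
    (measurable_const.indicator (hC k c)).const_mul _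
  have hsi : ∀ k, Integrable (s k) Λ := fun k => integrable_finsetSum _ fun c _ =>
    ((integrable_indicator_iff (hC k c)).2 (integrableOn_const (hfin k c).ne)).const_mul _
  have hlim : Tendsto (fun k => ∫ y, ‖s k y - φ y‖ ∂Λ) atTop (𝓝 0) := by
    have h0 : Tendsto (fun k : ℕ => ((k : ℝ≥0∞) + 1)⁻¹) atTop (𝓝 0) := by
      have := (tendsto_add_atTop_iff_nat (f := fun k : ℕ => (k : ℝ≥0∞)⁻¹) 1).2
        ENNReal.tendsto_inv_nat_nhds_zero
      exact_mod_cast this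
    have h1 := (ENNReal.tendsto_toReal ENNReal.zero_ne_top).comp
      (tendsto_of_tendsto_of_tendsto_of_le_of_le tendsto_const_nhds h0 (fun _ => zero_le) happ)
    refine h1.congr fun k => ?_
    have h2 := integral_norm_eq_lintegral_enorm ((hsi k).sub hφ).1
    simp only [Pi.sub_apply] at h2
    rw [Function.comp_apply, eLpNorm_one_eq_lintegral_enorm, h2]
    congr 1
    exact lintegral_congr fun y => enorm_sub_rev _ _
  have hL : Tendsto (fun k => ∫ ω, Complex.exp ((∫ y, s k y ∂η ω : ℝ) * Complex.I) ∂P) atTop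
      (𝓝 (∫ ω, Complex.exp ((∫ y, φ y ∂η ω : ℝ) * Complex.I) ∂P)) := by
    rw [tendsto_iff_norm_sub_tendsto_zero]
    refine squeeze_zero (fun _ => norm_nonneg _) (fun k => ?_) hlim
    have hdm : Measurable fun y => ‖s k y - φ y‖ := ((hsm k).sub hφm).norm
    have hdi : Integrable (fun y => ‖s k y - φ y‖) Λ := ((hsi k).sub hφ).norm
    have hA : ∀ {f : X → ℝ}, Measurable f → Integrable f Λ →
        Integrable (fun ω => Complex.exp ((∫ y, f y ∂η ω : ℝ) * Complex.I)) P := fun hfm hf =>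
      integrable_exp_mul_I
        (aestronglyMeasurable_integral_of_bind_eq hη.measurable hη.bind_eq hfm hf)
    rw [← integral_sub (hA (hsm k) (hsi k)) (hA hφm hφ),
      ← integral_integral_of_bind_eq hη.measurable hη.bind_eq hdm hdi]
    refine norm_integral_le_of_norm_le
      (integrable_integral_of_bind_eq hη.measurable hη.bind_eq hdm hdi) ?_
    filter_upwards [hη.ae_integrable (hsm k) (hsi k), hη.ae_integrable hφm hφ] with ω h1 h2
    refine (norm_exp_mul_I_sub_le _ _).trans ?_
    rw [← integral_sub h1 h2]
    exact norm_integral_le_integral_norm _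
  have hR : Tendsto (fun k => ∫ y, (Complex.exp (s k y * Complex.I) - 1) ∂Λ) atTop
      (𝓝 (∫ y, (Complex.exp (φ y * Complex.I) - 1) ∂Λ)) := by
    rw [tendsto_iff_norm_sub_tendsto_zero]
    refine squeeze_zero (fun _ => norm_nonneg _) (fun k => ?_) hlim
    rw [← integral_sub (integrable_exp_mul_I_sub_one (hsi k)) (integrable_exp_mul_I_sub_one hφ)]
    refine norm_integral_le_of_norm_le ((hsi k).sub hφ).norm (ae_of_all _ fun y => ?_)
    rw [sub_sub_sub_cancel_right]
    exact norm_exp_mul_I_sub_le _ _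
  refine tendsto_nhds_unique hL ?_
  refine ((Complex.continuous_exp.tendsto _).comp hR).congr fun k => ?_
  exact (hη.integral_exp_step (hC k) (hdisj k) (hfin k) (α k)).symm

/-- The characteristic function of a linear functional of the compensated process. -/
lemma IsPoissonProcess.integral_exp_firstChaos [IsProbabilityMeasure P]
    (hη : IsPoissonProcess η Λ P) (hφm : Measurable φ) (hφ : Integrable φ Λ) (hφ2 : MemLp φ 2 Λ) :
    ∫ ω, Complex.exp (firstChaos η Λ φ ω * Complex.I) ∂P =
      Complex.exp
        (∫ y, (Complex.exp (φ y * Complex.I) - 1) ∂Λ - (∫ y, φ y ∂Λ : ℝ) * Complex.I) := by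
  have h : ∀ ω, Complex.exp (firstChaos η Λ φ ω * Complex.I) =
      Complex.exp ((∫ y, φ y ∂η ω : ℝ) * Complex.I) *
        Complex.exp (-((∫ y, φ y ∂Λ : ℝ) * Complex.I)) := by
    intro ω
    rw [← Complex.exp_add, firstChaos]
    push_cast
    ring_nf
  simp only [h]
  rw [integral_mul_const, hη.integral_exp hφm hφ hφ2, ← Complex.exp_add, sub_eq_add_neg]

end CharFun

/-! ### Third moments of compensated integrals -/

section ThirdMoment

variable {X : Type*} [MeasurableSpace X] {Λ : Measure X} [SigmaFinite Λ]
  {Ω : Type*} [MeasurableSpace Ω] {P : Measure Ω} {η : Ω → Measure X} {φ : X → ℝ}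

/-- An upper bound for the `L³` norm of a linear functional of a compensated Poisson process. -/
noncomputable def cubeBound (Λ : Measure X) (φ : X → ℝ) : ℝ≥0∞ :=
  ((∫⁻ y, ‖φ y‖ₑ ∂Λ) ^ 3 + 3 * ((∫⁻ y, ‖φ y‖ₑ ^ 2 ∂Λ) * ∫⁻ y, ‖φ y‖ₑ ∂Λ) +
    ∫⁻ y, ‖φ y‖ₑ ^ 3 ∂Λ) ^ (1 / 3 : ℝ) + ∫⁻ y, ‖φ y‖ₑ ∂Λ

/-- Monotonicity makes the bound uniform over all intensity measures below a given one. -/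
lemma cubeBound_mono {Λ' : Measure X} (h : Λ ≤ Λ') (φ : X → ℝ) :
    cubeBound Λ φ ≤ cubeBound Λ' φ := by
  unfold cubeBound
  gcongr

lemma cubeBound_lt_top (hφ : Integrable φ Λ) (hφ2 : MemLp φ 2 Λ) (hφ3 : MemLp φ 3 Λ) :
    cubeBound Λ φ < ∞ := by
  have h1 : ∫⁻ y, ‖φ y‖ₑ ∂Λ ≠ ∞ := hφ.2.ne
  have h2 : ∫⁻ y, ‖φ y‖ₑ ^ 2 ∂Λ ≠ ∞ := by
    have := lintegral_rpow_enorm_lt_top_of_eLpNorm_lt_top two_ne_zero ENNReal.ofNat_ne_top hφ2.2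
    simpa using this.ne
  have h3 : ∫⁻ y, ‖φ y‖ₑ ^ 3 ∂Λ ≠ ∞ := by
    have := lintegral_rpow_enorm_lt_top_of_eLpNorm_lt_top three_ne_zero ENNReal.ofNat_ne_top hφ3.2
    simpa using this.ne
  unfold cubeBound
  finiteness

lemma IsPoissonProcess.eLpNorm_three_firstChaos_le [IsProbabilityMeasure P]
    (hη : IsPoissonProcess η Λ P) (hφm : Measurable φ) (hφ : Integrable φ Λ) :
    eLpNorm (firstChaos η Λ φ) 3 P ≤ cubeBound Λ φ := by
  have h1 : eLpNorm (fun ω => ∫ y, φ y ∂η ω) 3 P ≤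
      (∫⁻ ω, (∫⁻ y, ‖φ y‖ₑ ∂η ω) ^ 3 ∂P) ^ (1 / 3 : ℝ) := by
    rw [eLpNorm_eq_lintegral_rpow_enorm_toReal three_ne_zero ENNReal.ofNat_ne_top]
    simp only [ENNReal.toReal_ofNat, ENNReal.rpow_ofNat]
    gcongr with ω
    exact enorm_integral_le_lintegral_enorm _
  have h2 : eLpNorm (fun _ : Ω => ∫ y, φ y ∂Λ) 3 P ≤ ∫⁻ y, ‖φ y‖ₑ ∂Λ := by
    rw [eLpNorm_const _ three_ne_zero (IsProbabilityMeasure.ne_zero P)]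
    simpa using enorm_integral_le_lintegral_enorm φ
  rw [hη.lintegral_pow_three hφm.enorm] at h1
  exact (eLpNorm_sub_le (aestronglyMeasurable_integral_of_bind_eq hη.measurable hη.bind_eq hφm hφ)
    aestronglyMeasurable_const (by norm_num)).trans (add_le_add h1 h2)

end ThirdMoment

/-! ### Smooth test functions -/

section Smooth

variable {l : ℕ}

/-- Three times continuously differentiable functions with second and third derivative bounded by
`M` in operator norm. Unlike the class `testFunctions`, this condition does not refer to a basis. -/
def HasBoundedDerivs (M : ℝ) (h : EuclideanSpace ℝ (Fin l) → ℝ) : Prop :=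
  ContDiff ℝ 3 h ∧ (∀ x, ‖iteratedFDeriv ℝ 2 h x‖ ≤ M) ∧ ∀ x, ‖iteratedFDeriv ℝ 3 h x‖ ≤ M

lemma eq_sum_smul_basisVec (v : EuclideanSpace ℝ (Fin l)) : v = ∑ j, v j • basisVec j := by
  ext i
  simp [Finset.sum_apply, Pi.single_apply]

/-- A multilinear form with values at most `1` on the standard basis is a sum of `l ^ n` forms of
norm at most `1`. -/
lemma norm_le_of_apply_basisVec_le {n : ℕ}
    (f : ContinuousMultilinearMap ℝ (fun _ : Fin n => EuclideanSpace ℝ (Fin l)) ℝ)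
    (hf : ∀ r : Fin n → Fin l, |f fun i => basisVec (r i)| ≤ 1) : ‖f‖ ≤ (l : ℝ) ^ n := by
  refine ContinuousMultilinearMap.opNorm_le_bound (by positivity) fun v => ?_
  have h1 : f v = ∑ r : Fin n → Fin l, (∏ i, v i (r i)) * f fun i => basisVec (r i) := by
    conv_lhs => rw [show v = fun i => ∑ j, v i j • basisVec j from
      funext fun i => eq_sum_smul_basisVec (v i)]
    rw [f.map_sum]
    refine Finset.sum_congr rfl fun r _ => ?_
    rw [f.map_smul_univ (fun i => v i (r i)), smul_eq_mul]
  rw [h1]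
  refine (norm_sum_le _ _).trans ?_
  have h2 : ∀ r : Fin n → Fin l, ‖(∏ i, v i (r i)) * f fun i => basisVec (r i)‖ ≤ ∏ i, ‖v i‖ := by
    intro r
    rw [norm_mul, norm_prod]
    calc _ ≤ (∏ i, ‖v i‖) * 1 := by
          gcongr with i
          · exact PiLp.norm_apply_le (v i) (r i)
          · exact hf r
      _ = _ := mul_one _
  refine (Finset.sum_le_sum fun r _ => h2 r).trans (le_of_eq ?_)
  simp

lemma iteratedFDeriv_two_swap {h : EuclideanSpace ℝ (Fin l) → ℝ} {n : ℕ} (hn : 2 ≤ n)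
    (hh : ContDiff ℝ n h) (x u v : EuclideanSpace ℝ (Fin l)) :
    iteratedFDeriv ℝ 2 h x ![u, v] = iteratedFDeriv ℝ 2 h x ![v, u] := by
  have := (hh.contDiffAt (x := x)).isSymmSndFDerivAt (by simpa using hn)
  simpa [iteratedFDeriv_two_apply] using this.eq u v

lemma iteratedFDeriv_three_swap_right {h : EuclideanSpace ℝ (Fin l) → ℝ} (hh : ContDiff ℝ 3 h)
    (x u v w : EuclideanSpace ℝ (Fin l)) :
    iteratedFDeriv ℝ 3 h x ![u, v, w] = iteratedFDeriv ℝ 3 h x ![u, w, v] := by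
  have hd : DifferentiableAt ℝ (iteratedFDeriv ℝ 2 h) x :=
    (hh.differentiable_iteratedFDeriv (by norm_num)) x
  rw [hd.iteratedFDeriv_succ_apply_left', hd.iteratedFDeriv_succ_apply_left']
  have e : (fun y => iteratedFDeriv ℝ 2 h y (Fin.tail ![u, v, w])) =
      fun y => iteratedFDeriv ℝ 2 h y (Fin.tail ![u, w, v]) :=
    funext fun y => iteratedFDeriv_two_swap (n := 3) (by norm_num) hh y v w
  rw [e]
  rfl

lemma iteratedFDeriv_three_swap_left {h : EuclideanSpace ℝ (Fin l) → ℝ} (hh : ContDiff ℝ 3 h)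
    (x u v w : EuclideanSpace ℝ (Fin l)) :
    iteratedFDeriv ℝ 3 h x ![u, v, w] = iteratedFDeriv ℝ 3 h x ![v, u, w] := by
  have h2 : ContDiff ℝ 2 (fderiv ℝ h) := hh.fderiv_right (by norm_num)
  have hs := (h2.contDiffAt (x := x)).isSymmSndFDerivAt (by simp)
  have e : ∀ a b, iteratedFDeriv ℝ 3 h x ![a, b, w] =
      fderiv ℝ (fderiv ℝ (fderiv ℝ h)) x a b w := by
    intro a b
    rw [iteratedFDeriv_succ_apply_right, iteratedFDeriv_two_apply]
    rfl
  rw [e, e, hs.eq u v]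

/-- The test class bounds the partial derivatives for ordered indices only; symmetry of the
derivatives covers all indices. The constant dominates both `l ^ 2` and `l ^ 3`. -/
lemma hasBoundedDerivs_of_mem_testFunctions {h : EuclideanSpace ℝ (Fin l) → ℝ}
    (hh : h ∈ testFunctions l) : HasBoundedDerivs ((l + 1 : ℝ) ^ 3) h := by
  obtain ⟨hc, h2, h3⟩ := hh
  have h2' : ∀ i j x, |iteratedFDeriv ℝ 2 h x ![basisVec i, basisVec j]| ≤ 1 := by
    intro i j x
    rcases le_total i j with hij | hij
    · exact h2 i j hij x
    · rw [iteratedFDeriv_two_swap (n := 3) (by norm_num) hc]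
      exact h2 j i hij x
  have h3' : ∀ i j k x,
      |iteratedFDeriv ℝ 3 h x ![basisVec i, basisVec j, basisVec k]| ≤ 1 := by
    have hl := fun x u v w => iteratedFDeriv_three_swap_left hc x u v w
    have hr := fun x u v w => iteratedFDeriv_three_swap_right hc x u v w
    intro i j k x
    rcases le_total i j with hij | hij <;> rcases le_total j k with hjk | hjk <;>
      rcases le_total i k with hik | hik
    · exact h3 i j k hij hjk x
    · exact h3 i j k hij hjk x
    · rw [hr]; exact h3 i k j hik hjk x
    · rw [hr, hl]; exact h3 k i j hik hij x
    · rw [hl]; exact h3 j i k hij hik x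
    · rw [hl, hr]; exact h3 j k i hjk hik x
    · rw [hr, hl, hr]; exact h3 k j i hjk hij x
    · rw [hr, hl, hr]; exact h3 k j i hjk hij x
  have hl : (0 : ℝ) ≤ l := Nat.cast_nonneg l
  refine ⟨hc, fun x => (norm_le_of_apply_basisVec_le _ fun r => ?_).trans ?_,
    fun x => (norm_le_of_apply_basisVec_le _ fun r => ?_).trans ?_⟩
  · convert h2' (r 0) (r 1) x using 3
    funext i
    fin_cases i <;> rfl
  · calc (l : ℝ) ^ 2 ≤ (l + 1 : ℝ) ^ 2 := by gcongr; linarith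
      _ ≤ (l + 1 : ℝ) ^ 3 := pow_le_pow_right₀ (by linarith) (by norm_num)
  · convert h3' (r 0) (r 1) (r 2) x using 3
    funext i
    fin_cases i <;> rfl
  · gcongr
    linarith

variable {M : ℝ} {h : EuclideanSpace ℝ (Fin l) → ℝ}

lemma HasBoundedDerivs.translate (hh : HasBoundedDerivs M h) (w : EuclideanSpace ℝ (Fin l)) :
    HasBoundedDerivs M fun x => h (w + x) := by
  refine ⟨hh.1.comp (contDiff_const.add contDiff_id), fun x => ?_, fun x => ?_⟩
  · rw [iteratedFDeriv_comp_add_left]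
    exact hh.2.1 _
  · rw [iteratedFDeriv_comp_add_left]
    exact hh.2.2 _

lemma norm_integral_taylor_remainder_le {n : ℕ} {M : ℝ}
    (hM : ∀ x, ‖iteratedFDeriv ℝ (n + 1) h x‖ ≤ M) (w y : EuclideanSpace ℝ (Fin l)) :
    ‖∫ t in (0 : ℝ)..1, (1 - t) ^ n • iteratedFDeriv ℝ (n + 1) h (w + t • y) (fun _ => y)‖ ≤
      M * ‖y‖ ^ (n + 1) := by
  have h1 := intervalIntegral.norm_integral_le_of_norm_le_const (a := (0 : ℝ)) (b := 1)
    (f := fun t => (1 - t) ^ n • iteratedFDeriv ℝ (n + 1) h (w + t • y) (fun _ => y))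
    (C := M * ‖y‖ ^ (n + 1)) fun t ht => ?_
  · simpa using h1
  rw [uIoc_of_le zero_le_one] at ht
  have h2 : ‖(1 - t) ^ n‖ ≤ 1 := by
    rw [norm_pow]
    refine pow_le_one₀ (norm_nonneg _) ?_
    rw [Real.norm_of_nonneg (by linarith [ht.2])]
    linarith [ht.1]
  have h3 : ‖iteratedFDeriv ℝ (n + 1) h (w + t • y) (fun _ => y)‖ ≤ M * ‖y‖ ^ (n + 1) := by
    refine (ContinuousMultilinearMap.le_opNorm _ _).trans ?_
    rw [Finset.prod_const, Finset.card_univ, Fintype.card_fin]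
    gcongr
    exact hM _
  rw [norm_smul]
  exact (mul_le_of_le_one_left (norm_nonneg _) h2).trans h3

lemma HasBoundedDerivs.taylor_two (hh : HasBoundedDerivs M h) (w y : EuclideanSpace ℝ (Fin l)) :
    |h (w + y) - h w - fderiv ℝ h w y| ≤ M * ‖y‖ ^ 2 := by
  have h1 := map_add_eq_sum_add_integral_iteratedFDeriv (f := h) (x := w) (y := y) (n := 1)
    fun t _ => hh.1.contDiffAt.of_le (by norm_num)
  have h2 := norm_integral_taylor_remainder_le (n := 1) hh.2.1 w y
  simp only [Finset.sum_range_succ, Finset.range_zero, Finset.sum_empty, zero_add,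
    Nat.factorial_zero, Nat.factorial_one, Nat.cast_one, inv_one, one_smul,
    iteratedFDeriv_zero_apply, iteratedFDeriv_one_apply, Nat.reduceAdd] at h1
  rw [h1, add_assoc, add_sub_cancel_left, add_sub_cancel_left]
  exact h2

lemma HasBoundedDerivs.taylor_three (hh : HasBoundedDerivs M h)
    (w y : EuclideanSpace ℝ (Fin l)) :
    |h (w + y) - (h w + fderiv ℝ h w y + 2⁻¹ * iteratedFDeriv ℝ 2 h w fun _ => y)| ≤
      M * ‖y‖ ^ 3 := by
  have h1 := map_add_eq_sum_add_integral_iteratedFDeriv (f := h) (x := w) (y := y) (n := 2)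
    fun t _ => hh.1.contDiffAt.of_le (by norm_num)
  have h2 := norm_integral_taylor_remainder_le (n := 2) hh.2.2 w y
  simp only [Finset.sum_range_succ, Finset.range_zero, Finset.sum_empty, zero_add,
    Nat.factorial_zero, Nat.factorial_one, Nat.factorial_two, Nat.cast_one, Nat.cast_ofNat, inv_one,
    one_mul, iteratedFDeriv_zero_apply, iteratedFDeriv_one_apply, Nat.reduceAdd, smul_eq_mul] at h1
  rw [h1, add_sub_cancel_left, abs_mul]
  refine (mul_le_of_le_one_left (abs_nonneg _) ?_).trans h2
  norm_num [abs_le]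

/-- Increments of `h` compared with the derivative at the origin, which differs from the derivative
at `y` by at most `M ‖y‖`. -/
lemma HasBoundedDerivs.abs_sub_sub_le (hh : HasBoundedDerivs M h)
    (y r : EuclideanSpace ℝ (Fin l)) :
    |h (y + r) - h y - fderiv ℝ h 0 r| ≤ M * ((‖y‖ + ‖r‖) * ‖r‖) := by
  have h1 := hh.taylor_two y r
  have h2 : ‖fderiv ℝ h y - fderiv ℝ h 0‖ ≤ M * ‖y - 0‖ := by
    refine convex_univ.norm_image_sub_le_of_norm_fderiv_le (𝕜 := ℝ)
      (fun x _ => (hh.1.fderiv_right (m := 2) (by norm_num)).differentiable (by norm_num) x)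
      (fun x _ => ?_) (mem_univ _) (mem_univ _)
    rw [← norm_iteratedFDeriv_one, norm_iteratedFDeriv_fderiv]
    exact hh.2.1 x
  rw [sub_zero] at h2
  have h3 : |(fderiv ℝ h y - fderiv ℝ h 0) r| ≤ M * ‖y‖ * ‖r‖ :=
    ((fderiv ℝ h y - fderiv ℝ h 0).le_opNorm r).trans (by gcongr)
  have e : h (y + r) - h y - fderiv ℝ h 0 r =
      (h (y + r) - h y - fderiv ℝ h y r) + (fderiv ℝ h y - fderiv ℝ h 0) r := by
    rw [sub_apply]
    ring
  rw [e]
  refine (abs_add_le _ _).trans ((add_le_add h1 h3).trans (le_of_eq ?_))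
  ring

/-- Functions with bounded second derivative grow at most quadratically. -/
lemma HasBoundedDerivs.integrable (hh : HasBoundedDerivs M h)
    {μ : Measure (EuclideanSpace ℝ (Fin l))} [IsFiniteMeasure μ] (hμ : MemLp id 2 μ) :
    Integrable h μ := by
  have h1 : Integrable (fun x : EuclideanSpace ℝ (Fin l) => ‖x‖) μ :=
    (hμ.integrable one_le_two).norm
  have h2 : Integrable (fun x : EuclideanSpace ℝ (Fin l) => ‖x‖ ^ 2) μ := by
    simpa using hμ.integrable_norm_pow (by norm_num)
  refine (((integrable_const |h 0|).add (h1.const_mul ‖fderiv ℝ h 0‖)).add (h2.const_mul M)).mono'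
    hh.1.continuous.aestronglyMeasurable (ae_of_all _ fun x => ?_)
  have h3 := hh.taylor_two 0 x
  rw [zero_add] at h3
  have h4 : |fderiv ℝ h 0 x| ≤ ‖fderiv ℝ h 0‖ * ‖x‖ := (fderiv ℝ h 0).le_opNorm x
  have e : h x = (h x - h 0 - fderiv ℝ h 0 x) + (h 0 + fderiv ℝ h 0 x) := by ring
  rw [e, Real.norm_eq_abs]
  have h5 := abs_add_le (h x - h 0 - fderiv ℝ h 0 x) (h 0 + fderiv ℝ h 0 x)
  have h6 := abs_add_le (h 0) (fderiv ℝ h 0 x)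
  simp only [Pi.add_apply]
  linarith

end Smooth

/-! ### Replacing the summands of a convolution power -/

section Lindeberg

variable {l : ℕ} {μ ν : Measure (EuclideanSpace ℝ (Fin l))} {M : ℝ}
  {h : EuclideanSpace ℝ (Fin l) → ℝ}

/-- Equality of the first and second order mixed moments. -/
def SameMoments (μ ν : Measure (EuclideanSpace ℝ (Fin l))) : Prop :=
  (∀ i, ∫ x, x i ∂μ = ∫ x, x i ∂ν) ∧ ∀ i j, ∫ x, x i * x j ∂μ = ∫ x, x i * x j ∂ν

lemma memLp_apply_of_memLp_id {p : ℝ≥0∞} (hμ : MemLp id p μ) (i : Fin l) :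
    MemLp (fun x => x i) p μ :=
  hμ.of_le ((EuclideanSpace.proj (𝕜 := ℝ) i).continuous.aestronglyMeasurable)
    (ae_of_all _ fun x => PiLp.norm_apply_le x i)

lemma integrable_integral_linear_apply [IsFiniteMeasure μ] (hμ : MemLp id 2 μ)
    (A : EuclideanSpace ℝ (Fin l) →L[ℝ] ℝ) :
    Integrable (fun x => A x) μ ∧ ∫ x, A x ∂μ = ∑ i, (∫ x, x i ∂μ) * A (basisVec i) := by
  have hA : ∀ x, A x = ∑ i, x i * A (basisVec i) := by
    intro x
    conv_lhs => rw [eq_sum_smul_basisVec x]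
    simp only [map_sum, map_smul, smul_eq_mul]
  have hi : ∀ i, Integrable (fun x : EuclideanSpace ℝ (Fin l) => x i * A (basisVec i)) μ := fun i =>
    ((memLp_apply_of_memLp_id hμ i).integrable one_le_two).mul_const _
  refine ⟨(integrable_finsetSum _ fun i _ => hi i).congr (ae_of_all _ fun x => (hA x).symm), ?_⟩
  rw [integral_congr_ae (ae_of_all _ hA), integral_finsetSum _ fun i _ => hi i]
  simp only [integral_mul_const]

lemma integrable_integral_bilin_apply (hμ : MemLp id 2 μ)
    (B : ContinuousMultilinearMap ℝ (fun _ : Fin 2 => EuclideanSpace ℝ (Fin l)) ℝ) :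
    Integrable (fun x => B fun _ => x) μ ∧ ∫ x, (B fun _ => x) ∂μ =
      ∑ r : Fin 2 → Fin l, (∫ x, x (r 0) * x (r 1) ∂μ) * B fun i => basisVec (r i) := by
  have hB : ∀ x, (B fun _ => x) =
      ∑ r : Fin 2 → Fin l, x (r 0) * x (r 1) * B fun i => basisVec (r i) := by
    intro x
    conv_lhs => rw [show (fun _ => x) = fun _ : Fin 2 => ∑ j, x j • basisVec j from
      funext fun _ => eq_sum_smul_basisVec x]
    rw [B.map_sum]
    refine Finset.sum_congr rfl fun r _ => ?_
    rw [B.map_smul_univ (fun i => x (r i)), Fin.prod_univ_two, smul_eq_mul]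
  have hi : ∀ r : Fin 2 → Fin l, Integrable (fun x : EuclideanSpace ℝ (Fin l) =>
      x (r 0) * x (r 1) * B fun i => basisVec (r i)) μ := fun r =>
    ((memLp_apply_of_memLp_id hμ (r 0)).integrable_mul
      (memLp_apply_of_memLp_id hμ (r 1))).mul_const _
  simp only [hB]
  refine ⟨integrable_finsetSum _ fun r _ => hi r, ?_⟩
  rw [integral_finsetSum _ fun r _ => hi r]
  simp only [integral_mul_const]

/-- For two laws with the same first and second moments, the second order Taylor polynomial of `h`
at the origin has the same expectation, so that only third order remainders contribute. -/
lemma HasBoundedDerivs.abs_integral_sub_le [IsProbabilityMeasure μ] [IsProbabilityMeasure ν]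
    (hh : HasBoundedDerivs M h) (hμ : MemLp id 3 μ) (hν : MemLp id 3 ν) (hμν : SameMoments μ ν) :
    |∫ x, h x ∂μ - ∫ x, h x ∂ν| ≤ M * (∫ x, ‖x‖ ^ 3 ∂μ + ∫ x, ‖x‖ ^ 3 ∂ν) := by
  set T : EuclideanSpace ℝ (Fin l) → ℝ := fun y =>
    h 0 + fderiv ℝ h 0 y + 2⁻¹ * iteratedFDeriv ℝ 2 h 0 fun _ => y with hT
  have h23 : (2 : ℝ≥0∞) ≤ 3 := by norm_num
  have key : ∀ (κ : Measure (EuclideanSpace ℝ (Fin l))) [IsProbabilityMeasure κ], MemLp id 3 κ →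
      |∫ x, h x ∂κ - ∫ x, T x ∂κ| ≤ M * ∫ x, ‖x‖ ^ 3 ∂κ ∧ ∫ x, T x ∂κ =
        h 0 + ∑ i, (∫ x, x i ∂κ) * fderiv ℝ h 0 (basisVec i) +
        2⁻¹ * ∑ r : Fin 2 → Fin l, (∫ x, x (r 0) * x (r 1) ∂κ) *
          iteratedFDeriv ℝ 2 h 0 fun i => basisVec (r i) := by
    intro κ _ hκ
    have hκ2 : MemLp id 2 κ := hκ.mono_exponent h23
    obtain ⟨i1, e1⟩ := integrable_integral_linear_apply hκ2 (fderiv ℝ h 0)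
    obtain ⟨i2, e2⟩ := integrable_integral_bilin_apply hκ2 (iteratedFDeriv ℝ 2 h 0)
    have i3 : Integrable T κ := ((integrable_const _).add i1).add (i2.const_mul _)
    constructor
    · have hn : Integrable (fun x : EuclideanSpace ℝ (Fin l) => ‖x‖ ^ 3) κ := by
        simpa using hκ.integrable_norm_pow (by norm_num)
      rw [← integral_sub (hh.integrable hκ2) i3, ← integral_const_mul, ← Real.norm_eq_abs]
      refine norm_integral_le_of_norm_le (hn.const_mul M) (ae_of_all _ fun x => ?_)
      have := hh.taylor_three 0 x
      rwa [zero_add] at this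
    · have i4 := (integrable_const (μ := κ) (h 0)).add i1
      simp only [Pi.add_def] at i4
      simp only [hT]
      rw [← e1, ← e2, integral_add i4 (i2.const_mul _), integral_add (integrable_const _) i1,
        integral_const_mul]
      simp
  obtain ⟨a1, b1⟩ := key μ hμ
  obtain ⟨a2, b2⟩ := key ν hν
  have e : ∫ x, T x ∂μ = ∫ x, T x ∂ν := by
    rw [b1, b2]
    simp only [hμν.1, hμν.2]
  rw [e] at a1
  rw [abs_sub_comm] at a2
  rw [mul_add]
  exact (abs_sub_le _ _ _).trans (add_le_add a1 a2)

/-- The convolution powers of a measure. -/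
noncomputable def convPow (μ : Measure (EuclideanSpace ℝ (Fin l))) :
    ℕ → Measure (EuclideanSpace ℝ (Fin l))
  | 0 => Measure.dirac 0
  | n + 1 => Measure.conv (convPow μ n) μ

instance isProbabilityMeasure_convPow [IsProbabilityMeasure μ] (n : ℕ) :
    IsProbabilityMeasure (convPow μ n) := by
  induction n with
  | zero => exact Measure.dirac.isProbabilityMeasure
  | succ n ih =>
    unfold convPow
    infer_instance

lemma charFun_convPow [IsProbabilityMeasure μ] (n : ℕ) (u : EuclideanSpace ℝ (Fin l)) :
    charFun (convPow μ n) u = charFun μ u ^ n := by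
  induction n with
  | zero => simp [convPow]
  | succ n ih => rw [convPow, charFun_conv, ih, pow_succ]

lemma memLp_conv [IsProbabilityMeasure μ] [IsProbabilityMeasure ν] {p : ℝ≥0∞}
    (hμ : MemLp id p μ) (hν : MemLp id p ν) : MemLp id p (Measure.conv μ ν) := by
  unfold Measure.conv
  rw [memLp_map_measure_iff aestronglyMeasurable_id (by fun_prop)]
  exact (hμ.comp_fst ν).add (hν.comp_snd μ)

lemma memLp_convPow [IsProbabilityMeasure μ] {p : ℝ≥0∞} (hμ : MemLp id p μ) (n : ℕ) :
    MemLp id p (convPow μ n) := by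
  induction n with
  | zero =>
    unfold convPow
    refine (memLp_const (0 : EuclideanSpace ℝ (Fin l))).ae_eq ?_
    rw [Filter.EventuallyEq, ae_dirac_eq]
    exact rfl
  | succ n ih => exact memLp_conv ih hμ

/-- The difference of two convolutions with a common factor is an average over translates. -/
lemma HasBoundedDerivs.abs_integral_conv_sub_le (hh : HasBoundedDerivs M h)
    {κ α β : Measure (EuclideanSpace ℝ (Fin l))} [IsProbabilityMeasure κ]
    [IsProbabilityMeasure α] [IsProbabilityMeasure β] (hκ : MemLp id 2 κ) (hα : MemLp id 2 α)
    (hβ : MemLp id 2 β) {c : ℝ} (hc : ∀ w, |∫ x, h (w + x) ∂α - ∫ x, h (w + x) ∂β| ≤ c) :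
    |∫ x, h x ∂(Measure.conv κ α) - ∫ x, h x ∂(Measure.conv κ β)| ≤ c := by
  have j : ∀ (γ : Measure (EuclideanSpace ℝ (Fin l))) [IsProbabilityMeasure γ], MemLp id 2 γ →
      Integrable (fun w => ∫ x, h (w + x) ∂γ) κ ∧
        ∫ x, h x ∂(Measure.conv κ γ) = ∫ w, ∫ x, h (w + x) ∂γ ∂κ := by
    intro γ _ hγ
    have hi := hh.integrable (memLp_conv hκ hγ)
    refine ⟨?_, integral_conv hi⟩
    exact ((integrable_map_measure hi.1 (by fun_prop)).1 hi).integral_prod_left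
  rw [(j α hα).2, (j β hβ).2, ← integral_sub (j α hα).1 (j β hβ).1, ← Real.norm_eq_abs]
  refine (norm_integral_le_of_norm_le_const (C := c) (ae_of_all _ hc)).trans (le_of_eq ?_)
  simp

/-- Replacing one factor of a convolution at a time: the error is at most `n` times the error of a
single replacement, as the class of functions with bounded derivatives is translation invariant. -/
lemma HasBoundedDerivs.abs_integral_convPow_sub_le [IsProbabilityMeasure μ]
    [IsProbabilityMeasure ν] (hμ : MemLp id 3 μ) (hν : MemLp id 3 ν) (hμν : SameMoments μ ν)
    (n : ℕ) (hh : HasBoundedDerivs M h) :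
    |∫ x, h x ∂convPow μ n - ∫ x, h x ∂convPow ν n| ≤
      n * (M * (∫ x, ‖x‖ ^ 3 ∂μ + ∫ x, ‖x‖ ^ 3 ∂ν)) := by
  have h23 : (2 : ℝ≥0∞) ≤ 3 := by norm_num
  have hμ2 : MemLp id 2 μ := hμ.mono_exponent h23
  have hν2 : MemLp id 2 ν := hν.mono_exponent h23
  set δ := M * (∫ x, ‖x‖ ^ 3 ∂μ + ∫ x, ‖x‖ ^ 3 ∂ν)
  induction n generalizing h with
  | zero => simp [convPow]
  | succ n ih =>
    -- the last factor `μ` is replaced by `ν`, and the first `n` factors by induction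
    have s1 := hh.abs_integral_conv_sub_le (κ := convPow μ n) (memLp_convPow hμ2 n) hμ2 hν2
      fun w => (hh.translate w).abs_integral_sub_le hμ hν hμν
    have s2 := hh.abs_integral_conv_sub_le (κ := ν) hν2 (memLp_convPow hμ2 n) (memLp_convPow hν2 n)
      fun w => ih (hh.translate w)
    rw [Measure.conv_comm ν, Measure.conv_comm ν] at s2
    refine (abs_sub_le _ _ _).trans ((add_le_add s1 s2).trans (le_of_eq ?_))
    push_cast
    ring

end Lindeberg

/-! ### The linear part of a Poisson U-statistic and its remainder -/

section LinearPart

variable {X : Type*} [MeasurableSpace X] {lam Λ : Measure X}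

lemma memLp_projInt_of_projKernel {m n : ℕ} (h : n ≤ m) {f : (Fin m → X) → ℝ}
    (hf2 : MemLp (projKernel lam f n) 2 (Measure.pi fun _ => lam)) :
    MemLp (projInt lam f n) 2 (Measure.pi fun _ => lam) := by
  have hc : (m.choose n : ℝ) ≠ 0 := Nat.cast_ne_zero.2 (Nat.choose_pos h).ne'
  refine (hf2.const_mul (m.choose n : ℝ)⁻¹).ae_eq (ae_of_all _ fun x => ?_)
  exact inv_mul_cancel_left₀ hc _

/-- The constant in the bound for the remainder that is left when the linear part is subtracted from
a normalized U-statistic. -/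
noncomputable def remainderBound (lam : Measure X) {m : ℕ} (f : (Fin m → X) → ℝ) : ℝ≥0∞ :=
  ∑ n ∈ Finset.Icc 2 m, m.choose n * (n.factorial *
    eLpNorm (projInt lam f n) 2 (Measure.pi fun _ => lam))

/-- The part of order `n` of a U-statistic is of the size `t ^ (m - n / 2)`, and the normalization
by `t ^ (m - 1 / 2)` leaves at most `t ^ (-1 / 2)` for `n ≥ 2`. -/
lemma rpow_remainder_le {t : ℝ} (ht : 1 ≤ t) {m n : ℕ} (hn : 2 ≤ n) (hnm : n ≤ m) :
    t ^ (-((m : ℝ) - 1 / 2)) * (t ^ (m - n) * (t ^ n) ^ (1 / 2 : ℝ)) ≤ t ^ (-(1 / 2 : ℝ)) := by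
  have ht0 : 0 < t := by linarith
  rw [← Real.rpow_natCast, ← Real.rpow_natCast, ← Real.rpow_mul ht0.le, ← Real.rpow_add ht0,
    ← Real.rpow_add ht0]
  refine Real.rpow_le_rpow_of_exponent_le ht ?_
  have : (2 : ℝ) ≤ n := by exact_mod_cast hn
  rw [Nat.cast_sub hnm]
  linarith

variable [SigmaFinite lam] [SigmaFinite Λ]
  {Ω : Type*} [MeasurableSpace Ω] {P : Measure Ω} {η : Ω → Measure X} {t : ℝ}
  [IsProbabilityMeasure P] (hη : IsPoissonProcess η Λ P)
include hη

lemma IsPoissonProcess.ae_integrable_factorialMeasure {m : ℕ} {f : (Fin m → X) → ℝ}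
    (hf : IsSymmKernel Λ m f) : ∀ᵐ ω ∂P, Integrable f (factorialMeasure (η ω) m) := by
  filter_upwards [hη.ae_factProc_eq m, ae_integrable_of_bind_eq (hη.measurable_factProc m)
    (hη.bind_factProc m) hf.1 hf.2.2] with ω h1 h2
  rwa [← h1]

lemma IsPoissonProcess.integral_chaosPart {m n : ℕ} (hn : n ≠ 0) (h : n ≤ m)
    {f : (Fin m → X) → ℝ} (hf : IsSymmKernel Λ m f) : ∫ ω, chaosPart η Λ m f n ω ∂P = 0 := by
  induction m with
  | zero => exact absurd (Nat.le_zero.1 h) hn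
  | succ m ih =>
    rcases Nat.lt_or_ge m n with h1 | h1
    · obtain rfl : n = m + 1 := by omega
      rw [chaosPart_self]
      exact hη.integral_chaos hn hf
    · rw [chaosPart_succ h1]
      exact ih h1 hf.partialInt

/-- The part of order zero is deterministic, because the factorial measure of order zero is the unit
mass on a one-point space. -/
lemma IsPoissonProcess.exists_chaosPart_zero (m : ℕ) (f : (Fin m → X) → ℝ) :
    ∃ c, ∀ᵐ ω ∂P, chaosPart η Λ m f 0 ω = c := by
  induction m with
  | zero =>
    refine ⟨f Fin.elim0, ?_⟩
    filter_upwards [hη.ae_factProc_eq 0] with ω h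
    have e : chaosPart η Λ 0 f 0 ω = ∫ x, f x ∂factProc η Λ 0 ω := by
      simp [chaosPart, chaos, altSum, mixInt]
    rw [e, h, factorialMeasure, integral_dirac' _ _ Subsingleton.measurable.stronglyMeasurable]
  | succ m ih =>
    rw [chaosPart_succ (Nat.zero_le m)]
    exact ih _

/-- The part of order one is the integral of the first projection with respect to the compensated
process. -/
lemma IsPoissonProcess.ae_chaosPart_one (ht : 0 < t) (hΛ : Λ = ENNReal.ofReal t • lam) {m : ℕ}
    (hm : 1 ≤ m) {f : (Fin m → X) → ℝ} (hf : IsSymmKernel lam m f) :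
    chaosPart η Λ m f 1 =ᵐ[P] fun ω =>
      t ^ (m - 1) * firstChaos η Λ (fun y => projInt lam f 1 fun _ => y) ω := by
  induction m, hm using Nat.le_induction with
  | base =>
    rw [chaosPart_self, projInt_self]
    simpa using hη.ae_chaos_one hf.1
  | succ m hm ih =>
    have hmeas : ∀ {k : ℕ} {g : (Fin k → X) → ℝ}, Measurable g →
        Measurable fun y => projInt lam g 1 fun _ => y := fun hg =>
      (measurable_projInt hg).comp measurable_const_fin_one
    have h1 : (fun y => projInt lam (partialInt lam f) 1 fun _ => y) =ᵐ[lam]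
        fun y => projInt lam f 1 fun _ => y :=
      measurePreserving_const_fin_one.quasiMeasurePreserving.ae_eq_comp (projInt_partialInt hm hf)
    have h2 := hη.ae_firstChaos_congr (hmeas hf.partialInt.1) (hmeas hf.1)
      (hΛ ▸ Measure.ae_smul_measure h1 _)
    have e : (fun y => projInt lam (t • partialInt lam f) 1 fun _ => y) =
        fun y => t * projInt lam (partialInt lam f) 1 fun _ => y := by
      funext y
      simp only [projInt, Pi.smul_apply, smul_eq_mul, integral_const_mul]
    rw [chaosPart_succ hm, partialInt_smul_measure ht hΛ f]
    filter_upwards [ih (hf.partialInt.const_smul t), h2] with ω h3 h4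
    rw [h3, e, firstChaos_const_mul, h4, ← mul_assoc, ← pow_succ]
    congr 2
    omega

lemma IsPoissonProcess.memLp_chaosPart (ht : 0 < t) (hΛ : Λ = ENNReal.ofReal t • lam) {m n : ℕ}
    (h : n ≤ m) {f : (Fin m → X) → ℝ} (hf : IsSymmKernel lam m f)
    (hf2 : MemLp (projInt lam f n) 2 (Measure.pi fun _ => lam)) :
    MemLp (chaosPart η Λ m f n) 2 P := by
  refine ⟨hη.aestronglyMeasurable_chaosPart h (hf.smul_measure hΛ),
    (hη.eLpNorm_two_chaosPart_le ht hΛ h hf hf2).trans_lt ?_⟩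
  have := hf2.2.ne
  exact (by finiteness : _ ≠ ∞).lt_top

lemma IsPoissonProcess.integrable_chaosPart {m n : ℕ} (h : n ≤ m)
    {f : (Fin m → X) → ℝ} (hf : IsSymmKernel Λ m f) : Integrable (chaosPart η Λ m f n) P := by
  have key : ∀ {k : ℕ} {g : (Fin k → X) → ℝ}, IsSymmKernel Λ k g →
      Integrable (chaos η Λ k g) P := by
    intro k g hg
    unfold chaos altSum
    exact integrable_finsetSum _ fun j _ => (hη.integrable_mixInt hg j).const_mul _
  induction m with
  | zero => exact key hf
  | succ m ih =>
    rcases Nat.lt_or_ge m n with h1 | h1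
    · obtain rfl : n = m + 1 := by omega
      rw [chaosPart_self]
      exact key hf
    · rw [chaosPart_succ h1]
      exact ih h1 hf.partialInt

/-- An integral with respect to the factorial measure is its mean plus multiple integrals of
positive order. -/
lemma IsPoissonProcess.ae_integral_factorialMeasure_sub {m : ℕ}
    {f : (Fin m → X) → ℝ} (hf : IsSymmKernel Λ m f) :
    ∀ᵐ ω ∂P, ∫ x, f x ∂factorialMeasure (η ω) m -
        ∫ ω', ∫ x, f x ∂factorialMeasure (η ω') m ∂P =
      ∑ n ∈ Finset.Icc 1 m, (m.choose n : ℝ) * chaosPart η Λ m f n ω := by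
  obtain ⟨c, hc⟩ := hη.exists_chaosPart_zero m f
  have h1 : ∀ᵐ ω ∂P, ∫ x, f x ∂factorialMeasure (η ω) m =
      ∑ n ∈ Finset.Icc 1 m, (m.choose n : ℝ) * chaosPart η Λ m f n ω + c := by
    filter_upwards [hη.ae_factProc_eq m, hc] with ω h2 h3
    rw [← h2, integral_factProc_eq_sum_chaosPart, Finset.sum_range_eq_add_Ico _ (by omega), h3]
    have e : Finset.Ico 1 (m + 1) = Finset.Icc 1 m := by
      ext n
      simp only [Finset.mem_Ico, Finset.mem_Icc]
      omega
    rw [e]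
    simp [add_comm]
  have hi : ∀ n ∈ Finset.Icc 1 m,
      Integrable (fun ω => (m.choose n : ℝ) * chaosPart η Λ m f n ω) P := fun n hn =>
    (hη.integrable_chaosPart (Finset.mem_Icc.1 hn).2 hf).const_mul _
  have h2 : ∫ ω, ∫ x, f x ∂factorialMeasure (η ω) m ∂P = c := by
    rw [integral_congr_ae h1, integral_add (integrable_finsetSum _ hi) (integrable_const _),
      integral_finsetSum _ hi, Finset.sum_eq_zero fun n hn => ?_]
    · simp
    · rw [integral_const_mul, hη.integral_chaosPart (by have := (Finset.mem_Icc.1 hn).1; omega)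
        (Finset.mem_Icc.1 hn).2 hf, mul_zero]
  filter_upwards [h1] with ω h3
  rw [h2, h3, add_sub_cancel_right]

lemma IsPoissonProcess.memLp_uStat (ht : 0 < t) (hΛ : Λ = ENNReal.ofReal t • lam) {m : ℕ}
    {f : (Fin m → X) → ℝ} (hf : IsSymmKernel lam m f)
    (hf2 : ∀ n, 1 ≤ n → n ≤ m → MemLp (projInt lam f n) 2 (Measure.pi fun _ => lam)) (a : ℝ) :
    MemLp (uStat η a f) 2 P := by
  have h1 : MemLp (fun ω => ∑ n ∈ Finset.Icc 1 m, (m.choose n : ℝ) * chaosPart η Λ m f n ω) 2 P :=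
    memLp_finsetSum _ fun n hn => (hη.memLp_chaosPart ht hΛ (Finset.mem_Icc.1 hn).2 hf
      (hf2 n (Finset.mem_Icc.1 hn).1 (Finset.mem_Icc.1 hn).2)).const_mul _
  refine MemLp.const_mul ?_ a
  refine (h1.add (memLp_const (∫ ω', ∫ x, f x ∂factorialMeasure (η ω') m ∂P))).ae_eq ?_
  filter_upwards [hη.ae_integral_factorialMeasure_sub (hf.smul_measure hΛ)] with ω h2
  rw [Pi.add_apply, ← h2, sub_add_cancel]

/-- A normalized U-statistic is, up to a small centred remainder, the normalized integral of its
first projection with respect to the compensated process. -/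
lemma IsPoissonProcess.exists_remainder (ht : 1 ≤ t) (hΛ : Λ = ENNReal.ofReal t • lam) {m : ℕ}
    (hm : 1 ≤ m) {f : (Fin m → X) → ℝ} (hf : IsSymmKernel lam m f)
    (hf2 : ∀ n, 1 ≤ n → n ≤ m → MemLp (projInt lam f n) 2 (Measure.pi fun _ => lam)) {a : ℝ}
    (ha : a ≠ 0) : ∃ R : Ω → ℝ, MemLp R 2 P ∧ ∫ ω, R ω ∂P = 0 ∧
      eLpNorm R 2 P ≤ ENNReal.ofReal (t ^ (-(1 / 2 : ℝ))) * remainderBound lam f ∧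
      ∀ᵐ ω ∂P, normUStat P η t a f ω =
        t ^ (-(1 / 2 : ℝ)) * firstChaos η Λ (projKernelOne lam f) ω + R ω := by
  have ht0 : 0 < t := by linarith
  set c : ℝ := t ^ (-((m : ℝ) - 1 / 2)) with hc
  have hmem : ∀ n ∈ Finset.Icc 2 m, 1 ≤ n ∧ n ≤ m := fun n hn => by
    have := Finset.mem_Icc.1 hn
    omega
  have hL : ∀ n ∈ Finset.Icc 2 m, MemLp (chaosPart η Λ m f n) 2 P := fun n hn =>
    hη.memLp_chaosPart ht0 hΛ (hmem n hn).2 hf (hf2 n (hmem n hn).1 (hmem n hn).2)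
  -- the remainder consists of the parts of order at least two
  refine ⟨fun ω => ∑ n ∈ Finset.Icc 2 m, c * (m.choose n * chaosPart η Λ m f n ω),
    memLp_finsetSum _ fun n hn => ((hL n hn).const_mul _).const_mul _, ?_, ?_, ?_⟩
  · rw [integral_finsetSum _ fun n hn =>
      (((hL n hn).integrable one_le_two).const_mul _).const_mul _]
    refine Finset.sum_eq_zero fun n hn => ?_
    rw [integral_const_mul, integral_const_mul, hη.integral_chaosPart
      (by have := (hmem n hn).1; omega) (hmem n hn).2 (hf.smul_measure hΛ), mul_zero, mul_zero]
  · have e : (fun ω => ∑ n ∈ Finset.Icc 2 m, c * (m.choose n * chaosPart η Λ m f n ω)) =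
        ∑ n ∈ Finset.Icc 2 m, (c * m.choose n) • chaosPart η Λ m f n := by
      funext ω
      simp [mul_assoc]
    rw [e, remainderBound, Finset.mul_sum]
    refine (eLpNorm_sum_le (fun n hn => (hL n hn).1.const_smul _) one_le_two).trans
      (Finset.sum_le_sum fun n hn => ?_)
    have h1 := hη.eLpNorm_two_chaosPart_le ht0 hΛ (hmem n hn).2 hf
      (hf2 n (hmem n hn).1 (hmem n hn).2)
    have hc0 : 0 ≤ c := Real.rpow_nonneg ht0.le _
    have h2 : ENNReal.ofReal c * (ENNReal.ofReal t ^ (m - n) *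
        (ENNReal.ofReal t ^ n) ^ (1 / 2 : ℝ)) ≤ ENNReal.ofReal (t ^ (-(1 / 2 : ℝ))) := by
      rw [← ENNReal.ofReal_pow ht0.le, ← ENNReal.ofReal_pow ht0.le,
        ENNReal.ofReal_rpow_of_pos (by positivity), ← ENNReal.ofReal_mul (by positivity),
        ← ENNReal.ofReal_mul hc0]
      exact ENNReal.ofReal_le_ofReal
        (rpow_remainder_le ht (Finset.mem_Icc.1 hn).1 (Finset.mem_Icc.1 hn).2)
    rw [eLpNorm_const_smul, enorm_mul, Real.enorm_eq_ofReal hc0, Real.enorm_natCast]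
    calc _ ≤ ENNReal.ofReal c * m.choose n * (n.factorial * ENNReal.ofReal t ^ (m - n) *
          (ENNReal.ofReal t ^ n) ^ (1 / 2 : ℝ) *
          eLpNorm (projInt lam f n) 2 (Measure.pi fun _ => lam)) := by gcongr
      _ = ENNReal.ofReal c * (ENNReal.ofReal t ^ (m - n) *
          (ENNReal.ofReal t ^ n) ^ (1 / 2 : ℝ)) * (m.choose n * (n.factorial *
          eLpNorm (projInt lam f n) 2 (Measure.pi fun _ => lam))) := by ring
      _ ≤ _ := by gcongr
  · filter_upwards [hη.ae_integral_factorialMeasure_sub (hf.smul_measure hΛ),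
      hη.ae_chaosPart_one ht0 hΛ hm hf] with ω h1 h2
    have e1 : normUStat P η t a f ω = c * (∫ x, f x ∂factorialMeasure (η ω) m -
        ∫ ω', ∫ x, f x ∂factorialMeasure (η ω') m ∂P) := by
      simp only [normUStat, uStat]
      rw [integral_const_mul, ← mul_sub, mul_comm a⁻¹, mul_assoc, inv_mul_cancel_left₀ ha]
    have e2 : c * t ^ (m - 1) = t ^ (-(1 / 2 : ℝ)) := by
      rw [hc, ← Real.rpow_natCast, ← Real.rpow_add ht0, Nat.cast_sub hm]
      congr 1
      push_cast
      ring
    have e3 : firstChaos η Λ (projKernelOne lam f) ω =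
        m * firstChaos η Λ (fun y => projInt lam f 1 fun _ => y) ω := by
      rw [← firstChaos_const_mul]
      congr 1
      funext y
      rw [projKernelOne, projKernel, Nat.choose_one_right]
      rfl
    rw [e1, h1, ← Finset.add_sum_Ioc_eq_sum_Icc hm, h2, e3, ← e2, Nat.choose_one_right, mul_add,
      Finset.mul_sum]
    congr 1
    ring

end LinearPart

/-! ### Gaussian approximation of linear functionals -/

section GaussianVector

variable {l : ℕ} {Ω : Type*} [MeasurableSpace Ω] {Q : Measure Ω} [IsProbabilityMeasure Q]
  {N : Ω → EuclideanSpace ℝ (Fin l)}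

/-- A centred Gaussian law is a convolution power of the law of a scaled copy. -/
lemma map_eq_convPow_of_hasGaussianLaw (hN : HasGaussianLaw N Q) (hmean : ∀ i, ∫ ω, N ω i ∂Q = 0)
    {n : ℕ} (hn : n ≠ 0) :
    Q.map N = convPow (Q.map fun ω => (√n)⁻¹ • N ω) n := by
  have hNm := hN.aemeasurable
  have i1 : IsProbabilityMeasure (Q.map N) := Measure.isProbabilityMeasure_map hNm
  have i2 : IsProbabilityMeasure (Q.map fun ω => (√n)⁻¹ • N ω) :=
    Measure.isProbabilityMeasure_map (hNm.const_smul (√n)⁻¹)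
  refine Measure.ext_of_charFun (funext fun u => ?_)
  have hinner : ∀ u : EuclideanSpace ℝ (Fin l), ∫ ω, inner ℝ u (N ω) ∂Q = 0 := by
    intro u
    have hi : ∀ i, Integrable (fun ω => N ω i) Q := fun i =>
      ((memLp_piLp_iff.1 hN.memLp_two) i).integrable one_le_two
    simp only [PiLp.inner_apply, RCLike.inner_apply, conj_trivial]
    rw [integral_finsetSum _ fun i _ => (hi i).mul_const _]
    simp [integral_mul_const, hmean]
  have hn0 : (0 : ℝ) < n := by exact_mod_cast Nat.pos_of_ne_zero hn
  have hvar : Var[fun ω => inner ℝ ((√n)⁻¹ • u) (N ω); Q] =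
      (n : ℝ)⁻¹ * Var[fun ω => inner ℝ u (N ω); Q] := by
    simp only [real_inner_smul_left]
    rw [variance_const_mul, inv_pow, Real.sq_sqrt hn0.le]
  rw [charFun_convPow, charFun_map_smul_comp hNm, hN.charFun_map_eq, hN.charFun_map_eq, hinner,
    hinner, hvar, ← Complex.exp_nat_mul]
  congr 1
  have : (n : ℂ) ≠ 0 := by exact_mod_cast hn
  push_cast
  field_simp
  ring

end GaussianVector

section LinearVector

variable {l : ℕ} {X : Type*} [MeasurableSpace X] {lam Λ : Measure X} [SigmaFinite lam]
  [SigmaFinite Λ] {Ω : Type*} [MeasurableSpace Ω] {P : Measure Ω} [IsProbabilityMeasure P]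
  {η : Ω → Measure X} {φ : Fin l → X → ℝ} {s : ℝ}

/-- The random vector with components `c ∫ φᵢ d(η - Λ)`. -/
noncomputable def linearVector (η : Ω → Measure X) (Λ : Measure X) (φ : Fin l → X → ℝ) (c : ℝ)
    (ω : Ω) : EuclideanSpace ℝ (Fin l) :=
  WithLp.toLp 2 fun i => c * firstChaos η Λ (φ i) ω

lemma eLpNorm_toLp_le {Y : Fin l → Ω → ℝ} {p : ℝ≥0∞} (hp : 1 ≤ p)
    (hY : ∀ i, AEStronglyMeasurable (Y i) P) :
    eLpNorm (fun ω => WithLp.toLp 2 fun i => Y i ω : Ω → EuclideanSpace ℝ (Fin l)) p P ≤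
      ∑ i, eLpNorm (Y i) p P := by
  have e : (fun ω => WithLp.toLp 2 fun i => Y i ω : Ω → EuclideanSpace ℝ (Fin l)) =
      ∑ i, fun ω => Y i ω • basisVec i := by
    funext ω
    rw [Finset.sum_apply]
    exact eq_sum_smul_basisVec _
  rw [e]
  refine (eLpNorm_sum_le (fun i _ => (hY i).smul_const _) hp).trans
    (Finset.sum_le_sum fun i _ => le_of_eq ?_)
  refine eLpNorm_congr_norm_ae (ae_of_all _ fun ω => ?_)
  simp [norm_smul]

variable (hη : IsPoissonProcess η Λ P) (hφm : ∀ i, Measurable (φ i))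
include hη hφm

lemma IsPoissonProcess.memLp_linearVector (hφ : ∀ i, Integrable (φ i) Λ)
    (hφ2 : ∀ i, MemLp (φ i) 2 Λ) (c : ℝ) : MemLp (linearVector η Λ φ c) 2 P :=
  MemLp.of_eval_piLp fun i => (hη.memLp_two_firstChaos (hφm i) (hφ i) (hφ2 i)).const_mul c

/-- For the intensity measure `s • lam` the exponent of the characteristic function is proportional
to `s`. -/
lemma IsPoissonProcess.charFun_linearVector (hs : 0 < s) (hΛ : Λ = ENNReal.ofReal s • lam)
    (hφ : ∀ i, Integrable (φ i) lam) (hφ2 : ∀ i, MemLp (φ i) 2 lam) (c : ℝ)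
    (u : EuclideanSpace ℝ (Fin l)) :
    charFun (P.map (linearVector η Λ φ c)) u = Complex.exp (s *
      (∫ y, (Complex.exp ((∑ i, u i * c * φ i y : ℝ) * Complex.I) - 1) ∂lam -
        (∫ y, ∑ i, u i * c * φ i y ∂lam : ℝ) * Complex.I)) := by
  have hφΛ : ∀ i, Integrable (φ i) Λ := fun i => by
    rw [hΛ]
    exact (hφ i).smul_measure ENNReal.ofReal_ne_top
  have hφ2Λ : ∀ i, MemLp (φ i) 2 Λ := fun i => by
    rw [hΛ]
    exact (hφ2 i).smul_measure ENNReal.ofReal_ne_top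
  set ψ : X → ℝ := fun y => ∑ i, u i * c * φ i y with hψ
  have hψm : Measurable ψ := Finset.measurable_fun_sum _ fun i _ => (hφm i).const_mul _
  have hψi : Integrable ψ Λ := integrable_finsetSum _ fun i _ => (hφΛ i).const_mul _
  have hψ2 : MemLp ψ 2 Λ := memLp_finsetSum _ fun i _ => (hφ2Λ i).const_mul _
  have hm := (hη.memLp_linearVector hφm hφΛ hφ2Λ c).1.aemeasurable
  rw [charFun_apply, integral_map hm (by fun_prop)]
  have h1 : (fun ω => Complex.exp (inner ℝ (linearVector η Λ φ c ω) u * Complex.I)) =ᵐ[P]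
      fun ω => Complex.exp (firstChaos η Λ ψ ω * Complex.I) := by
    filter_upwards [hη.ae_firstChaos_sum Finset.univ (fun i => u i * c) hφm hφΛ] with ω hω
    rw [hψ, hω]
    simp [linearVector, PiLp.inner_apply, mul_assoc]
  rw [integral_congr_ae h1, hη.integral_exp_firstChaos hψm hψi hψ2, hΛ, integral_smul_measure,
    integral_smul_measure, ENNReal.toReal_ofReal hs.le]
  congr 1
  change _ = (s : ℂ) * (∫ y, (Complex.exp (ψ y * Complex.I) - 1) ∂lam -
    (∫ y, ψ y ∂lam : ℝ) * Complex.I)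
  rw [mul_sub, Complex.real_smul, smul_eq_mul, Complex.ofReal_mul]
  ring

lemma IsPoissonProcess.eLpNorm_three_linearVector_le (hφ : ∀ i, Integrable (φ i) Λ) (c : ℝ) :
    eLpNorm (linearVector η Λ φ c) 3 P ≤ ‖c‖ₑ * ∑ i, cubeBound Λ (φ i) := by
  refine (eLpNorm_toLp_le (by norm_num) fun i =>
    (hη.aestronglyMeasurable_firstChaos (hφm i) (hφ i)).const_mul c).trans ?_
  rw [Finset.mul_sum]
  refine Finset.sum_le_sum fun i _ => ?_
  rw [show (fun ω => c * firstChaos η Λ (φ i) ω) = c • firstChaos η Λ (φ i) from rfl,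
    eLpNorm_const_smul]
  gcongr
  exact hη.eLpNorm_three_firstChaos_le (hφm i) (hφ i)

lemma IsPoissonProcess.integral_linearVector (hφ : ∀ i, Integrable (φ i) Λ) (c : ℝ) (i : Fin l) :
    ∫ ω, linearVector η Λ φ c ω i ∂P = 0 := by
  simp only [linearVector]
  rw [integral_const_mul, hη.integral_firstChaos (hφm i) (hφ i), mul_zero]

lemma IsPoissonProcess.integral_linearVector_mul (hφ : ∀ i, Integrable (φ i) Λ)
    (hφ2 : ∀ i, MemLp (φ i) 2 Λ) (c : ℝ) (i j : Fin l) :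
    ∫ ω, linearVector η Λ φ c ω i * linearVector η Λ φ c ω j ∂P =
      c ^ 2 * ∫ y, φ i y * φ j y ∂Λ := by
  simp only [linearVector]
  rw [← hη.integral_firstChaos_mul (hφm i) (hφ i) (hφ2 i) (hφm j) (hφ j) (hφ2 j),
    ← integral_const_mul]
  congr 1
  funext ω
  ring

end LinearVector

section LinearApproximation

variable {l : ℕ} {X : Type*} [MeasurableSpace X] {lam : Measure X} [SigmaFinite lam]
  {Ω : Type*} [MeasurableSpace Ω] {P : Measure Ω} [IsProbabilityMeasure P]
  {η : ℝ → Ω → Measure X} {φ : Fin l → X → ℝ}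
  {Ω' : Type*} [MeasurableSpace Ω'] {Q : Measure Ω'} [IsProbabilityMeasure Q]
  {N : Ω' → EuclideanSpace ℝ (Fin l)}

lemma sigmaFinite_ofReal_smul (t : ℝ) : SigmaFinite (ENNReal.ofReal t • lam) :=
  inferInstanceAs (SigmaFinite (t.toNNReal • lam))

/-- Infinite divisibility: for the intensity measure `n s • lam`, the law of the linear functionals
is the `n`-th convolution power of the law for `s • lam`. -/
lemma map_linearVector_eq_convPow
    (hη : ∀ t : ℝ, 0 < t → IsPoissonProcess (η t) (ENNReal.ofReal t • lam) P)
    (hφm : ∀ i, Measurable (φ i)) (hφ : ∀ i, Integrable (φ i) lam) (hφ2 : ∀ i, MemLp (φ i) 2 lam)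
    {s : ℝ} (hs : 0 < s) {n : ℕ} (hn : n ≠ 0) (c : ℝ) :
    P.map (linearVector (η (n * s)) (ENNReal.ofReal (n * s) • lam) φ c) =
      convPow (P.map (linearVector (η s) (ENNReal.ofReal s • lam) φ c)) n := by
  have hns : 0 < n * s := mul_pos (by exact_mod_cast Nat.pos_of_ne_zero hn) hs
  have j1 := sigmaFinite_ofReal_smul (lam := lam) s
  have j2 := sigmaFinite_ofReal_smul (lam := lam) (n * s)
  have hm : ∀ r, 0 < r → SigmaFinite (ENNReal.ofReal r • lam) →
      AEMeasurable (linearVector (η r) (ENNReal.ofReal r • lam) φ c) P := fun r hr _ =>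
    ((hη r hr).memLp_linearVector hφm (fun i => (hφ i).smul_measure ENNReal.ofReal_ne_top)
      (fun i => (hφ2 i).smul_measure ENNReal.ofReal_ne_top) c).1.aemeasurable
  have i1 := Measure.isProbabilityMeasure_map (hm s hs j1)
  have i2 := Measure.isProbabilityMeasure_map (hm _ hns j2)
  refine Measure.ext_of_charFun (funext fun u => ?_)
  rw [charFun_convPow, (hη _ hns).charFun_linearVector hφm hns rfl hφ hφ2,
    (hη s hs).charFun_linearVector hφm hs rfl hφ hφ2, ← Complex.exp_nat_mul]
  congr 1
  push_cast
  ring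

lemma integral_norm_pow {E : Type*} [NormedAddCommGroup E] {V : Ω → E}
    (hV : AEStronglyMeasurable V P) {p : ℕ} (hp : p ≠ 0) :
    ∫ ω, ‖V ω‖ ^ p ∂P = (eLpNorm V p P).toReal ^ p := by
  have h := eLpNorm_nnreal_pow_eq_lintegral (μ := P) (f := V) (p := p) (by exact_mod_cast hp)
  simp only [NNReal.coe_natCast, ENNReal.rpow_natCast, ENNReal.coe_natCast] at h
  rw [← ENNReal.toReal_pow, h, integral_eq_lintegral_of_nonneg_ae
    (ae_of_all _ fun ω => by positivity) (hV.norm.aemeasurable.pow_const p).aestronglyMeasurable]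
  congr 1
  refine lintegral_congr fun ω => ?_
  rw [← ofReal_norm, ← ENNReal.ofReal_pow (norm_nonneg _)]

/-- Normal approximation of the normalized linear functionals: the intensity measure is split into
`⌈t⌉` equal parts, and the corresponding infinitely divisible law is compared with the normal law
one convolution factor at a time. -/
lemma abs_integral_linearVector_sub_le
    (hη : ∀ t : ℝ, 0 < t → IsPoissonProcess (η t) (ENNReal.ofReal t • lam) P)
    (hφm : ∀ i, Measurable (φ i)) (hφ : ∀ i, Integrable (φ i) lam) (hφ2 : ∀ i, MemLp (φ i) 2 lam)
    (hφ3 : ∀ i, MemLp (φ i) 3 lam) (hN : HasGaussianLaw N Q) (hmean : ∀ i, ∫ ω, N ω i ∂Q = 0)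
    (hcov : ∀ i j, ∫ ω, N ω i * N ω j ∂Q = ∫ x, φ i x * φ j x ∂lam)
    {M : ℝ} {h : EuclideanSpace ℝ (Fin l) → ℝ} (hM : 0 ≤ M) (hh : HasBoundedDerivs M h) {t : ℝ}
    (ht : 1 ≤ t) :
    |∫ ω, h (linearVector (η t) (ENNReal.ofReal t • lam) φ (t ^ (-(1 / 2 : ℝ))) ω) ∂P -
        ∫ ω, h (N ω) ∂Q| ≤
      M * (2 * ((∑ i, cubeBound lam (φ i)).toReal ^ 3 + ∫ ω, ‖N ω‖ ^ 3 ∂Q)) *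
        t ^ (-(1 / 2 : ℝ)) := by
  have ht0 : 0 < t := by linarith
  set c : ℝ := t ^ (-(1 / 2 : ℝ)) with hc
  have hc0 : 0 < c := Real.rpow_pos_of_pos ht0 _
  have hc2 : c ^ 2 = t⁻¹ := by
    rw [hc, ← Real.rpow_natCast, ← Real.rpow_mul ht0.le, ← Real.rpow_neg_one]
    norm_num
  -- with `⌈t⌉` parts the intensity of each is at most `lam`, and the number of parts at most `2 t`
  set n : ℕ := ⌈t⌉₊ with hn
  have hn0 : n ≠ 0 := (Nat.ceil_pos.2 ht0).ne'
  have hnpos : (0 : ℝ) < n := by exact_mod_cast Nat.pos_of_ne_zero hn0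
  have htn : t ≤ n := Nat.le_ceil t
  have hnt : (n : ℝ) ≤ 2 * t := by
    have := Nat.ceil_lt_add_one ht0.le
    linarith
  set s : ℝ := t / n with hs
  have hs0 : 0 < s := div_pos ht0 hnpos
  have hs1 : s ≤ 1 := (div_le_one hnpos).2 htn
  have hns : n * s = t := mul_div_cancel₀ t hnpos.ne'
  have j1 := sigmaFinite_ofReal_smul (lam := lam) s
  have j2 := sigmaFinite_ofReal_smul (lam := lam) t
  have hφs : ∀ i, Integrable (φ i) (ENNReal.ofReal s • lam) := fun i =>
    (hφ i).smul_measure ENNReal.ofReal_ne_top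
  have hφ2s : ∀ i, MemLp (φ i) 2 (ENNReal.ofReal s • lam) := fun i =>
    (hφ2 i).smul_measure ENNReal.ofReal_ne_top
  have hVs := (hη s hs0).memLp_linearVector hφm hφs hφ2s c
  have hVt := (hη t ht0).memLp_linearVector hφm
    (fun i => (hφ i).smul_measure ENNReal.ofReal_ne_top)
    (fun i => (hφ2 i).smul_measure ENNReal.ofReal_ne_top) c
  have hNm := hN.aemeasurable
  have hNs : AEMeasurable (fun ω => (√n)⁻¹ • N ω) Q := hNm.const_smul (√n)⁻¹
  have hN3 : MemLp (fun ω => (√n)⁻¹ • N ω) 3 Q := (hN.memLp (by norm_num)).const_smul (√n)⁻¹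
  set μ := P.map (linearVector (η s) (ENNReal.ofReal s • lam) φ c) with hμ
  set ν := Q.map fun ω => (√n)⁻¹ • N ω with hν
  have p1 : IsProbabilityMeasure μ := Measure.isProbabilityMeasure_map hVs.1.aemeasurable
  have p2 : IsProbabilityMeasure ν := Measure.isProbabilityMeasure_map hNs
  have hmono : ∀ i, cubeBound (ENNReal.ofReal s • lam) (φ i) ≤ cubeBound lam (φ i) := fun i => by
    refine cubeBound_mono (Measure.le_intro fun B _ _ => ?_) _
    rw [Measure.smul_apply, smul_eq_mul]
    exact mul_le_of_le_one_left' (ENNReal.ofReal_le_one.2 hs1)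
  set K : ℝ≥0∞ := ∑ i, cubeBound lam (φ i) with hK
  have hKfin : K ≠ ∞ := ENNReal.sum_ne_top.2 fun i _ =>
    (cubeBound_lt_top (hφ i) (hφ2 i) (hφ3 i)).ne
  have hV3 : eLpNorm (linearVector (η s) (ENNReal.ofReal s • lam) φ c) 3 P ≤
      ENNReal.ofReal c * K := by
    refine ((hη s hs0).eLpNorm_three_linearVector_le hφm hφs c).trans ?_
    rw [Real.enorm_eq_ofReal hc0.le]
    gcongr
    exact Finset.sum_le_sum fun i _ => hmono i
  have hVmem : MemLp (linearVector (η s) (ENNReal.ofReal s • lam) φ c) 3 P :=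
    ⟨hVs.1, hV3.trans_lt (by finiteness)⟩
  have hμ3 : MemLp id 3 μ :=
    (memLp_map_measure_iff aestronglyMeasurable_id hVs.1.aemeasurable).2 hVmem
  have hν3 : MemLp id 3 ν := (memLp_map_measure_iff aestronglyMeasurable_id hNs).2 hN3
  have hmom : SameMoments μ ν := by
    constructor
    · intro i
      rw [integral_map hVs.1.aemeasurable (by fun_prop), integral_map hNs (by fun_prop),
        (hη s hs0).integral_linearVector hφm hφs]
      simp [integral_const_mul, hmean]
    · intro i j
      rw [integral_map hVs.1.aemeasurable (by fun_prop), integral_map hNs (by fun_prop),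
        (hη s hs0).integral_linearVector_mul hφm hφs hφ2s, integral_smul_measure,
        ENNReal.toReal_ofReal hs0.le, ← hcov, hc2]
      have e : ∀ ω, ((√n)⁻¹ • N ω) i * ((√n)⁻¹ • N ω) j = (n : ℝ)⁻¹ * (N ω i * N ω j) := by
        intro ω
        have : (√(n : ℝ))⁻¹ * (√n)⁻¹ = (n : ℝ)⁻¹ := by
          rw [← mul_inv, Real.mul_self_sqrt hnpos.le]
        simp only [PiLp.smul_apply, smul_eq_mul]
        rw [← this]
        ring
      simp only [e]
      rw [integral_const_mul, smul_eq_mul, ← mul_assoc, hs]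
      congr 1
      field_simp
  have hμn : ∫ x, ‖x‖ ^ 3 ∂μ ≤ c ^ 3 * K.toReal ^ 3 := by
    rw [integral_map hVs.1.aemeasurable (by fun_prop), integral_norm_pow hVs.1 three_ne_zero,
      ← mul_pow]
    gcongr
    refine (ENNReal.toReal_mono (by finiteness) hV3).trans_eq ?_
    rw [ENNReal.toReal_mul, ENNReal.toReal_ofReal hc0.le]
  have hνn : ∫ x, ‖x‖ ^ 3 ∂ν ≤ c ^ 3 * ∫ ω, ‖N ω‖ ^ 3 ∂Q := by
    rw [integral_map hNs (by fun_prop), ← integral_const_mul]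
    have hN3' : Integrable (fun ω => ‖N ω‖ ^ 3) Q := by
      simpa using (hN.memLp (p := 3) (by norm_num)).integrable_norm_pow (by norm_num)
    have hle : (√n)⁻¹ ≤ c := by
      rw [hc, Real.rpow_neg ht0.le, ← Real.sqrt_eq_rpow]
      gcongr
    refine integral_mono ?_ (hN3'.const_mul _) fun ω => ?_
    · simpa using hN3.integrable_norm_pow (by norm_num)
    · simp only [norm_smul, mul_pow, norm_inv, Real.norm_of_nonneg (Real.sqrt_nonneg _)]
      gcongr
  have hmain := hh.abs_integral_convPow_sub_le hμ3 hν3 hmom n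
  rw [hμ, hν, ← map_linearVector_eq_convPow hη hφm hφ hφ2 hs0 hn0,
    ← map_eq_convPow_of_hasGaussianLaw hN hmean hn0, hns, ← hμ, ← hν,
    integral_map hVt.1.aemeasurable hh.1.continuous.aestronglyMeasurable,
    integral_map hNm hh.1.continuous.aestronglyMeasurable] at hmain
  refine hmain.trans ?_
  have hI : 0 ≤ ∫ ω, ‖N ω‖ ^ 3 ∂Q := integral_nonneg fun ω => by positivity
  calc (n : ℝ) * (M * (∫ x, ‖x‖ ^ 3 ∂μ + ∫ x, ‖x‖ ^ 3 ∂ν))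
      ≤ 2 * t * (M * (c ^ 3 * K.toReal ^ 3 + c ^ 3 * ∫ ω, ‖N ω‖ ^ 3 ∂Q)) := by
        gcongr
    _ = M * (2 * (K.toReal ^ 3 + ∫ ω, ‖N ω‖ ^ 3 ∂Q)) * c * (t * c ^ 2) := by ring
    _ = _ := by rw [hc2, mul_inv_cancel₀ ht0.ne', mul_one]

end LinearApproximation

/-! ### The effect of the remainder -/

section Remainder

variable {l : ℕ} {Ω : Type*} [MeasurableSpace Ω] {P : Measure Ω} [IsProbabilityMeasure P]
  {V R : Ω → EuclideanSpace ℝ (Fin l)} {M : ℝ} {h : EuclideanSpace ℝ (Fin l) → ℝ}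

lemma HasBoundedDerivs.integrable_comp (hh : HasBoundedDerivs M h) (hV : MemLp V 2 P) :
    Integrable (fun ω => h (V ω)) P := by
  have := Measure.isProbabilityMeasure_map hV.1.aemeasurable
  exact (hh.integrable ((memLp_map_measure_iff aestronglyMeasurable_id
    hV.1.aemeasurable).2 hV)).comp_aemeasurable hV.1.aemeasurable

/-- Effect of a centred perturbation on the expectation of a smooth function. As the derivative of
`h` at the origin is integrated against `R` to zero, only second derivatives of `h` enter. -/
lemma HasBoundedDerivs.abs_integral_add_sub_le (hh : HasBoundedDerivs M h) (hM : 0 ≤ M)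
    (hV : MemLp V 2 P) (hR : MemLp R 2 P) (hR0 : ∀ i, ∫ ω, R ω i ∂P = 0) {c : ℝ} (hc : 0 < c) :
    |∫ ω, h (V ω + R ω) ∂P - ∫ ω, h (V ω) ∂P| ≤
      M * (c * ∫ ω, ‖V ω‖ ^ 2 ∂P + (c⁻¹ + 1) * ∫ ω, ‖R ω‖ ^ 2 ∂P) := by
  have hR1 := hR.integrable one_le_two
  have hD : ∫ ω, fderiv ℝ h 0 (R ω) ∂P = 0 := by
    rw [ContinuousLinearMap.integral_comp_comm _ hR1]
    have : ∫ ω, R ω ∂P = 0 := by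
      ext i
      have := (EuclideanSpace.proj i : EuclideanSpace ℝ (Fin l) →L[ℝ] ℝ).integral_comp_comm hR1
      exact this.symm.trans (hR0 i)
    rw [this, map_zero]
  have i1 := hh.integrable_comp (hV.add hR)
  have i2 := hh.integrable_comp hV
  have i3 : Integrable (fun ω => fderiv ℝ h 0 (R ω)) P :=
    ContinuousLinearMap.integrable_comp _ hR1
  have hV2 : Integrable (fun ω => ‖V ω‖ ^ 2) P := hV.integrable_norm_pow two_ne_zero
  have hR2 : Integrable (fun ω => ‖R ω‖ ^ 2) P := hR.integrable_norm_pow two_ne_zero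
  have e : ∫ ω, h (V ω + R ω) ∂P - ∫ ω, h (V ω) ∂P =
      ∫ ω, (h (V ω + R ω) - h (V ω) - fderiv ℝ h 0 (R ω)) ∂P := by
    have h1 := integral_sub (i1.sub i2) i3
    have h2 := integral_sub i1 i2
    rw [hD, sub_zero] at h1
    exact h2.symm.trans h1.symm
  rw [e, ← integral_const_mul c, ← integral_const_mul (c⁻¹ + 1),
    ← integral_add (hV2.const_mul _) (hR2.const_mul _), ← integral_const_mul, ← Real.norm_eq_abs]
  refine norm_integral_le_of_norm_le (((hV2.const_mul _).add (hR2.const_mul _)).const_mul _)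
    (ae_of_all _ fun ω => ?_)
  refine (hh.abs_sub_sub_le (V ω) (R ω)).trans ?_
  gcongr
  -- the inequality of arithmetic and geometric means, with a weight `c` that balances the sizes of
  -- `V` and `R`
  have h1 : ‖V ω‖ * ‖R ω‖ ≤ c * ‖V ω‖ ^ 2 + c⁻¹ * ‖R ω‖ ^ 2 := by
    have h2 := sq_nonneg (c * ‖V ω‖ - ‖R ω‖)
    have h3 : 0 ≤ c⁻¹ * (c * ‖V ω‖ - ‖R ω‖) ^ 2 := by positivity
    have h4 : c⁻¹ * (c * ‖V ω‖ - ‖R ω‖) ^ 2 =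
        c * ‖V ω‖ ^ 2 + c⁻¹ * ‖R ω‖ ^ 2 - 2 * (‖V ω‖ * ‖R ω‖) := by
      field_simp
      ring
    have h5 : 0 ≤ ‖V ω‖ * ‖R ω‖ := by positivity
    linarith
  linarith [sq (‖R ω‖)]

end Remainder

section Main

variable {l : ℕ} {X : Type*} [MeasurableSpace X] {lam : Measure X} [SigmaFinite lam]
  {Ω : Type*} [MeasurableSpace Ω] {P : Measure Ω} [IsProbabilityMeasure P]
  {η : ℝ → Ω → Measure X} {m : Fin l → ℕ} {f : (i : Fin l) → (Fin (m i) → X) → ℝ}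

/-- The expectation of a smooth function of the normalized U-statistics differs by at most
`O(t^{-1/2})` from that of their linear parts. -/
lemma abs_integral_normUStat_sub_le
    (hη : ∀ t : ℝ, 0 < t → IsPoissonProcess (η t) (ENNReal.ofReal t • lam) P)
    (hm : ∀ i, 1 ≤ m i) (hf : ∀ i, IsSymmKernel lam (m i) (f i))
    (hf2 : ∀ i, ∀ n : ℕ, 1 ≤ n → n ≤ m i →
      MemLp (projInt lam (f i) n) 2 (Measure.pi fun _ => lam))
    (hφm : ∀ i, Measurable (projKernelOne lam (f i)))
    (hφ : ∀ i, Integrable (projKernelOne lam (f i)) lam)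
    (hφ2 : ∀ i, MemLp (projKernelOne lam (f i)) 2 lam)
    {M : ℝ} {h : EuclideanSpace ℝ (Fin l) → ℝ} (hM : 0 ≤ M) (hh : HasBoundedDerivs M h) {t : ℝ}
    (ht : 1 ≤ t) {a : Fin l → ℝ} (ha : ∀ i, a i ≠ 0) :
    |∫ ω, h (WithLp.toLp 2 fun i => normUStat P (η t) t (a i) (f i) ω) ∂P -
        ∫ ω, h (linearVector (η t) (ENNReal.ofReal t • lam) (fun i => projKernelOne lam (f i))
          (t ^ (-(1 / 2 : ℝ))) ω) ∂P| ≤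
      M * (∑ i, ∫ x, projKernelOne lam (f i) x ^ 2 ∂lam +
        2 * (∑ i, remainderBound lam (f i)).toReal ^ 2) * t ^ (-(1 / 2 : ℝ)) := by
  have ht0 : 0 < t := by linarith
  have j := sigmaFinite_ofReal_smul (lam := lam) t
  choose R hR2 hR0 hRn hRe using fun i =>
    (hη t ht0).exists_remainder ht rfl (hm i) (hf i) (hf2 i) (ha i)
  set c : ℝ := t ^ (-(1 / 2 : ℝ)) with hc
  have hc0 : 0 < c := Real.rpow_pos_of_pos ht0 _
  have hc1 : c ≤ 1 := Real.rpow_le_one_of_one_le_of_nonpos ht (by norm_num)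
  have hc2 : c ^ 2 = t⁻¹ := by
    rw [hc, ← Real.rpow_natCast, ← Real.rpow_mul ht0.le, ← Real.rpow_neg_one]
    norm_num
  set φ : Fin l → X → ℝ := fun i => projKernelOne lam (f i) with hφdef
  set V := linearVector (η t) (ENNReal.ofReal t • lam) φ c with hVdef
  set B := (∑ i, remainderBound lam (f i)).toReal with hB
  have hφt : ∀ i, Integrable (φ i) (ENNReal.ofReal t • lam) := fun i =>
    (hφ i).smul_measure ENNReal.ofReal_ne_top
  have hφ2t : ∀ i, MemLp (φ i) 2 (ENNReal.ofReal t • lam) := fun i =>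
    (hφ2 i).smul_measure ENNReal.ofReal_ne_top
  have hV : MemLp V 2 P := (hη t ht0).memLp_linearVector hφm hφt hφ2t c
  have hR : MemLp (fun ω => WithLp.toLp 2 fun i => R i ω : Ω → EuclideanSpace ℝ (Fin l)) 2 P :=
    MemLp.of_eval_piLp hR2
  have hBfin : ∑ i, remainderBound lam (f i) ≠ ∞ := by
    refine ENNReal.sum_ne_top.2 fun i _ => ENNReal.sum_ne_top.2 fun n hn => ?_
    obtain ⟨h2, hnm⟩ := Finset.mem_Icc.1 hn
    have := (hf2 i n (by omega) hnm).eLpNorm_ne_top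
    finiteness
  have hVn : ∫ ω, ‖V ω‖ ^ 2 ∂P = ∑ i, ∫ x, φ i x ^ 2 ∂lam := by
    simp only [EuclideanSpace.norm_sq_eq, Real.norm_eq_abs, sq_abs]
    rw [integral_finsetSum _ fun i _ => (memLp_piLp_iff.1 hV i).integrable_sq]
    refine Finset.sum_congr rfl fun i _ => ?_
    have := (hη t ht0).integral_linearVector_mul hφm hφt hφ2t c i i
    simp only [← sq] at this
    rw [hVdef, this, integral_smul_measure, ENNReal.toReal_ofReal ht0.le, hc2, smul_eq_mul,
      inv_mul_cancel_left₀ ht0.ne']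
  have hRn : ∫ ω, ‖(WithLp.toLp 2 fun i => R i ω : EuclideanSpace ℝ (Fin l))‖ ^ 2 ∂P ≤
      c ^ 2 * B ^ 2 := by
    rw [integral_norm_pow hR.1 two_ne_zero, ← mul_pow]
    gcongr
    rw [hB, ← ENNReal.toReal_ofReal hc0.le, ← ENNReal.toReal_mul, Finset.mul_sum]
    refine ENNReal.toReal_mono ?_
      ((eLpNorm_toLp_le one_le_two fun i => (hR2 i).1).trans (Finset.sum_le_sum fun i _ => hRn i))
    rw [← Finset.mul_sum]
    finiteness
  have e : ∫ ω, h (WithLp.toLp 2 fun i => normUStat P (η t) t (a i) (f i) ω) ∂P =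
      ∫ ω, h (V ω + WithLp.toLp 2 fun i => R i ω) ∂P := by
    refine integral_congr_ae ?_
    filter_upwards [ae_all_iff.2 hRe] with ω hω
    congr 1
    ext i
    exact hω i
  rw [e]
  refine (hh.abs_integral_add_sub_le hM hV hR hR0 hc0).trans ?_
  rw [hVn]
  calc M * (c * ∑ i, ∫ x, φ i x ^ 2 ∂lam + (c⁻¹ + 1) *
        ∫ ω, ‖(WithLp.toLp 2 fun i => R i ω : EuclideanSpace ℝ (Fin l))‖ ^ 2 ∂P)
      ≤ M * (c * ∑ i, ∫ x, φ i x ^ 2 ∂lam + (c⁻¹ + c⁻¹) * (c ^ 2 * B ^ 2)) := by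
        gcongr
        exact (one_le_inv₀ hc0).2 hc1
    _ = _ := by
        field_simp
        ring

end Main

end PoissonU

/-! ### The rate of convergence -/

theorem mainTheorem2
    {X : Type*} [MeasurableSpace X] (lam : Measure X) [SigmaFinite lam]
    {Ω : Type*} [MeasurableSpace Ω] (P : Measure Ω) [IsProbabilityMeasure P]
    (η : ℝ → Ω → Measure X)
    (hη : ∀ t : ℝ, 0 < t → PoissonU.IsPoissonProcess (η t) (ENNReal.ofReal t • lam) P)
    (l : ℕ) (m : Fin l → ℕ) (hm : ∀ i, 1 ≤ m i)
    (f : (i : Fin l) → (Fin (m i) → X) → ℝ)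
    (hf : ∀ i, PoissonU.IsSymmKernel lam (m i) (f i))
    (hf2 : ∀ i, ∀ n : ℕ, 1 ≤ n → n ≤ m i →
      MemLp (PoissonU.projKernel lam (f i) n) 2 (Measure.pi fun _ => lam))
    (hf3 : ∀ i, Integrable (fun x => |PoissonU.projKernelOne lam (f i) x| ^ 3) lam)
    (g : Fin l → ℝ → ℝ)
    {Ω' : Type*} [MeasurableSpace Ω'] (Q : Measure Ω') [IsProbabilityMeasure Q]
    (N : Ω' → EuclideanSpace ℝ (Fin l)) (hN : HasGaussianLaw N Q)
    (hN_mean : ∀ i, ∫ ω, N ω i ∂Q = 0)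
    (hN_cov : ∀ i j, cov[fun ω => N ω i, fun ω => N ω j; Q] =
      ∫ x, PoissonU.projKernelOne lam (f i) x * PoissonU.projKernelOne lam (f j) x ∂lam) :
    (∀ t : ℝ, 0 < t → ∀ i,
      (∀ᵐ ω ∂P, Integrable (f i) (PoissonU.factorialMeasure (η t ω) (m i))) ∧
        MemLp (PoissonU.uStat (η t) (g i t) (f i)) 2 P) ∧
    ∃ c : ℝ, 0 < c ∧ ∀ t : ℝ, 1 ≤ t → (∀ i, g i t ≠ 0) →
      PoissonU.d3 P
          (fun ω => WithLp.toLp 2 fun i => PoissonU.normUStat P (η t) t (g i t) (f i) ω) Q N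
        ≤ ENNReal.ofReal (c * t ^ (-(1 / 2 : ℝ))) := by
  have hproj : ∀ i, ∀ n : ℕ, 1 ≤ n → n ≤ m i →
      MemLp (PoissonU.projInt lam (f i) n) 2 (Measure.pi fun _ => lam) := fun i n h1 hn =>
    PoissonU.memLp_projInt_of_projKernel hn (hf2 i n h1 hn)
  set φ : Fin l → X → ℝ := fun i => PoissonU.projKernelOne lam (f i) with hφdef
  have hφm : ∀ i, Measurable (φ i) := fun i =>
    ((PoissonU.measurable_projInt (hf i).1).comp PoissonU.measurable_const_fin_one).const_mul _
  have hφ : ∀ i, Integrable (φ i) lam := fun i =>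
    (PoissonU.measurePreserving_const_fin_one.integrable_comp_of_integrable
      (PoissonU.isSymmKernel_projInt_one (hm i) (hf i)).2.2).const_mul _
  have hφ2 : ∀ i, MemLp (φ i) 2 lam := fun i =>
    (hf2 i 1 le_rfl (hm i)).comp_measurePreserving PoissonU.measurePreserving_const_fin_one
  have hφ3 : ∀ i, MemLp (φ i) 3 lam := fun i => by
    refine (integrable_norm_rpow_iff (hφm i).aestronglyMeasurable (by norm_num) (by norm_num)).1 ?_
    simpa using hf3 i
  refine ⟨fun t ht i => ?_, ?_⟩
  · have := PoissonU.sigmaFinite_ofReal_smul (lam := lam) t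
    exact ⟨(hη t ht).ae_integrable_factorialMeasure ((hf i).smul_measure rfl),
      (hη t ht).memLp_uStat ht rfl (hf i) (hproj i) (g i t)⟩
  have hN2 : ∀ i, MemLp (fun ω => N ω i) 2 Q := memLp_piLp_iff.1 hN.memLp_two
  have hcov : ∀ i j, ∫ ω, N ω i * N ω j ∂Q = ∫ x, φ i x * φ j x ∂lam := fun i j => by
    rw [← hN_cov i j, covariance_eq_sub (hN2 i) (hN2 j), hN_mean, zero_mul, sub_zero]
    rfl
  set A : ℝ := ∑ i, ∫ x, φ i x ^ 2 ∂lam +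
    2 * (∑ i, PoissonU.remainderBound lam (f i)).toReal ^ 2 with hA
  set B : ℝ := 2 * ((∑ i, PoissonU.cubeBound lam (φ i)).toReal ^ 3 + ∫ ω, ‖N ω‖ ^ 3 ∂Q) with hB
  have hA0 : 0 ≤ A := by
    have : 0 ≤ ∑ i, ∫ x, φ i x ^ 2 ∂lam :=
      Finset.sum_nonneg fun i _ => integral_nonneg fun x => sq_nonneg _
    positivity
  have hB0 : 0 ≤ B := by
    have : 0 ≤ ∫ ω, ‖N ω‖ ^ 3 ∂Q := integral_nonneg fun ω => by positivity
    positivity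
  -- one is added to make the constant positive
  refine ⟨(l + 1 : ℝ) ^ 3 * (A + B) + 1, by positivity, fun t ht hg => ?_⟩
  refine iSup₂_le fun h hh => ENNReal.ofReal_le_ofReal ?_
  have hb := PoissonU.hasBoundedDerivs_of_mem_testFunctions hh
  have hM : (0 : ℝ) ≤ (l + 1 : ℝ) ^ 3 := by positivity
  have h1 := PoissonU.abs_integral_normUStat_sub_le hη hm hf hproj hφm hφ hφ2 hM hb ht hg
  have h2 := PoissonU.abs_integral_linearVector_sub_le hη hφm hφ hφ2 hφ3 hN hN_mean hcov hM hb ht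
  have hc : 0 ≤ t ^ (-(1 / 2 : ℝ)) := Real.rpow_nonneg (by linarith) _
  refine (abs_sub_le _ _ _).trans ((add_le_add h1 h2).trans ?_)
  rw [← add_mul, ← mul_add]
  gcongr
  linarith
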